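/- Let $\mathbb K$ be an algebraically closed field of characteristic zero. A variety is an irreducible, reduced, separated scheme of finite type over $\mathbb K$. A normal affine toric variety $W$ is a normal affine variety containing a torus $\mathbb T_W\cong\mathbb G_m^d$ as a Zariski open subset such that the action of $\mathbb T_W$ on itself by multiplication extends to an algebraic action of $\mathbb T_W$ on $W$; its toric boundary $C$ is the reduction of $W\setminus\mathbb T_W$. Let $X$ be a variety, $U\subseteq X$ an open subset (possibly $U=X$), and let $D$ be the reduction of $X\setminus U$, with ideal sheaf $I_D\subset\mathcal O_X$. For a closed point $x\in X$, a *local toric model* $\{(W,C),w\}$ of $\{(X,D),x\}$ consists of a normal affine toric variety $W$ with toric boundary $C$, defined by the ideal $I_C$, and a closed point $w\in W$ such that there is an isomorphism of $\mathbb K$-algebras $\phi\colon\widehat{\mathcal O}_{X,x}\to\widehat{\mathcal O}_{W,w}$ between the completed local rings with $\phi(I_D\widehat{\mathcal O}_{X,x})=I_C\widehat{\mathcal O}_{W,w}$. The embedding $(U\subset X)$ is a *toroidal embedding* if $D$ is a divisor (every irreducible component of $D$ has codimension one in $X$) and $\{(X,D),x\}$ has a local toric model for every closed point $x\in X$. It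 is *strict* if moreover every irreducible component of $D$ is a normal variety. **Theorem.** Let $(U\subset X)$ be a strict toroidal embedding and let $D$ be the reduction of $X\setminus U$. Then for every closed point $x\in X$ and every local toric model $\{(W,C),w\}$ of $\{(X,D),x\}$, there exist an open neighbourhood $U_x\subseteq X$ of $x$ and an étale morphism $\pi\colon U_x\to W$ of $\mathbb K$-varieties such that $U\cap U_x=\pi^{-1}(\mathbb T_W)$. -/

import Mathlib

open AlgebraicGeometry CategoryTheory TensorProduct TopologicalSpace

universe u

noncomputable section

namespace Toroidal

/-! ### Varieties, normal schemes, completed local rings -/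

/-- `X`, with structure morphism `s` to `Spec K`, is a variety over `K`: an irreducible and reduced
scheme, separated and of finite type over `K`. -/
structure IsVariety {K : Type u} [Field K] {X : Scheme.{u}}
    (s : X ⟶ Spec (CommRingCat.of K)) : Prop where
  isIntegral : IsIntegral X
  isSeparated : IsSeparated s
  locallyOfFiniteType : LocallyOfFiniteType s
  quasiCompact : QuasiCompact s

/-- A scheme is normal if all of its local rings are integrally closed domains. -/
def IsNormalScheme (X : Scheme.{u}) : Prop :=
  ∀ x : X, IsDomain (X.presheaf.stalk x) ∧ IsIntegrallyClosed (X.presheaf.stalk x)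

/-- The completion of the local ring of `X` at `x` with respect to its maximal ideal. -/
abbrev CompletedStalk (X : Scheme.{u}) (x : X) : Type u :=
  AdicCompletion (IsLocalRing.maximalIdeal (X.presheaf.stalk x)) (X.presheaf.stalk x)

/-- The canonical homomorphism from the local ring to its completion. -/
def toCompletedStalk (X : Scheme.{u}) (x : X) : X.presheaf.stalk x →+* CompletedStalk X x :=
  algebraMap (X.presheaf.stalk x) (CompletedStalk X x)

/-- The homomorphism from `K` to the local ring at `x` of the `K`-scheme `s : X ⟶ Spec K`. -/
def scalarsToStalk {K : Type u} [Field K] {X : Scheme.{u}} (s : X ⟶ Spec (CommRingCat.of K))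
    (x : X) : K →+* X.presheaf.stalk x :=
  ((Scheme.ΓSpecIso (CommRingCat.of K)).inv ≫ s.appTop ≫
    X.presheaf.germ ⊤ x trivial).hom

/-- The stalk at `x` of the ideal sheaf of the closed subset `Z` with its reduced structure. -/
def stalkIdeal {X : Scheme.{u}} (Z : Closeds X) (x : X) : Ideal (X.presheaf.stalk x) :=
  ⨆ (V : X.affineOpens) (hx : x ∈ V.1),
    ((Scheme.IdealSheafData.vanishingIdeal Z).ideal V).map (X.presheaf.germ V.1 x hx).hom

/-- The ideal that the reduced closed subscheme `Z` generates in the completed local ring. -/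
def completedIdeal {X : Scheme.{u}} (Z : Closeds X) (x : X) : Ideal (CompletedStalk X x) :=
  (stalkIdeal Z x).map (toCompletedStalk X x)

/-- The complement of an open subset, as a closed subset. -/
def boundary {X : Scheme.{u}} (U : X.Opens) : Closeds X :=
  ⟨(U : Set X)ᶜ, U.isOpen.isClosed_compl⟩

/-- `Z` is an irreducible component of the closed subset `D`. -/
def IsComponent {X : Scheme.{u}} (D Z : Closeds X) : Prop :=
  Maximal (fun S : Set X => IsIrreducible S ∧ S ⊆ (D : Set X)) (Z : Set X)

/-! ### Normal affine toric varieties -/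

/-- The coordinate ring `K[ℤᵈ]` of the torus `𝔾ₘᵈ`. Its Hopf algebra structure, which is the one of
Mathlib, is dual to the group law of the torus. -/
abbrev TorusRing (K : Type u) [Field K] (d : ℕ) : Type u :=
  AddMonoidAlgebra K (Fin d → ℤ)

/-- The structure of a normal affine toric variety of dimension `d` on `Spec A`: the variety
`Spec A` is normal, contains a torus `𝔾ₘᵈ` as an open subscheme, and carries an algebraic action of
this torus that extends the action of the torus on itself by multiplication. The action
`T × Spec A ⟶ Spec A` is given by the dual homomorphism of coordinate rings. -/
structure NormalAffineToric (K : Type u) [Field K] (A : Type u) [CommRing A] [Algebra K A] where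
  isDomain : IsDomain A
  isIntegrallyClosed : IsIntegrallyClosed A
  finiteType : Algebra.FiniteType K A
  /-- the dimension of the torus -/
  d : ℕ
  /-- restriction of functions to the torus -/
  res : A →ₐ[K] TorusRing K d
  isOpenImmersion : IsOpenImmersion (Spec.map (CommRingCat.ofHom res.toRingHom))
  /-- the torus action, on coordinate rings -/
  act : A →ₐ[K] TorusRing K d ⊗[K] A
  /-- the unit of the torus acts as the identity -/
  unit_act : ∀ a : A,
    Algebra.TensorProduct.map (Bialgebra.counitAlgHom K (TorusRing K d)) (AlgHom.id K A) (act a) =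
      1 ⊗ₜ[K] a
  /-- the action is associative -/
  act_act : ∀ a : A,
    Algebra.TensorProduct.map (AlgHom.id K (TorusRing K d)) act (act a) =
      Algebra.TensorProduct.assoc K K K (TorusRing K d) (TorusRing K d) A
        (Algebra.TensorProduct.map (Bialgebra.comulAlgHom K (TorusRing K d)) (AlgHom.id K A)
          (act a))
  /-- the action extends the multiplication of the torus -/
  act_res : ∀ a : A,
    Algebra.TensorProduct.map (AlgHom.id K (TorusRing K d)) res (act a) =
      Bialgebra.comulAlgHom K (TorusRing K d) (res a)

/-- The structure morphism of `Spec A` over `Spec K`. -/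
def specStr (K : Type u) [Field K] (A : Type u) [CommRing A] [Algebra K A] :
    Spec (CommRingCat.of A) ⟶ Spec (CommRingCat.of K) :=
  Spec.map (CommRingCat.ofHom (algebraMap K A))

/-- The torus of an affine toric variety, as an open subset. -/
def NormalAffineToric.torus {K : Type u} [Field K] {A : Type u} [CommRing A] [Algebra K A]
    (W : NormalAffineToric K A) : (Spec (CommRingCat.of A)).Opens :=
  haveI := W.isOpenImmersion
  (Spec.map (CommRingCat.ofHom W.res.toRingHom)).opensRange

/-! ### Toroidal embeddings -/

/-- The toric variety `W` with toric boundary `C = W ∖ T_W` and the closed point `w` are a local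
toric model of `(X, D)` at `x`, where `D = X ∖ U`: there is an isomorphism of `K`-algebras between
the completed local rings of `X` at `x` and of `W` at `w` that takes the ideal of `D` to the
ideal of `C`. -/
def IsLocalToricModel {K : Type u} [Field K] {X : Scheme.{u}} (s : X ⟶ Spec (CommRingCat.of K))
    (U : X.Opens) (x : X) {A : Type u} [CommRing A] [Algebra K A] (W : NormalAffineToric K A)
    (w : Spec (CommRingCat.of A)) : Prop :=
  IsClosed ({w} : Set (Spec (CommRingCat.of A))) ∧
  ∃ φ : CompletedStalk X x ≃+* CompletedStalk (Spec (CommRingCat.of A)) w,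
    (∀ c : K, φ (toCompletedStalk X x (scalarsToStalk s x c)) =
      toCompletedStalk (Spec (CommRingCat.of A)) w (scalarsToStalk (specStr K A) w c)) ∧
    (completedIdeal (boundary U) x).map (φ : CompletedStalk X x →+* _) =
      completedIdeal (boundary W.torus) w

/-- `(U ⊂ X)` is a toroidal embedding: `D = X ∖ U` is a divisor, that is, each of its irreducible
components has codimension one, and `(X, D)` has a local toric model at every closed point. -/
structure IsToroidalEmbedding {K : Type u} [Field K] {X : Scheme.{u}}
    (s : X ⟶ Spec (CommRingCat.of K)) (U : X.Opens) : Prop where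
  isDivisor : ∀ Z : Closeds X, IsComponent (boundary U) Z →
    ∀ z : X, IsGenericPoint z (Z : Set X) → ringKrullDim (X.presheaf.stalk z) = 1
  exists_model : ∀ x : X, IsClosed ({x} : Set X) →
    ∃ (A : Type u) (_ : CommRing A) (_ : Algebra K A) (W : NormalAffineToric K A)
      (w : Spec (CommRingCat.of A)), IsLocalToricModel s U x W w

/-- A toroidal embedding is strict (without self-intersection) if every irreducible component of
`D = X ∖ U`, with its reduced structure, is normal. -/
structure IsStrictToroidalEmbedding {K : Type u} [Field K] {X : Scheme.{u}}
    (s : X ⟶ Spec (CommRingCat.of K)) (U : X.Opens) : Prop extends IsToroidalEmbedding s U where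
  isNormal_component : ∀ Z : Closeds X, IsComponent (boundary U) Z →
    IsNormalScheme (Scheme.IdealSheafData.vanishingIdeal Z).subscheme

end Toroidal

end

/-!
# Étale charts of strict toroidal embeddings

Let `O` be the local ring of `X` at `x`, let `A` be the coordinate ring of the affine toric variety
`W`, and let `R` be its local ring at `w`. The given isomorphism `φ` identifies the completions of
`O` and `R` with one ring `C`. The point of the proof is to replace the formal coordinates that `φ`
provides by algebraic ones without leaving the Zariski topology: to find a homomorphism `ψ : A → O`
that agrees with `A → C` modulo the square of the maximal ideal and carries the equation of the
toric boundary to an equation of `D`.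

*Components.* A prime of a local ring of a variety whose quotient is normal stays prime in the
completion (`isPrime_map_adicCompletion`). By Noether normalization the completion is generated by
the coordinate ring over a power series ring, which is integrally closed. A factorization there of
the minimal polynomial of a primitive element yields an idempotent, and a local ring has no
nontrivial one (`IsCompletion.isDomain`). That the idempotent lies in the completion, and not only
in its total ring of fractions, is a divisibility that is checked at the associated primes of a
principal ideal of the normal ring (`algebraMap_dvd_of_sq_eq_mul`). The components of the toric
boundary are normal, as their coordinate rings are retracts of `A`
(`NormalAffineToric.isIntegrallyClosed_quotient`), and those of `D` are normal by strictness. Hence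
`φ` matches the components of `D` through `x` with those of the toric boundary through `w`
(`exists_isPrime_map_eq_map`). Without strictness a component of `D` could split in the completion,
and this step would fail.

*Monomials.* Every monomial divides a power of the product `m₀` of a finite system of generating
monomials, so that its divisor is supported on the toric boundary. The principal ideal which it
generates in `C` is then an intersection of symbolic powers of primes that are extended from `O`,
so that it is itself extended from `O`; an extended principal ideal of a local ring has a generator
among the extended elements (`exists_associated_algebraMap`). Thus each monomial is a unit of `C`
times an element of `O`, and the unit may be taken congruent to `1` modulo the square of the
maximal ideal. As the group of characters of the torus is free, these choices can be made
multiplicatively (`exists_monoidHom_of_forall_exists`), which gives `ψ`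
(`NormalAffineToric.exists_algHom_of_ringEquiv`).

*Étaleness.* Since `ψ` agrees with the completion map to first order, the composite `R → O → C`
exhibits `C` as the completion of `R` as well: modulo each power of the maximal ideal it defines a
surjective endomorphism of a Noetherian ring, which is injective (`isCompletion_of_map_eq`). So `C`
is flat over `R` and faithfully flat over `O`, whence `O` is flat over `R`; it is unramified because
the maximal ideal of `R` generates that of `O` (`formallyEtale_of_isCompletion`). Étaleness spreads
out to a neighbourhood of `x`, on which moreover `ψ m₀` and the ideal of `D` have the same radical
(`NormalAffineToric.exists_etale_of_ringEquiv`). The torus of `W` is the locus where `m₀` does not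
vanish (`NormalAffineToric.mem_torus_iff`), so its preimage is the complement of `D`.
-/

set_option linter.unusedSectionVars false

/-! ### Power series over a field are integrally closed -/

namespace Toroidal

/-- A domain is completely integrally closed if it contains every element `a / b` of its fraction
field all of whose powers have a common denominator `c`. The condition is phrased by divisibility,
without the fraction field. -/
def CompletelyIntegrallyClosed (R : Type*) [CommRing R] : Prop :=
  ∀ a b c : R, b ≠ 0 → c ≠ 0 → (∀ n : ℕ, b ^ n ∣ c * a ^ n) → b ∣ a

lemma CompletelyIntegrallyClosed.isIntegrallyClosed {R : Type*} [CommRing R] [IsDomain R]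
    (h : CompletelyIntegrallyClosed R) : IsIntegrallyClosed R := by
  refine (isIntegrallyClosed_iff (FractionRing R)).mpr fun {x} hx => ?_
  obtain ⟨c, hc, hcx⟩ := hx.isAlmostIntegral
  obtain ⟨a, b, hb, rfl⟩ := IsFractionRing.div_surjective (A := R) x
  have hb0 : b ≠ 0 := nonZeroDivisors.ne_zero hb
  have hb0' : algebraMap R (FractionRing R) b ≠ 0 := by simpa using hb0
  obtain ⟨q, rfl⟩ := h a b c hb0 (nonZeroDivisors.ne_zero hc) fun n => by
    obtain ⟨r, hr⟩ := hcx n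
    refine ⟨r, IsFractionRing.injective R (FractionRing R) ?_⟩
    rw [Algebra.smul_def] at hr
    rw [map_mul, map_mul, hr, map_pow, map_pow, div_pow]
    field_simp
  exact ⟨q, by rw [map_mul]; field_simp⟩

lemma completelyIntegrallyClosed_of_isNoetherianRing (R : Type*) [CommRing R] [IsDomain R]
    [IsNoetherianRing R] [IsIntegrallyClosed R] : CompletelyIntegrallyClosed R := by
  intro a b c hb hc h
  have hb0' : algebraMap R (FractionRing R) b ≠ 0 := by simpa using hb
  have : IsAlmostIntegral R (algebraMap R (FractionRing R) a / algebraMap R _ b) := by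
    refine ⟨c, mem_nonZeroDivisors_of_ne_zero hc, fun n => ?_⟩
    obtain ⟨r, hr⟩ := h n
    refine ⟨r, ?_⟩
    rw [Algebra.smul_def, div_pow, ← mul_div_assoc, ← map_pow, ← map_mul, hr]
    simp [mul_comm, hb0']
  obtain ⟨y, hy⟩ := IsIntegrallyClosed.isIntegral_iff.mp this.isIntegral
  refine ⟨y, IsFractionRing.injective R (FractionRing R) ?_⟩
  rw [map_mul, hy]
  field_simp

lemma CompletelyIntegrallyClosed.of_ringEquiv {R S : Type*} [CommRing R] [CommRing S] (e : R ≃+* S)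
    (h : CompletelyIntegrallyClosed R) : CompletelyIntegrallyClosed S := by
  intro a b c hb hc H
  have := h (e.symm a) (e.symm b) (e.symm c) (by simpa using hb) (by simpa using hc) fun n => by
    simpa using map_dvd e.symm (H n)
  simpa using map_dvd e this

/-- The coefficients of a power series over the fraction field that is almost integral over `R⟦X⟧`
are almost integral over `R`: split off the constant term and divide by `X`. -/
lemma CompletelyIntegrallyClosed.coeff_mem_range {R : Type*} [CommRing R] [IsDomain R]
    (h : CompletelyIntegrallyClosed R) (c : PowerSeries R) (hc : PowerSeries.coeff 0 c ≠ 0)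
    (i : ℕ) : ∀ f : PowerSeries (FractionRing R),
      (∀ n : ℕ, ∃ r : PowerSeries R, PowerSeries.map (algebraMap R (FractionRing R)) c * f ^ n =
        PowerSeries.map (algebraMap R (FractionRing R)) r) →
      ∃ r : R, PowerSeries.coeff i f = algebraMap R (FractionRing R) r := by
  have key : ∀ f : PowerSeries (FractionRing R),
      (∀ n : ℕ, ∃ r : PowerSeries R, PowerSeries.map (algebraMap R (FractionRing R)) c * f ^ n =
        PowerSeries.map (algebraMap R (FractionRing R)) r) →
      ∃ r : R, PowerSeries.coeff 0 f = algebraMap R (FractionRing R) r := by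
    intro f hf
    obtain ⟨a, b, hb, hab⟩ := IsFractionRing.div_surjective (A := R) (PowerSeries.coeff 0 f)
    have hb0 : b ≠ 0 := nonZeroDivisors.ne_zero hb
    have hb0' : algebraMap R (FractionRing R) b ≠ 0 := by simpa using hb0
    obtain ⟨q, rfl⟩ := h a b (PowerSeries.coeff 0 c) hb0 hc fun n => by
      obtain ⟨r, hr⟩ := hf n
      refine ⟨PowerSeries.coeff 0 r, IsFractionRing.injective R (FractionRing R) ?_⟩
      have := congrArg PowerSeries.constantCoeff hr
      simp only [map_mul, map_pow, ← PowerSeries.coeff_zero_eq_constantCoeff_apply,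
        PowerSeries.coeff_map] at this
      rw [map_mul, map_mul, ← this, ← hab, map_pow, map_pow, div_pow]
      field_simp
    exact ⟨q, by rw [← hab, map_mul]; field_simp⟩
  induction i with
  | zero => exact key
  | succ i ih =>
    intro f hf
    obtain ⟨r₀, hr₀⟩ := key f hf
    obtain ⟨g, hg⟩ : PowerSeries.X ∣ f - PowerSeries.C (PowerSeries.coeff 0 f) := by
      rw [PowerSeries.X_dvd_iff]; simp
    have hcoef : PowerSeries.coeff (i + 1) f = PowerSeries.coeff i g := by
      have := congrArg (PowerSeries.coeff (i + 1)) hg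
      rw [PowerSeries.coeff_succ_X_mul] at this
      rw [← this]; simp
    rw [hcoef]
    refine ih g fun n => ?_
    -- the powers of `f - C f₀` also have common denominator `c`
    have h1 : ∃ r : PowerSeries R, PowerSeries.map (algebraMap R (FractionRing R)) c *
        (f - PowerSeries.C (PowerSeries.coeff 0 f)) ^ n =
        PowerSeries.map (algebraMap R (FractionRing R)) r := by
      have hC : PowerSeries.C (PowerSeries.coeff 0 f) =
          PowerSeries.map (algebraMap R (FractionRing R)) (PowerSeries.C r₀) := by
        rw [hr₀]; simp
      choose r hr using hf
      refine ⟨∑ m ∈ Finset.range (n + 1),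
        r m * (-PowerSeries.C r₀) ^ (n - m) * (n.choose m : PowerSeries R), ?_⟩
      rw [sub_eq_add_neg, add_pow, Finset.mul_sum, map_sum]
      refine Finset.sum_congr rfl fun m _ => ?_
      rw [map_mul, map_mul, map_pow, map_neg, ← hr, hC, map_natCast]
      ring
    obtain ⟨r, hr⟩ := h1
    refine ⟨PowerSeries.mk fun j => PowerSeries.coeff (j + n) r, ?_⟩
    ext j
    have := congrArg (PowerSeries.coeff (j + n)) hr
    rw [hg, mul_pow, mul_left_comm, PowerSeries.coeff_X_pow_mul] at this
    rw [this]; simp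

/-- Power series over a completely integrally closed domain form a completely integrally closed
domain. -/
lemma CompletelyIntegrallyClosed.powerSeries {R : Type*} [CommRing R] [IsDomain R]
    (h : CompletelyIntegrallyClosed R) : CompletelyIntegrallyClosed (PowerSeries R) := by
  intro a b c hb hc H
  let k := FractionRing R
  let φ : PowerSeries R →+* PowerSeries k := PowerSeries.map (algebraMap R k)
  have hφ : Function.Injective φ := by
    intro p q hpq
    ext i
    have := congrArg (PowerSeries.coeff i) hpq
    simpa [φ] using this
  obtain ⟨f, hf⟩ := completelyIntegrallyClosed_of_isNoetherianRing (PowerSeries k) (φ a) (φ b) (φ c)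
    (by simpa using hφ.ne hb) (by simpa using hφ.ne hc) fun n => by
      simpa using map_dvd φ (H n)
  have hcf : ∀ n : ℕ, ∃ r, φ c * f ^ n = φ r := by
    intro n
    obtain ⟨r, hr⟩ := H n
    refine ⟨r, ?_⟩
    have hbn : φ b ^ n ≠ 0 := pow_ne_zero _ (by simpa using hφ.ne hb)
    apply mul_left_cancel₀ hbn
    rw [← map_pow, ← map_mul, ← hr, map_mul, map_pow, map_pow, hf]
    ring
  obtain ⟨c', hc'⟩ := PowerSeries.X_pow_order_dvd (φ := c)
  have hc0 : PowerSeries.coeff 0 c' ≠ 0 := by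
    have h1 := PowerSeries.coeff_order hc
    rw [hc'] at h1
    have h2 := PowerSeries.coeff_X_pow_mul c' c.order.toNat 0
    rw [zero_add] at h2
    rw [← h2, ← hc']
    exact PowerSeries.coeff_order hc
  have hc'f : ∀ n : ℕ, ∃ r, φ c' * f ^ n = φ r := by
    intro n
    obtain ⟨r, hr⟩ := hcf n
    refine ⟨PowerSeries.mk fun j => PowerSeries.coeff (j + c.order.toNat) r, ?_⟩
    ext j
    have := congrArg (PowerSeries.coeff (j + c.order.toNat)) hr
    have hcφ : φ c = PowerSeries.X ^ c.order.toNat * φ c' := by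
      conv_lhs => rw [hc']
      rw [map_mul, map_pow]
      congr 2
      exact PowerSeries.map_X _
    rw [hcφ, mul_assoc, PowerSeries.coeff_X_pow_mul] at this
    rw [this]; simp [φ]
  choose q hq using fun i => h.coeff_mem_range c' hc0 i f hc'f
  refine ⟨PowerSeries.mk q, hφ ?_⟩
  rw [hf, map_mul]
  congr 1
  ext i
  rw [hq i]
  simp [φ, k]

instance isDomain_mvPowerSeries (K : Type*) [Field K] (n : ℕ) :
    IsDomain (MvPowerSeries (Fin n) K) :=
  NoZeroDivisors.to_isDomain _

lemma completelyIntegrallyClosed_mvPowerSeries (K : Type*) [Field K] (n : ℕ) :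
    CompletelyIntegrallyClosed (MvPowerSeries (Fin n) K) := by
  induction n with
  | zero =>
    exact (completelyIntegrallyClosed_of_isNoetherianRing K).of_ringEquiv
      (MvPowerSeries.isEmptyEquiv (Fin 0) K).toRingEquiv.symm
  | succ n ih =>
    exact ih.powerSeries.of_ringEquiv (MvPowerSeries.finSuccEquiv K n).toRingEquiv.symm

instance isIntegrallyClosed_mvPowerSeries (K : Type*) [Field K] (n : ℕ) :
    IsIntegrallyClosed (MvPowerSeries (Fin n) K) :=
  (completelyIntegrallyClosed_mvPowerSeries K n).isIntegrallyClosed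

end Toroidal

/-! ### Generically étale finite extensions and their base change -/

namespace Toroidal

section FiniteExtension

open Polynomial

variable (S A : Type*) [CommRing S] [IsDomain S] [CommRing A] [IsDomain A] [Algebra S A]
  [FaithfulSMul S A] [Module.Finite S A]

/-- A finite extension of domains of characteristic zero is generated by one element `θ`, up to a
common denominator `δ`: the primitive element theorem for the fraction fields. -/
lemma exists_smul_mem_adjoin_singleton [CharZero S] :
    ∃ (θ : A) (δ : S), δ ≠ 0 ∧ ∀ a : A, δ • a ∈ Algebra.adjoin S {θ} := by
  let F := FractionRing S
  let L := FractionRing A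
  let : Algebra F L := FractionRing.liftAlgebra S L
  have : IsScalarTower S F L := FractionRing.isScalarTower_liftAlgebra S L
  have : Algebra.IsAlgebraic S A := inferInstance
  have hloc : IsLocalization (Algebra.algebraMapSubmonoid A (nonZeroDivisors S)) L := inferInstance
  have : FiniteDimensional F L := .of_isLocalization S A (nonZeroDivisors S)
  have : CharZero F := charZero_of_injective_algebraMap (IsFractionRing.injective S F)
  obtain ⟨α, hα⟩ := Field.exists_primitive_element F L
  obtain ⟨θ, ⟨_, s, hs, rfl⟩, hθ⟩ :=
    IsLocalization.exists_mk'_eq (Algebra.algebraMapSubmonoid A (nonZeroDivisors S)) α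
  -- clear denominators of the primitive element
  have hθα : algebraMap A L θ = (algebraMap S F s) • α := by
    rw [← hθ, Algebra.smul_def, ← IsScalarTower.algebraMap_apply, IsScalarTower.algebraMap_apply S A,
      mul_comm]
    exact (IsLocalization.mk'_spec L θ _).symm
  have hs0 : algebraMap S F s ≠ 0 := by
    simpa using nonZeroDivisors.ne_zero hs
  have htop : Algebra.adjoin F {algebraMap A L θ} = ⊤ := by
    rw [eq_top_iff, ← IntermediateField.top_toSubalgebra, ← hα,
      IntermediateField.adjoin_simple_toSubalgebra_of_isAlgebraic
        (Algebra.IsAlgebraic.isAlgebraic α)]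
    refine Algebra.adjoin_le ?_
    rw [Set.singleton_subset_iff, hθα]
    have := (Algebra.adjoin F {(algebraMap S F s) • α}).smul_mem
      (Algebra.self_mem_adjoin_singleton F _) (algebraMap S F s)⁻¹
    rwa [smul_smul, inv_mul_cancel₀ hs0, one_smul] at this
  have key : ∀ a : A, ∃ δ : S, δ ≠ 0 ∧ δ • a ∈ Algebra.adjoin S {θ} := by
    intro a
    have ha : algebraMap A L a ∈ Algebra.adjoin F {algebraMap A L θ} := htop ▸ trivial
    rw [Algebra.adjoin_singleton_eq_range_aeval] at ha
    obtain ⟨p, hp⟩ := ha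
    obtain ⟨b, hbm, hb⟩ := IsLocalization.integerNormalization_spec (nonZeroDivisors S) p
    refine ⟨b, nonZeroDivisors.ne_zero hbm, ?_⟩
    rw [Algebra.adjoin_singleton_eq_range_aeval]
    refine ⟨IsLocalization.integerNormalization (nonZeroDivisors S) p,
      IsFractionRing.injective A L ?_⟩
    change algebraMap A L (aeval θ _) = _
    rw [← aeval_algebraMap_apply, ← aeval_map_algebraMap F, hb]
    have hp' : aeval (algebraMap A L θ) p = algebraMap A L a := hp
    rw [← IsScalarTower.algebraMap_smul F b p, map_smul, hp',
      Algebra.smul_def, Algebra.smul_def, map_mul, ← IsScalarTower.algebraMap_apply S A L,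
      ← IsScalarTower.algebraMap_apply S F L]
  choose δ hδ hδ' using key
  obtain ⟨t, ht⟩ := Module.Finite.fg_top (R := S) (M := A)
  refine ⟨θ, ∏ a ∈ t, δ a, Finset.prod_ne_zero_iff.mpr fun a _ => hδ a, fun a => ?_⟩
  have ha : a ∈ Submodule.span S (t : Set A) := ht ▸ trivial
  induction ha using Submodule.span_induction with
  | mem x hx =>
    classical
    rw [← Finset.prod_erase_mul _ _ hx, mul_smul]
    exact Subalgebra.smul_mem _ (hδ' x) _
  | zero => simp
  | add x y _ _ hx hy => rw [smul_add]; exact add_mem hx hy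
  | smul r x _ hx => rw [smul_comm]; exact Subalgebra.smul_mem _ hx _

variable {S A}

/-- In characteristic zero the derivative of the minimal polynomial of `θ` does not vanish
at `θ`. -/
lemma aeval_derivative_minpoly_ne_zero [CharZero S] [IsIntegrallyClosed S] (θ : A) :
    aeval θ (derivative (minpoly S θ)) ≠ 0 := by
  intro h
  have hθ : IsIntegral S θ := Algebra.IsIntegral.isIntegral θ
  have hne : derivative (minpoly S θ) ≠ 0 := by
    intro h0
    have := derivative_eq_zero.mp h0
    exact (minpoly.natDegree_pos hθ).ne' this
  have h1 := minpoly.IsIntegrallyClosed.degree_le_of_ne_zero hne h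
  exact absurd h1 (not_le.mpr (degree_derivative_lt (minpoly.ne_zero hθ)))

/-- Over any field containing `S`, the minimal polynomial of `θ` over `S` is squarefree. -/
lemma squarefree_map_minpoly [CharZero S] [IsIntegrallyClosed S] (θ : A) {F : Type*} [Field F]
    [Algebra S F] [FaithfulSMul S F] :
    Squarefree ((minpoly S θ).map (algebraMap S F)) := by
  have hθ : IsIntegral S θ := Algebra.IsIntegral.isIntegral θ
  let F₀ := FractionRing S
  let L := FractionRing A
  let : Algebra F₀ L := FractionRing.liftAlgebra S L
  have : IsScalarTower S F₀ L := FractionRing.isScalarTower_liftAlgebra S L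
  have : CharZero F₀ := charZero_of_injective_algebraMap (IsFractionRing.injective S F₀)
  let : Algebra F₀ F := FractionRing.liftAlgebra S F
  have : IsScalarTower S F₀ F := FractionRing.isScalarTower_liftAlgebra S F
  have h1 : minpoly F₀ (algebraMap A L θ) = (minpoly S θ).map (algebraMap S F₀) :=
    minpoly.isIntegrallyClosed_eq_field_fractions F₀ L hθ
  have h2 : Irreducible ((minpoly S θ).map (algebraMap S F₀)) := by
    rw [← h1]
    exact minpoly.irreducible ((hθ.map (IsScalarTower.toAlgHom S A L)).tower_top)
  rw [IsScalarTower.algebraMap_eq S F₀ F, ← Polynomial.map_map]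
  exact (h2.separable.map).squarefree

variable (P : Type*) [CommRing P] [IsDomain P] [Algebra S P] [FaithfulSMul S P] [Module.Flat S P]

/-- Multiplication by the common denominator embeds the base change of `A` into the free module
with basis the powers of `θ`. -/
lemma exists_injective_mul_denominator {θ : A} {δ : S} (hδ : δ ≠ 0)
    (h : ∀ a : A, δ • a ∈ Algebra.adjoin S {θ}) :
    ∃ f : P ⊗[S] A →ₗ[P] P ⊗[S] Algebra.adjoin S {θ}, Function.Injective f ∧
      ∀ b, Algebra.TensorProduct.map (AlgHom.id P P) (Algebra.adjoin S {θ}).val (f b) =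
        algebraMap S P δ • b := by
  let f₀ : A →ₗ[S] Algebra.adjoin S {θ} :=
    LinearMap.codRestrict (Subalgebra.toSubmodule (Algebra.adjoin S {θ})) (δ • LinearMap.id)
      fun a => h a
  have hf₀ : Function.Injective f₀ := by
    intro a b hab
    have : δ • a = δ • b := congrArg Subtype.val hab
    rw [Algebra.smul_def, Algebra.smul_def] at this
    exact mul_left_cancel₀ (by simpa using hδ) this
  refine ⟨f₀.baseChange P, Module.Flat.lTensor_preserves_injective_linearMap f₀ hf₀, fun b => ?_⟩
  induction b with
  | zero => simp
  | add x y hx hy => rw [map_add, map_add, hx, hy, smul_add]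
  | tmul p a =>
    rw [LinearMap.baseChange_tmul, Algebra.TensorProduct.map_tmul]
    change p ⊗ₜ[S] (δ • a) = _
    rw [TensorProduct.tmul_smul, algebraMap_smul]

lemma aeval_one_tmul_map_minpoly (θ : A) :
    aeval ((1 : P) ⊗ₜ[S] (⟨θ, Algebra.self_mem_adjoin_singleton S θ⟩ :
      Algebra.adjoin S {θ})) ((minpoly S θ).map (algebraMap S P)) = 0 := by
  have h1 : aeval (⟨θ, Algebra.self_mem_adjoin_singleton S θ⟩ : Algebra.adjoin S {θ})
      (minpoly S θ) = 0 := by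
    apply Subtype.ext
    rw [← Subalgebra.coe_val, ← aeval_algHom_apply]
    exact minpoly.aeval S θ
  have h2 := congrArg
    (Algebra.TensorProduct.includeRight : Algebra.adjoin S {θ} →ₐ[S] P ⊗[S] _) h1
  rw [← aeval_algHom_apply, map_zero] at h2
  rw [aeval_map_algebraMap]
  exact h2

/-- A polynomial relation for `θ` in the base change is a multiple of its minimal polynomial. -/
lemma map_minpoly_dvd_of_aeval_eq_zero [IsIntegrallyClosed S] (θ : A) (q : P[X])
    (hq : aeval ((1 : P) ⊗ₜ[S] (⟨θ, Algebra.self_mem_adjoin_singleton S θ⟩ :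
      Algebra.adjoin S {θ})) q = 0) :
    (minpoly S θ).map (algebraMap S P) ∣ q := by
  have hθ : IsIntegral S θ := Algebra.IsIntegral.isIntegral θ
  set f := (minpoly S θ).map (algebraMap S P) with hf
  have hfm : f.Monic := (minpoly.monic hθ).map _
  set D := Algebra.adjoin S {θ}
  set t : D := ⟨θ, Algebra.self_mem_adjoin_singleton S θ⟩ with ht
  have haev : aeval ((1 : P) ⊗ₜ[S] t) f = 0 := aeval_one_tmul_map_minpoly P θ
  rw [← Polynomial.modByMonic_eq_zero_iff_dvd hfm]
  set r := q %ₘ f with hr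
  have hraev : aeval ((1 : P) ⊗ₜ[S] t) r = 0 := by
    rw [← hq, ← Polynomial.modByMonic_add_div q f, map_add, map_mul, haev, zero_mul, add_zero]
  have hdeg : r.degree < f.degree := degree_modByMonic_lt q hfm
  let pb := Algebra.adjoin.powerBasis' hθ
  have hdim : pb.dim = f.natDegree := by
    rw [hf, (minpoly.monic hθ).natDegree_map]
    rfl
  have hgen : pb.gen = t := by
    apply Subtype.ext; simp [pb, t]
  let bs := pb.basis.baseChange P
  have hsum : ∑ i : Fin pb.dim, r.coeff i • bs i = 0 := by
    rw [← hraev, aeval_eq_sum_range' (n := pb.dim), Finset.sum_range]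
    · refine Finset.sum_congr rfl fun i _ => ?_
      simp only [bs, Module.Basis.baseChange_apply, PowerBasis.basis_eq_pow, hgen,
        Algebra.TensorProduct.tmul_pow, one_pow]
    · rw [hdim]
      by_cases hr0 : r = 0
      · rw [hr0, natDegree_zero, hf, (minpoly.monic hθ).natDegree_map]
        exact minpoly.natDegree_pos hθ
      · exact natDegree_lt_natDegree hr0 hdeg
  have hzero := Fintype.linearIndependent_iff.mp bs.linearIndependent _ hsum
  ext i
  by_cases hi : i < pb.dim
  · exact hzero ⟨i, hi⟩
  · rw [coeff_zero]
    refine coeff_eq_zero_of_degree_lt (hdeg.trans_le ?_)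
    rw [degree_eq_natDegree hfm.ne_zero, ← hdim]
    exact_mod_cast not_lt.mp hi

variable [CharZero S] [IsIntegrallyClosed S]

variable (S A)

/-- The base change of a finite extension of `S` to a flat extension domain `P` has no
`P`-torsion. -/
lemma eq_zero_of_smul_tensor_eq_zero (p : P) (hp : p ≠ 0) (b : P ⊗[S] A) (h : p • b = 0) :
    b = 0 := by
  obtain ⟨θ, δ, hδ, hA⟩ := exists_smul_mem_adjoin_singleton S A
  obtain ⟨f, hf, -⟩ := exists_injective_mul_denominator P hδ hA
  let bs := (Algebra.adjoin.powerBasis' (Algebra.IsIntegral.isIntegral (R := S) θ)).basis.baseChange P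
  apply hf
  have h1 : p • f b = 0 := by rw [← map_smul, h, map_zero]
  rw [map_zero]
  refine bs.ext_elem fun i => ?_
  have h2 : bs.repr (p • f b) i = 0 := by
    rw [h1, LinearEquiv.map_zero bs.repr, Finsupp.zero_apply]
  have h3 : bs.repr (p • f b) = p • bs.repr (f b) := LinearEquiv.map_smul bs.repr p (f b)
  rw [h3, Finsupp.smul_apply, smul_eq_mul] at h2
  rw [(mul_eq_zero.mp h2).resolve_left hp, LinearEquiv.map_zero bs.repr, Finsupp.zero_apply]

/-- The base change of a finite extension of `S` to a flat extension domain `P` is reduced, as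
the extension is generically separable. -/
lemma isReduced_tensor : IsReduced (P ⊗[S] A) := by
  obtain ⟨θ, δ, hδ, hA⟩ := exists_smul_mem_adjoin_singleton S A
  obtain ⟨f, hf, hf'⟩ := exists_injective_mul_denominator P hδ hA
  have hθ : IsIntegral S θ := Algebra.IsIntegral.isIntegral θ
  let t : Algebra.adjoin S {θ} := ⟨θ, Algebra.self_mem_adjoin_singleton S θ⟩
  have hval : Function.Injective
      (Algebra.TensorProduct.map (AlgHom.id P P) (Algebra.adjoin S {θ}).val : P ⊗[S] Algebra.adjoin S {θ} →ₐ[P] P ⊗[S] A) :=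
    Module.Flat.lTensor_preserves_injective_linearMap (M := P) (Algebra.adjoin S {θ}).val.toLinearMap
      Subtype.val_injective
  have hsurj : ∀ y : P ⊗[S] Algebra.adjoin S {θ}, ∃ q : P[X], aeval ((1 : P) ⊗ₜ[S] t) q = y := by
    intro y
    induction y with
    | zero => exact ⟨0, map_zero _⟩
    | add x y hx hy =>
      obtain ⟨p, rfl⟩ := hx
      obtain ⟨q, rfl⟩ := hy
      exact ⟨p + q, map_add _ _ _⟩
    | tmul p d =>
      obtain ⟨d, hd⟩ := d
      have hd' := hd
      rw [Algebra.adjoin_singleton_eq_range_aeval] at hd'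
      obtain ⟨q, hq⟩ := hd'
      refine ⟨C p * q.map (algebraMap S P), ?_⟩
      have h1 : aeval t q = ⟨d, hd⟩ := by
        apply Subtype.ext
        rw [← Subalgebra.coe_val, ← aeval_algHom_apply]
        exact hq
      have h2 := congrArg (Algebra.TensorProduct.includeRight : Algebra.adjoin S {θ} →ₐ[S] P ⊗[S] Algebra.adjoin S {θ}) h1
      rw [← aeval_algHom_apply] at h2
      rw [map_mul, aeval_C, aeval_map_algebraMap]
      change _ * aeval (Algebra.TensorProduct.includeRight t) q = _
      rw [h2, Algebra.TensorProduct.includeRight_apply, Algebra.TensorProduct.algebraMap_apply,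
        Algebra.TensorProduct.tmul_mul_tmul]
      simp
  rw [isReduced_iff_pow_one_lt 2 one_lt_two]
  intro b hb
  apply hf
  rw [map_zero]
  have hfb : f b ^ 2 = 0 := by
    apply hval
    rw [map_pow, hf', map_zero, _root_.smul_pow, hb, smul_zero]
  obtain ⟨q, hq⟩ := hsurj (f b)
  rw [← hq, ← map_pow] at hfb
  have h1 := map_minpoly_dvd_of_aeval_eq_zero P θ _ hfb
  have hfm : ((minpoly S θ).map (algebraMap S P)).Monic := (minpoly.monic hθ).map _
  have hinj : Function.Injective (algebraMap P (FractionRing P)) := IsFractionRing.injective _ _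
  have : FaithfulSMul S (FractionRing P) := (faithfulSMul_iff_algebraMap_injective _ _).mpr <| by
    rw [IsScalarTower.algebraMap_eq S P]
    exact hinj.comp (FaithfulSMul.algebraMap_injective S P)
  have h2 : (minpoly S θ).map (algebraMap S P) ∣ q := by
    apply (Polynomial.map_dvd_map _ hinj hfm).mp
    have h3 := Polynomial.map_dvd (algebraMap P (FractionRing P)) h1
    rw [Polynomial.map_pow] at h3
    have hsq : Squarefree (((minpoly S θ).map (algebraMap S P)).map
        (algebraMap P (FractionRing P))) := by
      rw [Polynomial.map_map, ← IsScalarTower.algebraMap_eq]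
      exact squarefree_map_minpoly θ
    exact hsq.isRadical 2 _ h3
  obtain ⟨g, rfl⟩ := h2
  rw [← hq, map_mul, aeval_one_tmul_map_minpoly, zero_mul]

end FiniteExtension
end Toroidal

/-! ### Completions as finite modules over power series -/

namespace Toroidal

section Precomplete

/-- A finite power of a precomplete module is precomplete. -/
lemma isPrecomplete_pi {R : Type*} [CommRing R] (I : Ideal R) (M : Type*) [AddCommGroup M]
    [Module R M] [IsPrecomplete I M] (k : ℕ) : IsPrecomplete I (Fin k → M) := by
  have key : ∀ (n : ℕ) (x : Fin k → M), x ∈ (I ^ n • ⊤ : Submodule R (Fin k → M)) ↔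
      ∀ i, x i ∈ (I ^ n • ⊤ : Submodule R M) := by
    intro n x
    constructor
    · intro hx i
      have := Submodule.mem_map_of_mem (f := LinearMap.proj (R := R) (φ := fun _ : Fin k => M) i) hx
      rw [Submodule.map_smul''] at this
      exact Submodule.smul_mono le_rfl le_top this
    · intro hx
      rw [← Finset.univ_sum_single x]
      refine Submodule.sum_mem _ fun i _ => ?_
      have := Submodule.mem_map_of_mem (f := LinearMap.single R (fun _ : Fin k => M) i) (hx i)
      rw [Submodule.map_smul''] at this
      exact Submodule.smul_mono le_rfl le_top this
  refine ⟨fun {f} hf => ?_⟩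
  have h1 : ∀ i : Fin k, ∃ L : M, ∀ n, f n i ≡ L [SMOD (I ^ n • ⊤ : Submodule R M)] := by
    intro i
    refine IsPrecomplete.prec ‹_› (f := fun n => f n i) fun {m n} hmn => ?_
    have := hf hmn
    rw [SModEq.sub_mem, key] at this
    rw [SModEq.sub_mem]
    exact this i
  choose L hL using h1
  refine ⟨L, fun n => ?_⟩
  rw [SModEq.sub_mem, key]
  intro i
  have := hL i n
  rwa [SModEq.sub_mem] at this

end Precomplete

section PowerSeries

variable {K : Type*} [Field K] {n : ℕ}

local notation "S" => MvPolynomial (Fin n) K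
local notation "P" => MvPowerSeries (Fin n) K

instance flat_mvPowerSeries : Module.Flat S P :=
  Module.Flat.of_linearEquiv (MvPowerSeries.toAdicCompletionAlgEquiv (Fin n) K).toLinearEquiv

instance faithfulSMul_mvPowerSeries : FaithfulSMul S P :=
  (faithfulSMul_iff_algebraMap_injective _ _).mpr fun _ _ h =>
    MvPolynomial.coe_injective _ _ h

/-- Every power series is congruent to a polynomial modulo a power of the variables. -/
lemma exists_sub_algebraMap_mem (p : P) (k : ℕ) : ∃ s : S,
    p - algebraMap S P s ∈ (MvPolynomial.idealOfVars (Fin n) K ^ k).map (algebraMap S P) := by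
  let I := MvPolynomial.idealOfVars (Fin n) K
  let e := MvPowerSeries.toAdicCompletionAlgEquiv (Fin n) K
  obtain ⟨s, hs⟩ := Submodule.mkQ_surjective (I ^ k • ⊤ : Submodule S S)
    (AdicCompletion.eval I S k (e p))
  refine ⟨s, ?_⟩
  have h1 : e p - AdicCompletion.of I S s ∈
      (I ^ k • ⊤ : Submodule S (AdicCompletion I S)) := by
    rw [AdicCompletion.pow_smul_top_eq_ker_eval (MvPolynomial.idealOfVars_fg (Fin n) K),
      LinearMap.mem_ker, map_sub, AdicCompletion.eval_of, hs, sub_self]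
  have h2 := Submodule.mem_map_of_mem (f := e.symm.toLinearMap) h1
  rw [Submodule.map_smul''] at h2
  have h3 := (Submodule.smul_mono le_rfl le_top : _ ≤ I ^ k • (⊤ : Submodule S P)) h2
  rw [Ideal.smul_top_eq_map] at h3
  have h4 : e.symm.toLinearMap (e p - AdicCompletion.of I S s) = p - algebraMap S P s := by
    rw [map_sub]
    congr 1
    · exact e.symm_apply_apply p
    · exact e.symm.commutes s
  rw [h4] at h3
  exact h3

/-- A homomorphism from the polynomial ring to a complete ring that sends the variables into the
ideal of definition extends to power series. -/
lemma exists_ringHom_mvPowerSeries {C : Type*} [CommRing C] (J : Ideal C) [IsAdicComplete J C]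
    (g : S →+* C) (hg : (MvPolynomial.idealOfVars (Fin n) K).map g ≤ J) :
    ∃ ρ : P →+* C, ρ.comp (algebraMap S P) = g := by
  let I := MvPolynomial.idealOfVars (Fin n) K
  have hle : ∀ k, I ^ k ≤ (J ^ k).comap g := fun k => by
    rw [← Ideal.map_le_iff_le_comap, Ideal.map_pow]
    exact Ideal.pow_right_mono hg k
  let f : (k : ℕ) → P →+* C ⧸ J ^ k := fun k =>
    (Ideal.quotientMap (J ^ k) g (hle k)).comp
      (MvPowerSeries.truncTotalAlgHom (Fin n) K k : P →+* S ⧸ I ^ k)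
  have hf : ∀ k p, f k p = Ideal.Quotient.mk (J ^ k) (g (MvPowerSeries.truncTotal k p)) :=
    fun k p => rfl
  have hcomp : ∀ {m k : ℕ} (h : m ≤ k), (Ideal.Quotient.factorPow J h).comp (f k) = f m := by
    intro m k h
    ext p
    rw [RingHom.comp_apply, hf, hf]
    change Ideal.Quotient.mk (J ^ m) _ = _
    rw [Ideal.Quotient.eq, ← map_sub]
    exact hle m (MvPowerSeries.truncTotal_sub_truncTotal_mem_pow_idealOfVars h le_rfl p)
  refine ⟨IsAdicComplete.liftRingHom J f hcomp, ?_⟩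
  refine RingHom.ext fun s => ?_
  refine (IsHausdorff.eq_iff_smodEq (I := J)).mpr fun k => ?_
  rw [SModEq.sub_mem, smul_eq_mul, Ideal.mul_top, ← Ideal.Quotient.eq]
  rw [RingHom.comp_apply, IsAdicComplete.mk_liftRingHom, hf, Ideal.Quotient.eq, ← map_sub]
  apply hle k
  have h1 := (MvPowerSeries.truncTotalAlgHom (Fin n) K k).commutes s
  exact (Ideal.Quotient.eq).mp h1

end PowerSeries

section Completion

/-- Data exhibiting a ring `C` as the completion of `A` at an ideal `m`: `C` is complete, and
`A / m ^ k` maps isomorphically to `C / m ^ k C` for all `k`. -/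
structure IsCompletion {A C : Type*} [CommRing A] [CommRing C] [Algebra A C] (m : Ideal A) :
    Prop where
  isAdicComplete : IsAdicComplete (m.map (algebraMap A C)) C
  comap_le : ∀ k, ((m.map (algebraMap A C)) ^ k).comap (algebraMap A C) ≤ m ^ k
  exists_sub_mem : ∀ (k : ℕ) (c : C), ∃ a : A, c - algebraMap A C a ∈ (m.map (algebraMap A C)) ^ k

lemma isArtinianRing_quotient_idealOfVars (K : Type*) [Field K] (n : ℕ) :
    IsArtinianRing (MvPolynomial (Fin n) K ⧸ MvPolynomial.idealOfVars (Fin n) K) := by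
  refine Function.Surjective.isArtinianRing
    (f := (Ideal.Quotient.mk (MvPolynomial.idealOfVars (Fin n) K)).comp
      (MvPolynomial.C : K →+* MvPolynomial (Fin n) K)) fun x => ?_
  obtain ⟨s, rfl⟩ := Ideal.Quotient.mk_surjective x
  refine ⟨MvPolynomial.coeff 0 s, ?_⟩
  rw [RingHom.comp_apply, Ideal.Quotient.eq]
  rw [← pow_one (MvPolynomial.idealOfVars (Fin n) K), MvPolynomial.mem_pow_idealOfVars_iff']
  intro x hx
  have : x = 0 := by
    have h0 : x.degree = 0 := by omega
    exact (Finsupp.degree_eq_zero_iff x).mp h0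
  simp [this]

variable {K : Type*} [Field K] {n : ℕ} {A C : Type*} [CommRing A] [CommRing C] [Algebra A C]
  [Algebra (MvPolynomial (Fin n) K) A] [Module.Finite (MvPolynomial (Fin n) K) A]
  [Algebra (MvPowerSeries (Fin n) K) C] [Algebra (MvPolynomial (Fin n) K) C]
  [IsScalarTower (MvPolynomial (Fin n) K) A C]
  [IsScalarTower (MvPolynomial (Fin n) K) (MvPowerSeries (Fin n) K) C] {m : Ideal A}

/-- Modulo the variables, the completion of a finite algebra over the polynomial ring is a quotient
of the algebra itself: the powers of `m` become stationary there, and Nakayama's lemma provides an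
element of `1 + m`, invertible in the completion, that annihilates the stationary power. -/
lemma IsCompletion.exists_sub_mem_map_idealOfVars (hC : IsCompletion (C := C) m) (c : C) :
    ∃ a : A, c - algebraMap A C a ∈
      (MvPolynomial.idealOfVars (Fin n) K).map (algebraMap (MvPolynomial (Fin n) K) C) := by
  have := hC.isAdicComplete
  let I := MvPolynomial.idealOfVars (Fin n) K
  let IA := I.map (algebraMap (MvPolynomial (Fin n) K) A)
  have hNoeth : IsNoetherianRing A := IsNoetherianRing.of_finite (MvPolynomial (Fin n) K) A
  have := isArtinianRing_quotient_idealOfVars K n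
  have : IsArtinianRing (A ⧸ IA) := IsArtinianRing.of_finite (MvPolynomial (Fin n) K ⧸ I) (A ⧸ IA)
  have : IsArtinian A (A ⧸ IA) :=
    isArtinian_of_surjective_algebraMap (R := A ⧸ IA) (M := A ⧸ IA) Ideal.Quotient.mk_surjective
  let N : ℕ →o (Submodule A (A ⧸ IA))ᵒᵈ :=
    ⟨fun k => OrderDual.toDual (m ^ k • ⊤), fun i j h =>
      Submodule.smul_mono (Ideal.pow_le_pow_right h) le_rfl⟩
  obtain ⟨k, hk⟩ := IsArtinian.monotone_stabilizes N
  have hk1 : (m ^ k • ⊤ : Submodule A (A ⧸ IA)) = m • (m ^ k • ⊤ : Submodule A (A ⧸ IA)) := by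
    have h1 : (m ^ k • ⊤ : Submodule A (A ⧸ IA)) = m ^ (k + 1) • ⊤ := hk (k + 1) (Nat.le_succ k)
    rw [← smul_assoc, smul_eq_mul, ← pow_succ']
    exact h1
  obtain ⟨e, he, heN⟩ := Submodule.exists_sub_one_mem_and_smul_eq_zero_of_fg_of_le_smul m
    (m ^ k • ⊤ : Submodule A (A ⧸ IA)) (IsNoetherian.noetherian _) hk1.le
  have heu : IsUnit (algebraMap A C e) := by
    have h1 : algebraMap A C e - 1 ∈ (⊥ : Ideal C).jacobson := by
      apply IsAdicComplete.le_jacobson_bot (m.map (algebraMap A C))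
      rw [← map_one (algebraMap A C), ← map_sub]
      exact Ideal.mem_map_of_mem _ he
    exact Ideal.isUnit_of_sub_one_mem_jacobson_bot _ h1
  obtain ⟨a, ha⟩ := hC.exists_sub_mem k c
  refine ⟨a, ?_⟩
  have hle : (m.map (algebraMap A C)) ^ k ≤ I.map (algebraMap (MvPolynomial (Fin n) K) C) := by
    rw [← Ideal.map_pow, Ideal.map_le_iff_le_comap]
    intro y hy
    have h1 : e • (Ideal.Quotient.mk IA y) = 0 := by
      apply heN
      have : Ideal.Quotient.mk IA y = y • (1 : A ⧸ IA) := by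
        rw [Algebra.smul_def, mul_one]; rfl
      rw [this]
      exact Submodule.smul_mem_smul hy trivial
    have h2 : e * y ∈ IA := by
      rw [← Ideal.Quotient.eq_zero_iff_mem, map_mul]
      rw [Algebra.smul_def] at h1
      exact h1
    have h3 := Ideal.mem_map_of_mem (algebraMap A C) h2
    rw [Ideal.map_map, ← IsScalarTower.algebraMap_eq, map_mul] at h3
    rw [Ideal.mem_comap]
    exact (Ideal.unit_mul_mem_iff_mem _ heu).mp h3
  exact hle ha

/-- The completion of a finite algebra over the polynomial ring is generated by the algebra as a
module over the power series ring. -/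
lemma IsCompletion.surjective_tensor (hC : IsCompletion (C := C) m)
    (hm : (MvPolynomial.idealOfVars (Fin n) K).map (algebraMap (MvPolynomial (Fin n) K) A) ≤ m) :
    Function.Surjective (Algebra.TensorProduct.lift (Algebra.ofId (MvPowerSeries (Fin n) K) C)
      (IsScalarTower.toAlgHom (MvPolynomial (Fin n) K) A C) (fun _ _ => Commute.all _ _) :
      MvPowerSeries (Fin n) K ⊗[MvPolynomial (Fin n) K] A →ₐ[MvPowerSeries (Fin n) K] C) := by
  have := hC.isAdicComplete
  let I := MvPolynomial.idealOfVars (Fin n) K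
  let J : Ideal (MvPowerSeries (Fin n) K) := .span (.range MvPowerSeries.X)
  have hJ : I.map (algebraMap (MvPolynomial (Fin n) K) (MvPowerSeries (Fin n) K)) = J := by
    rw [Ideal.map_span, ← Set.range_comp]
    congr 1
    ext1 x
    simp only [Set.mem_range, Function.comp_apply]
    refine exists_congr fun i => ?_
    rw [show algebraMap (MvPolynomial (Fin n) K) (MvPowerSeries (Fin n) K) (MvPolynomial.X i) =
      MvPowerSeries.X i from MvPolynomial.coe_X i]
  have hJC : J.map (algebraMap (MvPowerSeries (Fin n) K) C) =
      I.map (algebraMap (MvPolynomial (Fin n) K) C) := by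
    rw [← hJ, Ideal.map_map, ← IsScalarTower.algebraMap_eq]
  have hle : J.map (algebraMap (MvPowerSeries (Fin n) K) C) ≤ m.map (algebraMap A C) := by
    rw [hJC, IsScalarTower.algebraMap_eq _ A C, ← Ideal.map_map]
    exact Ideal.map_mono hm
  obtain ⟨k, a, ha⟩ := Module.Finite.exists_fin (R := MvPolynomial (Fin n) K) (M := A)
  have : IsPrecomplete J (Fin k → MvPowerSeries (Fin n) K) := isPrecomplete_pi J _ k
  have : IsHausdorff J C := ⟨fun x hx => by
    refine IsHausdorff.haus (inferInstance : IsHausdorff (m.map (algebraMap A C)) C) x fun i => ?_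
    have := hx i
    rw [SModEq.zero, Ideal.smul_top_eq_map, Submodule.restrictScalars_mem, Ideal.map_pow] at this
    rw [SModEq.zero, smul_eq_mul, Ideal.mul_top]
    exact Ideal.pow_right_mono hle i this⟩
  let f : (Fin k → MvPowerSeries (Fin n) K) →ₗ[MvPowerSeries (Fin n) K] C :=
    Fintype.linearCombination _ fun i => algebraMap A C (a i)
  have hf : Function.Surjective f := by
    refine surjective_of_mkQ_comp_surjective (I := J) fun y => ?_
    obtain ⟨c, rfl⟩ := Submodule.mkQ_surjective _ y
    obtain ⟨b, hb⟩ := hC.exists_sub_mem_map_idealOfVars (K := K) (n := n) c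
    have hb' : b ∈ Submodule.span (MvPolynomial (Fin n) K) (Set.range a) := ha ▸ trivial
    obtain ⟨r, rfl⟩ := (Submodule.mem_span_range_iff_exists_fun _).mp hb'
    refine ⟨fun i => algebraMap _ _ (r i), ?_⟩
    rw [LinearMap.comp_apply, eq_comm, Submodule.mkQ_apply, Submodule.mkQ_apply,
      Submodule.Quotient.eq, Ideal.smul_top_eq_map, Submodule.restrictScalars_mem, hJC]
    convert hb using 2
    simp only [f, Fintype.linearCombination_apply, map_sum, Algebra.smul_def, map_mul,
      ← IsScalarTower.algebraMap_apply]
  intro c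
  obtain ⟨p, rfl⟩ := hf c
  refine ⟨∑ i, p i ⊗ₜ a i, ?_⟩
  simp [f, Fintype.linearCombination_apply, map_sum, Algebra.smul_def, Algebra.ofId_apply]

/-- The kernel of the map from the base change to the completion consists of the elements fixed by
an element of `m`: it is the intersection of the powers of `m`, by Krull's theorem. -/
lemma IsCompletion.exists_mul_eq_of_tensor_eq_zero (hC : IsCompletion (C := C) m)
    (hm : (MvPolynomial.idealOfVars (Fin n) K).map (algebraMap (MvPolynomial (Fin n) K) A) ≤ m)
    (b : MvPowerSeries (Fin n) K ⊗[MvPolynomial (Fin n) K] A)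
    (hb : Algebra.TensorProduct.lift (Algebra.ofId (MvPowerSeries (Fin n) K) C)
      (IsScalarTower.toAlgHom (MvPolynomial (Fin n) K) A C) (fun _ _ => Commute.all _ _) b = 0) :
    ∃ r ∈ m.map (Algebra.TensorProduct.includeRight :
      A →ₐ[MvPolynomial (Fin n) K] MvPowerSeries (Fin n) K ⊗[MvPolynomial (Fin n) K] A),
      r * b = b := by
  let S := MvPolynomial (Fin n) K
  let P := MvPowerSeries (Fin n) K
  let I := MvPolynomial.idealOfVars (Fin n) K
  let ι : A →ₐ[S] P ⊗[S] A := Algebra.TensorProduct.includeRight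
  let β : P ⊗[S] A →ₐ[P] C := Algebra.TensorProduct.lift (Algebra.ofId P C)
    (IsScalarTower.toAlgHom S A C) (fun _ _ => Commute.all _ _)
  have hβι : ∀ a, β (ι a) = algebraMap A C a := fun a => by simp [β, ι]
  let M := m.map ι
  have hNoeth : IsNoetherianRing (P ⊗[S] A) := IsNoetherianRing.of_finite P _
  -- the base change is generated by `A` up to any power of the variables
  have hdec : ∀ (k : ℕ) (y : P ⊗[S] A), ∃ a : A, y - ι a ∈ M ^ k := by
    intro k y
    induction y with
    | zero => exact ⟨0, by simp⟩
    | add x y hx hy =>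
      obtain ⟨a, ha⟩ := hx
      obtain ⟨b, hb⟩ := hy
      refine ⟨a + b, ?_⟩
      rw [map_add, add_sub_add_comm]
      exact add_mem ha hb
    | tmul p a =>
      obtain ⟨s, hs⟩ := exists_sub_algebraMap_mem p k
      refine ⟨s • a, ?_⟩
      have h1 : p ⊗ₜ[S] a - ι (s • a) = algebraMap P (P ⊗[S] A) (p - algebraMap S P s) * ι a := by
        have h2 : ι (s • a) = algebraMap S P s ⊗ₜ[S] a := by
          change (1 : P) ⊗ₜ[S] (s • a) = _
          rw [← TensorProduct.smul_tmul, Algebra.smul_def, mul_one]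
        have h3 : ∀ q : P, algebraMap P (P ⊗[S] A) q * ι a = q ⊗ₜ[S] a := fun q => by
          change (q ⊗ₜ[S] (1 : A)) * ((1 : P) ⊗ₜ[S] a) = _
          rw [Algebra.TensorProduct.tmul_mul_tmul, mul_one, one_mul]
        rw [h2, h3, TensorProduct.sub_tmul]
      rw [h1]
      refine Ideal.mul_mem_right _ _ ?_
      have h2 := Ideal.mem_map_of_mem (algebraMap P (P ⊗[S] A)) hs
      rw [Ideal.map_map, ← IsScalarTower.algebraMap_eq, Ideal.map_pow] at h2
      refine Ideal.pow_right_mono ?_ k h2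
      rw [show algebraMap S (P ⊗[S] A) = (ι : A →+* P ⊗[S] A).comp (algebraMap S A) from
        ι.comp_algebraMap.symm, ← Ideal.map_map]
      exact Ideal.map_mono hm
  have hMC : ∀ k, (M ^ k).map (β : P ⊗[S] A →+* C) ≤ (m.map (algebraMap A C)) ^ k := by
    intro k
    rw [Ideal.map_pow]
    refine Ideal.pow_right_mono ?_ k
    change Ideal.map (β : P ⊗[S] A →+* C) (Ideal.map (ι : A →+* P ⊗[S] A) m) ≤ _
    rw [Ideal.map_map]
    refine le_of_eq ?_
    congr 1
    ext a
    exact hβι a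
  have hker : ∀ k, b ∈ M ^ k := by
    intro k
    obtain ⟨a, ha⟩ := hdec k b
    have h1 := hMC k (Ideal.mem_map_of_mem (β : P ⊗[S] A →+* C) ha)
    rw [map_sub] at h1
    have h2 : (β : P ⊗[S] A →+* C) b = 0 := hb
    rw [h2, zero_sub, neg_mem_iff] at h1
    have h3 : algebraMap A C a ∈ (m.map (algebraMap A C)) ^ k := by rw [← hβι]; exact h1
    have h4 : a ∈ m ^ k := hC.comap_le k h3
    have h5 : ι a ∈ M ^ k := by
      have := Ideal.mem_map_of_mem ι h4
      rwa [Ideal.map_pow] at this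
    have := add_mem ha h5
    rwa [sub_add_cancel] at this
  have hinf : b ∈ (⨅ i : ℕ, M ^ i • ⊤ : Submodule (P ⊗[S] A) (P ⊗[S] A)) := by
    rw [Submodule.mem_iInf]
    intro i
    rw [smul_eq_mul, Ideal.mul_top]
    exact hker i
  obtain ⟨⟨r, hr⟩, hrb⟩ := (Ideal.mem_iInf_smul_pow_eq_bot_iff M b).mp hinf
  exact ⟨r, hr, hrb⟩

end Completion
end Toroidal

/-! ### Reducedness and integrality of completions -/

namespace Toroidal

open Polynomial

section

variable {K : Type*} [Field K] [CharZero K] {n : ℕ} {A C : Type*} [CommRing A] [IsDomain A]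
  [CommRing C] [Algebra A C]
  [Algebra (MvPolynomial (Fin n) K) A] [Module.Finite (MvPolynomial (Fin n) K) A]
  [FaithfulSMul (MvPolynomial (Fin n) K) A]
  [Algebra (MvPowerSeries (Fin n) K) C] [Algebra (MvPolynomial (Fin n) K) C]
  [IsScalarTower (MvPolynomial (Fin n) K) A C]
  [IsScalarTower (MvPolynomial (Fin n) K) (MvPowerSeries (Fin n) K) C] {m : Ideal A}

/-- Elements of the base change that are congruent to `1` modulo `m` become invertible in the
completion. -/
lemma IsCompletion.isUnit_one_sub (hC : IsCompletion (C := C) m)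
    {r : MvPowerSeries (Fin n) K ⊗[MvPolynomial (Fin n) K] A}
    (hr : r ∈ m.map (Algebra.TensorProduct.includeRight :
      A →ₐ[MvPolynomial (Fin n) K] MvPowerSeries (Fin n) K ⊗[MvPolynomial (Fin n) K] A)) :
    IsUnit (1 - Algebra.TensorProduct.lift (Algebra.ofId (MvPowerSeries (Fin n) K) C)
      (IsScalarTower.toAlgHom (MvPolynomial (Fin n) K) A C) (fun _ _ => Commute.all _ _) r) := by
  have := hC.isAdicComplete
  let S := MvPolynomial (Fin n) K
  let P := MvPowerSeries (Fin n) K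
  let ι : A →ₐ[S] P ⊗[S] A := Algebra.TensorProduct.includeRight
  let β : P ⊗[S] A →ₐ[P] C := Algebra.TensorProduct.lift (Algebra.ofId P C)
    (IsScalarTower.toAlgHom S A C) (fun _ _ => Commute.all _ _)
  have hβι : ∀ a, β (ι a) = algebraMap A C a := fun a => by simp [β, ι]
  have h1 := Ideal.mem_map_of_mem (β : P ⊗[S] A →+* C) hr
  change β r ∈ Ideal.map (β : P ⊗[S] A →+* C) (Ideal.map (ι : A →+* P ⊗[S] A) m) at h1
  rw [Ideal.map_map, show (β : P ⊗[S] A →+* C).comp (ι : A →+* P ⊗[S] A) = algebraMap A C from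
    RingHom.ext hβι] at h1
  apply Ideal.isUnit_of_sub_one_mem_jacobson_bot
  rw [sub_sub_cancel_left, neg_mem_iff]
  exact IsAdicComplete.le_jacobson_bot (m.map (algebraMap A C)) h1

/-- The completion is torsion-free over the power series ring: a relation lifts to the base change
`P ⊗ A` up to a factor in `1 + m`, and the base change is torsion-free. -/
lemma IsCompletion.algebraMap_mem_nonZeroDivisors (hC : IsCompletion (C := C) m)
    (hm : (MvPolynomial.idealOfVars (Fin n) K).map (algebraMap (MvPolynomial (Fin n) K) A) ≤ m)
    {p : MvPowerSeries (Fin n) K} (hp : p ≠ 0) :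
    algebraMap (MvPowerSeries (Fin n) K) C p ∈ nonZeroDivisors C := by
  refine mem_nonZeroDivisors_iff_right.mpr fun c hc => ?_
  obtain ⟨b, rfl⟩ := hC.surjective_tensor hm c
  obtain ⟨r, hr, hrb⟩ := hC.exists_mul_eq_of_tensor_eq_zero hm (p • b) (by
    rw [map_smul, Algebra.smul_def, mul_comm]; exact hc)
  have h1 := eq_zero_of_smul_tensor_eq_zero (MvPolynomial (Fin n) K) A (MvPowerSeries (Fin n) K)
    p hp ((1 - r) * b) (by rw [sub_mul, smul_sub, one_mul, ← mul_smul_comm, hrb, sub_self])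
  have h2 := congrArg (Algebra.TensorProduct.lift (Algebra.ofId (MvPowerSeries (Fin n) K) C)
      (IsScalarTower.toAlgHom (MvPolynomial (Fin n) K) A C) (fun _ _ => Commute.all _ _)) h1
  rw [map_mul, map_sub, map_one, map_zero] at h2
  exact (hC.isUnit_one_sub hr).mul_right_eq_zero.mp h2

/-- The completion inherits reducedness from the base change `P ⊗ A`. -/
lemma IsCompletion.isReduced (hC : IsCompletion (C := C) m)
    (hm : (MvPolynomial.idealOfVars (Fin n) K).map (algebraMap (MvPolynomial (Fin n) K) A) ≤ m) :
    IsReduced C := by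
  have := isReduced_tensor (MvPolynomial (Fin n) K) A (MvPowerSeries (Fin n) K)
  refine isReduced_iff_pow_one_lt 2 one_lt_two |>.mpr fun c hc => ?_
  obtain ⟨b, rfl⟩ := hC.surjective_tensor hm c
  obtain ⟨r, hr, hrb⟩ := hC.exists_mul_eq_of_tensor_eq_zero hm (b ^ 2) (by rw [map_pow]; exact hc)
  have h1 : (1 - r) * b = 0 := by
    apply eq_zero_of_pow_eq_zero (n := 2)
    linear_combination (r - 1) * hrb
  have h2 := congrArg (Algebra.TensorProduct.lift (Algebra.ofId (MvPowerSeries (Fin n) K) C)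
      (IsScalarTower.toAlgHom (MvPolynomial (Fin n) K) A C) (fun _ _ => Commute.all _ _)) h1
  rw [map_mul, map_sub, map_one, map_zero] at h2
  exact (hC.isUnit_one_sub hr).mul_right_eq_zero.mp h2

/-- Up to the common denominator `δ`, the completion is generated over the power series ring by the
primitive element `θ`. -/
lemma IsCompletion.exists_mul_eq_aeval (hC : IsCompletion (C := C) m)
    (hm : (MvPolynomial.idealOfVars (Fin n) K).map (algebraMap (MvPolynomial (Fin n) K) A) ≤ m)
    {θ : A} {δ : MvPolynomial (Fin n) K}
    (h : ∀ a : A, δ • a ∈ Algebra.adjoin (MvPolynomial (Fin n) K) {θ}) (c : C) :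
    ∃ q : (MvPowerSeries (Fin n) K)[X],
      algebraMap (MvPolynomial (Fin n) K) C δ * c = aeval (algebraMap A C θ) q := by
  obtain ⟨b, rfl⟩ := hC.surjective_tensor hm c
  induction b with
  | zero => exact ⟨0, by simp⟩
  | add x y hx hy =>
    obtain ⟨q, hq⟩ := hx
    obtain ⟨q', hq'⟩ := hy
    exact ⟨q + q', by rw [map_add, mul_add, hq, hq', map_add]⟩
  | tmul p a =>
    have h1 := h a
    rw [Algebra.adjoin_singleton_eq_range_aeval] at h1
    obtain ⟨t, ht⟩ := h1
    refine ⟨Polynomial.C p * t.map (algebraMap _ _), ?_⟩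
    have ht' : aeval θ t = δ • a := ht
    rw [map_mul, aeval_C, aeval_map_algebraMap, aeval_algebraMap_apply, ht', Algebra.smul_def,
      map_mul, ← IsScalarTower.algebraMap_apply]
    simp only [Algebra.TensorProduct.lift_tmul, Algebra.ofId_apply, IsScalarTower.coe_toAlgHom']
    ring

lemma IsCompletion.algebraMap_mem_nonZeroDivisors' (hC : IsCompletion (C := C) m)
    (hm : (MvPolynomial.idealOfVars (Fin n) K).map (algebraMap (MvPolynomial (Fin n) K) A) ≤ m)
    {a : A} (ha : a ≠ 0) : algebraMap A C a ∈ nonZeroDivisors C := by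
  have h1 : IsAlgebraic (MvPolynomial (Fin n) K) a :=
    (Algebra.IsIntegral.isIntegral (R := MvPolynomial (Fin n) K) a).isAlgebraic
  obtain ⟨r, hr, hra⟩ := h1.exists_nonzero_dvd (mem_nonZeroDivisors_of_ne_zero ha)
  have h2 := hC.algebraMap_mem_nonZeroDivisors hm
    (p := algebraMap (MvPolynomial (Fin n) K) (MvPowerSeries (Fin n) K) r) (by
      rwa [Ne, FaithfulSMul.algebraMap_eq_zero_iff])
  rw [← IsScalarTower.algebraMap_apply, IsScalarTower.algebraMap_apply _ A C] at h2
  obtain ⟨b, hb⟩ := hra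
  rw [hb, map_mul] at h2
  exact (mul_mem_nonZeroDivisors.mp h2).1

/-- Integrality of the completion, from a weak form of its normality. Over the power series ring,
the minimal polynomial of a primitive element `θ` may only factor as `g * h`, where `g` is the
minimal polynomial of `θ` modulo a minimal prime. Up to the factor `f'(θ)`, the element
`g'(θ) * h(θ)` is idempotent, and a local ring has no nontrivial idempotents. -/
lemma IsCompletion.isDomain (hC : IsCompletion (C := C) m) [IsLocalRing C]
    (hm : (MvPolynomial.idealOfVars (Fin n) K).map (algebraMap (MvPolynomial (Fin n) K) A) ≤ m)
    (hdvd : ∀ (a : C) (d : A), d ≠ 0 → a ^ 2 = algebraMap A C d * a → algebraMap A C d ∣ a) :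
    IsDomain C := by
  let S := MvPolynomial (Fin n) K
  let P := MvPowerSeries (Fin n) K
  obtain ⟨θ₀, δ, hδ, hA⟩ := exists_smul_mem_adjoin_singleton S A
  set θ := algebraMap A C θ₀ with hθ
  have hint : IsIntegral S θ₀ := Algebra.IsIntegral.isIntegral θ₀
  obtain ⟨𝔮, h𝔮, -⟩ := Ideal.exists_minimalPrimes_le (bot_le : (⊥ : Ideal C) ≤ IsLocalRing.maximalIdeal C)
  have h𝔮p : 𝔮.IsPrime := h𝔮.1.1
  have hnzd : ∀ c ∈ nonZeroDivisors C, c ∉ 𝔮 := fun c hc hc' =>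
    Set.disjoint_left.mp (Ideal.disjoint_nonZeroDivisors_of_mem_minimalPrimes h𝔮) hc' hc
  have hinj : Function.Injective (algebraMap P (C ⧸ 𝔮)) := by
    rw [injective_iff_map_eq_zero]
    intro p hp
    by_contra hp0
    rw [IsScalarTower.algebraMap_apply P C (C ⧸ 𝔮)] at hp
    exact hnzd _ (hC.algebraMap_mem_nonZeroDivisors hm hp0) (Ideal.Quotient.eq_zero_iff_mem.mp hp)
  have : Module.IsTorsionFree P (C ⧸ 𝔮) :=
    Module.isTorsionFree_iff_algebraMap_injective.mpr hinj
  have hsub : ∀ q : P[X], aeval (algebraMap C (C ⧸ 𝔮) θ) q = 0 ↔ aeval θ q ∈ 𝔮 := fun q => by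
    rw [aeval_algebraMap_apply]; exact Ideal.Quotient.eq_zero_iff_mem
  set f : P[X] := (minpoly S θ₀).map (algebraMap S P) with hf
  have hf0 : aeval θ f = 0 := by
    rw [hf, aeval_map_algebraMap, hθ, aeval_algebraMap_apply, minpoly.aeval, map_zero]
  have hθP : IsIntegral P (algebraMap C (C ⧸ 𝔮) θ) :=
    ⟨f, (minpoly.monic hint).map _, by
      rw [← aeval_def, aeval_algebraMap_apply, hf0, map_zero]⟩
  set g := minpoly P (algebraMap C (C ⧸ 𝔮) θ) with hg
  obtain ⟨h, hh⟩ : g ∣ f := minpoly.isIntegrallyClosed_dvd hθP ((hsub f).mpr (hf0 ▸ zero_mem _))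
  have hg𝔮 : aeval θ g ∈ 𝔮 := (hsub g).mp (minpoly.aeval _ _)
  have hgh : aeval θ g * aeval θ h = 0 := by rw [← map_mul, ← hh, hf0]
  set d₀ := aeval θ₀ (derivative (minpoly S θ₀)) with hd₀
  have hd₀0 : d₀ ≠ 0 := aeval_derivative_minpoly_ne_zero θ₀
  have hd : algebraMap A C d₀ = aeval θ (derivative g) * aeval θ h +
      aeval θ g * aeval θ (derivative h) := by
    rw [← map_mul, ← map_mul, ← map_add, ← derivative_mul, ← hh, hf, derivative_map,
      aeval_map_algebraMap, hθ, aeval_algebraMap_apply]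
  have hdn := hC.algebraMap_mem_nonZeroDivisors' hm hd₀0
  obtain ⟨e, he⟩ := hdvd (aeval θ (derivative g) * aeval θ h) d₀ hd₀0 (by
    rw [hd]
    linear_combination (- aeval θ (derivative g) * aeval θ (derivative h)) * hgh)
  -- the quotient `e` of `g'(θ) * h(θ)` by `f'(θ)` is idempotent, since `g(θ) * h(θ) = 0`
  have hee : e * (1 - e) = 0 := by
    refine (mem_nonZeroDivisors_iff_right.mp hdn) _
      ((mem_nonZeroDivisors_iff_right.mp hdn) _ ?_)
    have h2 : algebraMap A C d₀ * e * (algebraMap A C d₀ * (1 - e)) = 0 := by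
      rw [mul_sub, mul_one, ← he, hd]
      linear_combination (aeval θ (derivative g) * aeval θ (derivative h)) * hgh
    linear_combination h2
  have he1 : e = 1 := by
    rcases IsLocalRing.isUnit_or_isUnit_one_sub_self e with h1 | h1
    · exact (sub_eq_zero.mp (h1.mul_right_eq_zero.mp hee)).symm
    -- `e = 0` would put the nonzerodivisor `f'(θ) = g(θ) * h'(θ)` into the minimal prime `𝔮`
    · have he0 : e = 0 := h1.mul_left_eq_zero.mp hee
      rw [he0, mul_zero] at he
      rw [he, zero_add] at hd
      exact absurd (hd ▸ Ideal.mul_mem_right _ _ hg𝔮) (hnzd _ hdn)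
  have hg0 : aeval θ g = 0 := by
    rw [he1, mul_one] at he
    refine (mem_nonZeroDivisors_iff_right.mp hdn) _ ?_
    have h1 : aeval θ g * aeval θ (derivative h) = 0 := by
      rw [he] at hd
      exact left_eq_add.mp hd
    rw [hd]
    linear_combination (aeval θ (derivative g)) * hgh + aeval θ g * h1
  -- as `g(θ) = 0`, the torsion-free `P`-module `C` embeds, up to `δ`, into `P[X] / g`, which maps
  -- injectively to `C / 𝔮`
  have hbot : 𝔮 = ⊥ := by
    rw [eq_bot_iff]
    intro y hy
    obtain ⟨q, hq⟩ := hC.exists_mul_eq_aeval hm hA y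
    have hgm : g.Monic := minpoly.monic hθP
    have h1 : aeval θ (q %ₘ g) = aeval θ q := by
      conv_rhs => rw [← modByMonic_add_div q g, map_add, map_mul, hg0, zero_mul, add_zero]
    have h2 : g ∣ q %ₘ g := by
      refine minpoly.isIntegrallyClosed_dvd hθP ((hsub _).mpr ?_)
      rw [h1, ← hq]
      exact Ideal.mul_mem_left _ _ hy
    have h3 := eq_zero_of_dvd_of_degree_lt h2 (degree_modByMonic_lt q hgm)
    rw [h3, map_zero, ← hq] at h1
    have h4 := hC.algebraMap_mem_nonZeroDivisors' hm (a := algebraMap S A δ) (by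
      rwa [Ne, FaithfulSMul.algebraMap_eq_zero_iff])
    rw [← IsScalarTower.algebraMap_apply] at h4
    exact (mem_nonZeroDivisors_iff_right.mp h4) y (by rw [mul_comm, h1.symm])
  exact @IsDomain.of_bot_isPrime C _ (hbot ▸ h𝔮p)

end

end Toroidal

/-! ### Completed local rings of algebras of finite type -/

namespace Toroidal

section AdicCompletion

lemma isAdicComplete_of_linearEquiv {R M N : Type*} [CommRing R] (I : Ideal R) [AddCommGroup M]
    [Module R M] [AddCommGroup N] [Module R N] (e : M ≃ₗ[R] N) [IsAdicComplete I N] :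
    IsAdicComplete I M := by
  rw [← AdicCompletion.of_bijective_iff]
  have h1 : AdicCompletion.congr I e ∘ AdicCompletion.of I M = AdicCompletion.of I N ∘ e :=
    funext fun x => AdicCompletion.map_of I (e : M →ₗ[R] N) x
  have h2 : Function.Bijective (AdicCompletion.congr I e ∘ AdicCompletion.of I M) := by
    rw [h1]
    exact (AdicCompletion.of_bijective I N).comp e.bijective
  exact ((AdicCompletion.congr I e).bijective.of_comp_iff' _).mp h2

variable {R : Type u} [CommRing R] [IsLocalRing R] [IsNoetherianRing R]

local notation "R̂" => AdicCompletion (IsLocalRing.maximalIdeal R) R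

instance faithfullyFlat_adicCompletion : Module.FaithfullyFlat R R̂ :=
  Module.FaithfullyFlat.of_flat_of_isLocalHom

lemma isCompletion_adicCompletion : IsCompletion (C := R̂) (IsLocalRing.maximalIdeal R) where
  isAdicComplete := AdicCompletion.isAdicComplete_self _ (Ideal.fg_of_isNoetherianRing _)
  comap_le k := by
    rw [← Ideal.map_pow]
    exact (Ideal.comap_map_eq_self_of_faithfullyFlat _).le
  exists_sub_mem k c := by
    obtain ⟨r, hr⟩ := Submodule.mkQ_surjective _ (AdicCompletion.eval _ R k c)
    refine ⟨r, ?_⟩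
    have h1 : c - AdicCompletion.of (IsLocalRing.maximalIdeal R) R r ∈
        ((IsLocalRing.maximalIdeal R) ^ k • ⊤ : Submodule R R̂) := by
      rw [AdicCompletion.pow_smul_top_eq_ker_eval (Ideal.fg_of_isNoetherianRing _),
        LinearMap.mem_ker, map_sub, AdicCompletion.eval_of, hr, sub_self]
    rw [Ideal.smul_top_eq_map, Ideal.map_pow] at h1
    exact h1

/-- A quotient of the completion by an extended ideal is complete, being the completion of the
quotient. -/
lemma isAdicComplete_quotient_map (Q : Ideal R) :
    IsAdicComplete (IsLocalRing.maximalIdeal R) (R̂ ⧸ Q.map (algebraMap R R̂)) := by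
  have : IsAdicComplete (IsLocalRing.maximalIdeal R)
      (AdicCompletion (IsLocalRing.maximalIdeal R) (R ⧸ Q)) :=
    AdicCompletion.isAdicComplete (Ideal.fg_of_isNoetherianRing _)
  let e₁ := (Algebra.TensorProduct.quotIdealMapEquivTensorQuot R̂ Q).toLinearEquiv.restrictScalars R
  let e₂ := (AdicCompletion.ofTensorProductEquivOfFiniteNoetherian
    (IsLocalRing.maximalIdeal R) (R ⧸ Q)).restrictScalars R
  exact isAdicComplete_of_linearEquiv _ (e₁.trans e₂)

end AdicCompletion

section Completion

variable {A C : Type*} [CommRing A] [CommRing C] [Algebra A C]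

/-- The completion of the local ring at a maximal ideal is also the completion of the algebra. -/
lemma IsCompletion.of_isLocalization_atPrime {R : Type*} [CommRing R] [IsLocalRing R] [Algebra A R]
    [Algebra R C] [IsScalarTower A R C] (m : Ideal A) [m.IsMaximal] [IsLocalization.AtPrime R m]
    (hC : IsCompletion (C := C) (IsLocalRing.maximalIdeal R)) : IsCompletion (C := C) m := by
  have hm : m.map (algebraMap A C) = (IsLocalRing.maximalIdeal R).map (algebraMap R C) := by
    rw [IsScalarTower.algebraMap_eq A R C, ← Ideal.map_map,
      IsLocalization.AtPrime.map_eq_maximalIdeal m R]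
  refine ⟨hm ▸ hC.isAdicComplete, fun k a ha => ?_, fun k c => ?_⟩
  · rw [← IsLocalization.AtPrime.under_maximalIdeal_pow m R]
    refine hC.comap_le k ?_
    rw [Ideal.mem_comap, hm, IsScalarTower.algebraMap_apply A R C] at ha
    exact ha
  · obtain ⟨r, hr⟩ := hC.exists_sub_mem k c
    obtain ⟨x, hx⟩ := (IsLocalization.AtPrime.equivQuotMaximalIdealPow m R k).surjective
      (Ideal.Quotient.mk _ r)
    obtain ⟨a, rfl⟩ := Ideal.Quotient.mk_surjective x
    rw [IsLocalization.AtPrime.equivQuotMaximalIdealPow_apply_mk, Ideal.Quotient.eq] at hx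
    refine ⟨a, ?_⟩
    rw [hm]
    have h1 := Ideal.mem_map_of_mem (algebraMap R C) hx
    rw [map_sub, Ideal.map_pow, ← IsScalarTower.algebraMap_apply] at h1
    have := sub_mem hr h1
    rwa [sub_sub_sub_cancel_right] at this

/-- Completion commutes with passage to a quotient. -/
lemma IsCompletion.quotient {m : Ideal A} (hC : IsCompletion (C := C) m) (I : Ideal A)
    {C' : Type*} [CommRing C'] [Algebra (A ⧸ I) C'] (π : C →+* C') (hπ : Function.Surjective π)
    (hker : RingHom.ker π ≤ I.map (algebraMap A C))
    (hcomp : ∀ a, π (algebraMap A C a) = algebraMap (A ⧸ I) C' (Ideal.Quotient.mk I a))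
    (hcomplete : IsAdicComplete (m.map (π.comp (algebraMap A C))) C') :
    IsCompletion (C := C') (m.map (Ideal.Quotient.mk I)) := by
  have hm : (m.map (Ideal.Quotient.mk I)).map (algebraMap (A ⧸ I) C') =
      (m.map (algebraMap A C)).map π := by
    rw [Ideal.map_map, Ideal.map_map]
    congr 1
    exact RingHom.ext fun a => (hcomp a).symm
  refine ⟨?_, fun k b hb => ?_, fun k c => ?_⟩
  · rw [hm, Ideal.map_map]
    exact hcomplete
  · obtain ⟨a, rfl⟩ := Ideal.Quotient.mk_surjective b
    rw [Ideal.mem_comap, hm, ← Ideal.map_pow, ← hcomp, Ideal.mem_map_iff_of_surjective _ hπ] at hb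
    obtain ⟨c, hc, hca⟩ := hb
    have h1 : algebraMap A C a - c ∈ I.map (algebraMap A C) := by
      apply hker
      rw [RingHom.mem_ker, map_sub, hca, sub_self]
    have h2 : ∀ y ∈ I.map (algebraMap A C), ∃ i ∈ I,
        y - algebraMap A C i ∈ (m.map (algebraMap A C)) ^ k := by
      intro y hy
      induction hy using Submodule.span_induction with
      | mem x hx =>
        obtain ⟨i, hi, rfl⟩ := hx
        exact ⟨i, hi, by simp⟩
      | zero => exact ⟨0, zero_mem _, by simp⟩
      | add x y _ _ hx hy =>
        obtain ⟨i, hi, hi'⟩ := hx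
        obtain ⟨j, hj, hj'⟩ := hy
        refine ⟨i + j, add_mem hi hj, ?_⟩
        rw [map_add, add_sub_add_comm]
        exact add_mem hi' hj'
      | smul c x _ hx =>
        obtain ⟨i, hi, hi'⟩ := hx
        obtain ⟨a, ha⟩ := hC.exists_sub_mem k c
        refine ⟨a * i, Ideal.mul_mem_left _ _ hi, ?_⟩
        have := add_mem (Ideal.mul_mem_left _ c hi') (Ideal.mul_mem_right (algebraMap A C i) _ ha)
        convert this using 1
        rw [smul_eq_mul, map_mul]
        ring
    obtain ⟨i, hi, hi'⟩ := h2 _ h1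
    have h3 : a - i ∈ m ^ k := by
      apply hC.comap_le
      have := add_mem hi' hc
      rw [Ideal.mem_comap, map_sub]
      convert this using 1
      ring
    rw [← Ideal.map_pow]
    have h4 := Ideal.mem_map_of_mem (Ideal.Quotient.mk I) h3
    rwa [map_sub, Ideal.Quotient.eq_zero_iff_mem.mpr hi, sub_zero] at h4
  · obtain ⟨c, rfl⟩ := hπ c
    obtain ⟨a, ha⟩ := hC.exists_sub_mem k c
    refine ⟨Ideal.Quotient.mk I a, ?_⟩
    rw [← hcomp, ← map_sub, hm, ← Ideal.map_pow]
    exact Ideal.mem_map_of_mem π ha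

end Completion

section NoetherNormalization

variable {K : Type*} [Field K] {A : Type*} [CommRing A] [Algebra K A]

/-- Over an algebraically closed field the residue fields at maximal ideals of an algebra of finite
type are trivial extensions. -/
lemma exists_sub_algebraMap_mem_of_isMaximal [IsAlgClosed K] [Algebra.FiniteType K A]
    (m : Ideal A) [m.IsMaximal] (a : A) : ∃ c : K, a - algebraMap K A c ∈ m := by
  let := Ideal.Quotient.field m
  have : Module.Finite K (A ⧸ m) := finite_of_finite_type_of_isJacobsonRing K (A ⧸ m)
  obtain ⟨c, hc⟩ := (IsAlgClosed.algebraMap_bijective_of_isIntegral (k := K) (K := A ⧸ m)).2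
    (Ideal.Quotient.mk m a)
  refine ⟨c, ?_⟩
  rw [← Ideal.Quotient.eq, ← hc]
  rfl

/-- Noether normalization with the given point over the origin. -/
lemma exists_finite_injective_idealOfVars_le [IsAlgClosed K] [Algebra.FiniteType K A]
    (m : Ideal A) [m.IsMaximal] : ∃ (n : ℕ) (g : MvPolynomial (Fin n) K →ₐ[K] A),
      Function.Injective g ∧ g.Finite ∧
      (MvPolynomial.idealOfVars (Fin n) K).map (g : MvPolynomial (Fin n) K →+* A) ≤ m := by
  have : Nontrivial A := Ideal.Quotient.mk_surjective.nontrivial (f := Ideal.Quotient.mk m)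
  obtain ⟨n, g, hg, hg'⟩ := exists_finite_inj_algHom_of_fg K A
  choose c hc using fun i => exists_sub_algebraMap_mem_of_isMaximal m (g (MvPolynomial.X i)) (K := K)
  obtain ⟨e, he⟩ : ∃ e : MvPolynomial (Fin n) K ≃ₐ[K] MvPolynomial (Fin n) K,
      ∀ i, e (MvPolynomial.X i) = MvPolynomial.X i - MvPolynomial.C (c i) :=
    ⟨AlgEquiv.ofAlgHom (MvPolynomial.aeval fun i => MvPolynomial.X i - MvPolynomial.C (c i))
      (MvPolynomial.aeval fun i => MvPolynomial.X i + MvPolynomial.C (c i))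
      (by ext i; simp [MvPolynomial.algHom_C, MvPolynomial.algebraMap_eq])
      (by ext i; simp [MvPolynomial.algHom_C, MvPolynomial.algebraMap_eq]), fun i => by simp⟩
  refine ⟨n, g.comp e.toAlgHom, ?_, ?_, ?_⟩
  · rw [AlgHom.coe_comp]
    exact hg.comp e.injective
  · exact AlgHom.Finite.comp hg' (AlgHom.Finite.of_surjective _ e.surjective)
  · rw [MvPolynomial.idealOfVars, Ideal.map_span, Ideal.span_le]
    rintro _ ⟨_, ⟨i, rfl⟩, rfl⟩
    change g (e (MvPolynomial.X i)) ∈ m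
    rw [he, map_sub, MvPolynomial.algHom_C]
    exact hc i

end NoetherNormalization

section Affine

variable {A C : Type*} [CommRing A] [IsDomain A] [CommRing C] [Algebra A C] {m : Ideal A}

/-- The completion of an affine domain at a maximal ideal is reduced. -/
lemma IsCompletion.isReduced_of_finiteType (K : Type*) [Field K] [IsAlgClosed K] [CharZero K] [Algebra K A]
    [Algebra.FiniteType K A] [m.IsMaximal] (hC : IsCompletion (C := C) m) :
    IsReduced C := by
  obtain ⟨n, g, hg, hg', hm⟩ := exists_finite_injective_idealOfVars_le (K := K) m
  have := hC.isAdicComplete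
  let : Algebra (MvPolynomial (Fin n) K) A := g.toRingHom.toAlgebra
  have : Module.Finite (MvPolynomial (Fin n) K) A := hg'
  have : FaithfulSMul (MvPolynomial (Fin n) K) A := (faithfulSMul_iff_algebraMap_injective _ _).mpr hg
  let : Algebra (MvPolynomial (Fin n) K) C :=
    ((algebraMap A C).comp (algebraMap (MvPolynomial (Fin n) K) A)).toAlgebra
  have : IsScalarTower (MvPolynomial (Fin n) K) A C := .of_algebraMap_eq fun _ => rfl
  obtain ⟨ρ, hρ⟩ := exists_ringHom_mvPowerSeries (m.map (algebraMap A C))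
    (algebraMap (MvPolynomial (Fin n) K) C) (by
      rw [IsScalarTower.algebraMap_eq _ A C, ← Ideal.map_map]
      exact Ideal.map_mono hm)
  let : Algebra (MvPowerSeries (Fin n) K) C := ρ.toAlgebra
  have : IsScalarTower (MvPolynomial (Fin n) K) (MvPowerSeries (Fin n) K) C :=
    .of_algebraMap_eq fun x => (RingHom.congr_fun hρ x).symm
  exact hC.isReduced (K := K) (n := n) hm

/-- The completion of an affine domain at a maximal ideal is a domain if it satisfies a weak form
of normality. -/
lemma IsCompletion.isDomain_of_finiteType (K : Type*) [Field K] [IsAlgClosed K] [CharZero K] [Algebra K A]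
    [Algebra.FiniteType K A] [m.IsMaximal] [IsLocalRing C]
    (hC : IsCompletion (C := C) m)
    (hdvd : ∀ (a : C) (d : A), d ≠ 0 → a ^ 2 = algebraMap A C d * a → algebraMap A C d ∣ a) :
    IsDomain C := by
  obtain ⟨n, g, hg, hg', hm⟩ := exists_finite_injective_idealOfVars_le (K := K) m
  have := hC.isAdicComplete
  let : Algebra (MvPolynomial (Fin n) K) A := g.toRingHom.toAlgebra
  have : Module.Finite (MvPolynomial (Fin n) K) A := hg'
  have : FaithfulSMul (MvPolynomial (Fin n) K) A := (faithfulSMul_iff_algebraMap_injective _ _).mpr hg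
  let : Algebra (MvPolynomial (Fin n) K) C :=
    ((algebraMap A C).comp (algebraMap (MvPolynomial (Fin n) K) A)).toAlgebra
  have : IsScalarTower (MvPolynomial (Fin n) K) A C := .of_algebraMap_eq fun _ => rfl
  obtain ⟨ρ, hρ⟩ := exists_ringHom_mvPowerSeries (m.map (algebraMap A C))
    (algebraMap (MvPolynomial (Fin n) K) C) (by
      rw [IsScalarTower.algebraMap_eq _ A C, ← Ideal.map_map]
      exact Ideal.map_mono hm)
  let : Algebra (MvPowerSeries (Fin n) K) C := ρ.toAlgebra
  have : IsScalarTower (MvPolynomial (Fin n) K) (MvPowerSeries (Fin n) K) C :=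
    .of_algebraMap_eq fun x => (RingHom.congr_fun hρ x).symm
  exact hC.isDomain (K := K) (n := n) hm hdvd

end Affine

end Toroidal

/-! ### Associated primes of principal ideals in normal domains -/

namespace Toroidal

section Divisibility

variable {R : Type*} [CommRing R]

/-- Prime avoidance for the associated primes of `R / d`: an ideal that is not contained in any of
them contains a nonzerodivisor modulo `d`. -/
lemma exists_mem_forall_dvd_of_dvd_mul [IsNoetherianRing R] (d : R) (J : Ideal R)
    (h : ∀ (p : Ideal R) (c : R), p.IsPrime → (∀ y, y ∈ p ↔ d ∣ y * c) → ∃ s ∈ J, s ∉ p) :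
    ∃ s ∈ J, ∀ x, d ∣ s * x → d ∣ x := by
  by_contra! hcon
  have h1 : (J : Set R) ⊆ ⋃ p ∈ associatedPrimes R (R ⧸ Ideal.span {d}), (p : Set R) := by
    intro s hs
    rw [biUnion_associatedPrimes_eq_zero_divisors]
    obtain ⟨x, hx, hx'⟩ := hcon s hs
    refine ⟨Ideal.Quotient.mk _ x, ?_, ?_⟩
    · rwa [Ne, Ideal.Quotient.eq_zero_iff_mem, Ideal.mem_span_singleton]
    · rw [Algebra.smul_def, Ideal.Quotient.algebraMap_eq, ← map_mul,
        Ideal.Quotient.eq_zero_iff_mem, Ideal.mem_span_singleton]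
      exact hx
  obtain ⟨p, hp, hJp⟩ := (Ideal.subset_union_prime_finite
    (associatedPrimes.finite R (R ⧸ Ideal.span {d})) (f := id) ⊥ ⊥
    (fun p hp _ _ => (AssociatedPrimes.mem_iff.mp hp).isPrime)).mp h1
  obtain ⟨hp1, x, hx⟩ := (isAssociatedPrime_iff).mp (AssociatedPrimes.mem_iff.mp hp)
  obtain ⟨c, rfl⟩ := Ideal.Quotient.mk_surjective x
  obtain ⟨s, hs, hsp⟩ := h p c hp1 fun y => by
    rw [hx, Submodule.mem_colon_singleton, Submodule.mem_bot, Algebra.smul_def,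
      Ideal.Quotient.algebraMap_eq, ← map_mul, Ideal.Quotient.eq_zero_iff_mem,
      Ideal.mem_span_singleton]
  exact hsp (hJp hs)

/-- Flat extensions preserve nonzerodivisors modulo an element. -/
lemma algebraMap_dvd_of_dvd_mul_of_flat {C : Type*} [CommRing C] [Algebra R C] [Module.Flat R C]
    {d s : R} (h : ∀ x, d ∣ s * x → d ∣ x) {a : C}
    (ha : algebraMap R C d ∣ algebraMap R C s * a) : algebraMap R C d ∣ a := by
  obtain ⟨b, hb⟩ := ha
  obtain ⟨k, M, y, hy, hM⟩ := Module.Flat.isTrivialRelation_of_sum_smul_eq_zero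
    (R := R) (M := C) (f := ![s, -d]) (x := ![a, b]) (by
      simp [Algebra.smul_def, hb])
  have ha' : a = ∑ j, M 0 j • y j := hy 0
  rw [ha']
  refine Finset.dvd_sum fun j _ => ?_
  have h1 : d ∣ M 0 j := by
    apply h
    have := hM j
    simp only [Fin.sum_univ_two, Matrix.cons_val_zero, Matrix.cons_val_one, neg_mul] at this
    exact ⟨M 1 j, by linear_combination this⟩
  rw [Algebra.smul_def]
  exact (map_dvd _ h1).mul_right _

lemma algebraMap_dvd_mul_of_mem_map {C : Type*} [CommRing C] [Algebra R C] {p : Ideal R} {t u : R}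
    (h : ∀ y ∈ p, t ∣ u * y) {y : C} (hy : y ∈ p.map (algebraMap R C)) :
    algebraMap R C t ∣ algebraMap R C u * y := by
  induction hy using Submodule.span_induction with
  | mem x hx =>
    obtain ⟨i, hi, rfl⟩ := hx
    rw [← map_mul]
    exact map_dvd _ (h i hi)
  | zero => simp
  | add x y _ _ hx hy => rw [mul_add]; exact dvd_add hx hy
  | smul c x _ hx =>
    rw [smul_eq_mul, mul_left_comm]
    exact hx.mul_left _

variable [IsDomain R] [IsNoetherianRing R] [IsIntegrallyClosed R]

/-- At an associated prime `p` of `R / d`, a normal Noetherian domain is a discrete valuation ring: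
some `t ∈ p` generates `p` locally. -/
lemma exists_uniformizer_of_forall_mem_iff_dvd {d c : R} (hd : d ≠ 0) (p : Ideal R) [p.IsPrime]
    (hp : ∀ y, y ∈ p ↔ d ∣ y * c) : ∃ t ∈ p, t ≠ 0 ∧ ∃ u ∉ p, ∀ y ∈ p, t ∣ u * y := by
  have hdp : d ∈ p := (hp d).mpr (dvd_mul_right d c)
  by_cases hex : ∃ t ∈ p, ∃ u ∉ p, t * c = d * u
  · obtain ⟨t, ht, u, hu, htu⟩ := hex
    refine ⟨t, ht, ?_, u, hu, fun y hy => ?_⟩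
    · rintro rfl
      rw [zero_mul, eq_comm, mul_eq_zero] at htu
      rcases htu with h | h
      · exact hd h
      · exact hu (h ▸ zero_mem _)
    · obtain ⟨z, hz⟩ := (hp y).mp hy
      refine ⟨z, mul_left_cancel₀ hd ?_⟩
      linear_combination (-y) * htu + t * hz
  · exfalso
    push Not at hex
    let F := FractionRing R
    have hd' : algebraMap R F d ≠ 0 := by rwa [Ne, FaithfulSMul.algebraMap_eq_zero_iff]
    let x : F := algebraMap R F c / algebraMap R F d
    have hx' : x * algebraMap R F d = algebraMap R F c := div_mul_cancel₀ _ hd'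
    let N : Submodule R F := Submodule.map (Algebra.linearMap R F) p
    have hN : N ≠ ⊥ := by
      intro h0
      have : algebraMap R F d ∈ N := ⟨d, hdp, rfl⟩
      rw [h0, Submodule.mem_bot] at this
      exact hd' this
    have hx : IsIntegral R x := by
      refine isIntegral_of_smul_mem_submodule N hN (Submodule.FG.map _ (IsNoetherian.noetherian p)) x ?_
      rintro _ ⟨y, hy, rfl⟩
      obtain ⟨z, hz⟩ := (hp y).mp hy
      refine ⟨z, ?_, ?_⟩
      · by_contra hzp
        exact hex y hy z hzp hz
      · have : algebraMap R F y * algebraMap R F c = algebraMap R F d * algebraMap R F z := by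
          rw [← map_mul, hz, map_mul]
        refine mul_right_cancel₀ hd' ?_
        simp only [Algebra.linearMap_apply, smul_eq_mul]
        linear_combination -this - algebraMap R F y * hx'
    obtain ⟨r, hr⟩ := IsIntegrallyClosed.isIntegral_iff.mp hx
    have h1 : c = d * r := by
      apply FaithfulSMul.algebraMap_injective R F
      rw [map_mul, hr, mul_comm, hx']
    have h2 : (1 : R) ∈ p := (hp 1).mpr ⟨r, by rw [one_mul, h1]⟩
    exact (Ideal.ne_top_iff_one p).mp ‹p.IsPrime›.ne_top h2

/-- Every nonzero element is, up to units at `p`, a power of the uniformizer. -/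
lemma exists_mul_eq_mul_pow {d t u : R} (hd : d ≠ 0) (p : Ideal R) [p.IsPrime] (ht : t ∈ p)
    (hu : u ∉ p) (htu : ∀ y ∈ p, t ∣ u * y) : ∃ N : ℕ, ∃ s ∉ p, ∃ s' ∉ p, s * d = s' * t ^ N := by
  by_contra! hcon
  have h1 : ∀ i : ℕ, ∃ s ∉ p, t ^ i ∣ s * d := by
    intro i
    induction i with
    | zero => exact ⟨1, (Ideal.ne_top_iff_one p).mp ‹p.IsPrime›.ne_top, by simp⟩
    | succ i ih =>
      obtain ⟨s, hs, e, he⟩ := ih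
      have hep : e ∈ p := by
        by_contra hep
        exact hcon i s hs e hep (by rw [he, mul_comm])
      obtain ⟨e', he'⟩ := htu e hep
      exact ⟨u * s, fun h => (‹p.IsPrime›.mem_or_mem h).elim hu hs, e', by
        rw [mul_assoc, he, mul_left_comm, he']; ring⟩
  let L := Localization.AtPrime p
  have h2 : algebraMap R L d ∈ (⨅ i : ℕ, (IsLocalRing.maximalIdeal L) ^ i) := by
    rw [Ideal.mem_iInf]
    intro i
    obtain ⟨s, hs, e, he⟩ := h1 i
    have hsu : IsUnit (algebraMap R L s) := IsLocalization.map_units L (⟨s, hs⟩ : p.primeCompl)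
    rw [← Ideal.unit_mul_mem_iff_mem _ hsu, ← map_mul, he, map_mul, map_pow]
    refine Ideal.mul_mem_right _ _ (Ideal.pow_mem_pow ?_ i)
    rw [← Localization.AtPrime.map_eq_maximalIdeal]
    exact Ideal.mem_map_of_mem _ ht
  rw [Ideal.iInf_pow_eq_bot_of_isLocalRing _ (Ideal.IsPrime.ne_top inferInstance), Ideal.mem_bot,
    FaithfulSMul.algebraMap_eq_zero_iff] at h2
  exact hd h2

/-- A weak form of the normality of a flat extension with reduced fibres of codimension one. -/
lemma algebraMap_dvd_of_sq_eq_mul {C : Type*} [CommRing C] [Algebra R C] [Module.Flat R C]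
    (hrad : ∀ p : Ideal R, p.IsPrime → (p.map (algebraMap R C)).IsRadical) {d : R} (hd : d ≠ 0)
    {a : C} (ha : a ^ 2 = algebraMap R C d * a) : algebraMap R C d ∣ a := by
  let J : Ideal R := ((Ideal.span {algebraMap R C d}).colon {a}).comap (algebraMap R C)
  have hJ : ∀ s, s ∈ J ↔ algebraMap R C d ∣ algebraMap R C s * a := fun s => by
    rw [Ideal.mem_comap, Submodule.mem_colon_singleton, Ideal.mem_span_singleton, smul_eq_mul]
  obtain ⟨s, hs, hs'⟩ := exists_mem_forall_dvd_of_dvd_mul d J fun p c hp hpc => by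
    obtain ⟨t, ht, ht0, u, hu, htu⟩ := exists_uniformizer_of_forall_mem_iff_dvd hd p hpc
    obtain ⟨N, s₀, hs₀, s', hs', hN⟩ := exists_mul_eq_mul_pow hd p ht hu htu
    have htC : algebraMap R C t ∈ nonZeroDivisors C :=
      mem_nonZeroDivisors_iff_right.mpr fun c hc => by
        have h1 : IsSMulRegular C t := Module.Flat.isSMulRegular_of_nonZeroDivisors
          (mem_nonZeroDivisors_of_ne_zero ht0)
        exact h1.right_eq_zero_of_smul (by rw [Algebra.smul_def, mul_comm, hc])
    have hpow : ∀ i, algebraMap R C t ^ i ∈ nonZeroDivisors C := fun i => pow_mem htC i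
    have hNC := congrArg (algebraMap R C) hN
    simp only [map_mul, map_pow] at hNC
    have hpC := fun y hy => algebraMap_dvd_mul_of_mem_map (C := C) htu (y := y) hy
    -- locally at `p` the element `d` is `t ^ N`; if `t ^ i` divides `a` with `i < N` and quotient `b`,
    -- then `t` divides `b ^ 2`, so that `b` lies in the radical ideal `p C`, which `t` generates locally
    have key : ∀ i ≤ N, ∃ s ∉ p, algebraMap R C t ^ i ∣ algebraMap R C s * a := by
      intro i hi
      induction i with
      | zero => exact ⟨1, (Ideal.ne_top_iff_one p).mp hp.ne_top, by simp⟩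
      | succ i ih =>
        obtain ⟨s, hs, b, hb⟩ := ih (by omega)
        have h1 : algebraMap R C s₀ * b ^ 2 =
            algebraMap R C t * (algebraMap R C s' * algebraMap R C s *
              algebraMap R C t ^ (N - i - 1) * b) := by
          obtain ⟨j, rfl⟩ : ∃ j, N = i + 1 + j := ⟨N - (i + 1), by omega⟩
          rw [show i + 1 + j - i - 1 = j by omega]
          refine mul_cancel_left_mem_nonZeroDivisors (hpow (2 * i)) |>.mp ?_
          have h2 : algebraMap R C s₀ * (algebraMap R C s * a) ^ 2 =
              algebraMap R C s' * algebraMap R C t ^ (i + 1 + j) * algebraMap R C s *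
                (algebraMap R C s * a) := by
            rw [← hNC]; linear_combination algebraMap R C s₀ * algebraMap R C s ^ 2 * ha
          rw [hb] at h2
          linear_combination h2
        have h3 : algebraMap R C s₀ * b ∈ p.map (algebraMap R C) := by
          refine hrad p hp ⟨2, ?_⟩
          rw [mul_pow, pow_two (algebraMap R C s₀), mul_assoc, h1]
          exact Ideal.mul_mem_left _ _ (Ideal.mul_mem_right _ _ (Ideal.mem_map_of_mem _ ht))
        obtain ⟨e, he⟩ := hpC _ h3
        refine ⟨u * s₀ * s, fun h => (hp.mem_or_mem h).elim
          (fun h => (hp.mem_or_mem h).elim hu hs₀) hs, e, ?_⟩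
        rw [map_mul, map_mul]
        linear_combination algebraMap R C u * algebraMap R C s₀ * hb + algebraMap R C t ^ i * he
    obtain ⟨s, hs, b, hb⟩ := key N le_rfl
    refine ⟨s' * s, (hJ _).mpr ⟨algebraMap R C s₀ * b, ?_⟩, fun h => (hp.mem_or_mem h).elim hs' hs⟩
    rw [map_mul]
    linear_combination algebraMap R C s' * hb - b * hNC
  exact algebraMap_dvd_of_dvd_mul_of_flat hs' ((hJ s).mp hs)

end Divisibility

end Toroidal

/-! ### Primes of a local ring that stay prime in the completion -/

namespace Toroidal

section

variable {A : Type*} [CommRing A] (m : Ideal A) [m.IsMaximal]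
  {R : Type u} [CommRing R] [IsLocalRing R] [IsNoetherianRing R] [Algebra A R]
  [IsLocalization.AtPrime R m]

local notation "R̂" => AdicCompletion (IsLocalRing.maximalIdeal R) R

/-- The quotient of the completed local ring by an extended ideal is the completion of the quotient
of the algebra. -/
lemma isCompletion_quotient (Q : Ideal R) :
    letI : Algebra (A ⧸ Q.comap (algebraMap A R)) (R̂ ⧸ Q.map (algebraMap R R̂)) :=
      ((algebraMap (R ⧸ Q) (R̂ ⧸ Q.map (algebraMap R R̂))).comp
        (Ideal.quotientMap Q (algebraMap A R) le_rfl)).toAlgebra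
    IsCompletion (C := R̂ ⧸ Q.map (algebraMap R R̂))
      (m.map (Ideal.Quotient.mk (Q.comap (algebraMap A R)))) := by
  let : Algebra (A ⧸ Q.comap (algebraMap A R)) (R̂ ⧸ Q.map (algebraMap R R̂)) :=
      ((algebraMap (R ⧸ Q) (R̂ ⧸ Q.map (algebraMap R R̂))).comp
        (Ideal.quotientMap Q (algebraMap A R) le_rfl)).toAlgebra
  have hC := IsCompletion.of_isLocalization_atPrime (C := R̂) m (isCompletion_adicCompletion (R := R))
  refine hC.quotient _ (Ideal.Quotient.mk (Q.map (algebraMap R R̂))) Ideal.Quotient.mk_surjective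
    ?_ (fun a => rfl) ?_
  · rw [Ideal.mk_ker, IsScalarTower.algebraMap_eq A R R̂, ← Ideal.map_map]
    apply Ideal.map_mono
    exact (IsLocalization.map_under m.primeCompl R Q).ge
  · have h1 := (IsAdicComplete.map_algebraMap_iff (S := R̂ ⧸ Q.map (algebraMap R R̂))
      (IsLocalRing.maximalIdeal R) _).mpr (isAdicComplete_quotient_map Q)
    have h2 : ∀ f : R →+* R̂ ⧸ Q.map (algebraMap R R̂), (IsLocalRing.maximalIdeal R).map f =
        m.map (f.comp (algebraMap A R)) := fun f => by
      rw [← Ideal.map_map, IsLocalization.AtPrime.map_eq_maximalIdeal m R]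
    rw [h2] at h1
    exact h1

lemma isMaximal_map_quotientMk_comap (Q : Ideal R) [Q.IsPrime] :
    (m.map (Ideal.Quotient.mk (Q.comap (algebraMap A R)))).IsMaximal := by
  refine Ideal.IsMaximal.map_of_surjective_of_ker_le Ideal.Quotient.mk_surjective ?_
  rw [Ideal.mk_ker, ← IsLocalization.AtPrime.under_maximalIdeal R m]
  exact Ideal.comap_mono (IsLocalRing.le_maximalIdeal ‹Q.IsPrime›.ne_top)

/-- Primes of the local ring of an algebra of finite type generate radical ideals in the
completion. -/
lemma isRadical_map_adicCompletion (K : Type*) [Field K] [IsAlgClosed K] [CharZero K]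
    {A : Type*} [CommRing A] [Algebra K A] [Algebra.FiniteType K A] (m : Ideal A) [m.IsMaximal]
    [Algebra A R] [IsLocalization.AtPrime R m] (Q : Ideal R) [Q.IsPrime] :
    (Q.map (algebraMap R R̂)).IsRadical := by
  let : Algebra (A ⧸ Q.comap (algebraMap A R)) (R̂ ⧸ Q.map (algebraMap R R̂)) :=
      ((algebraMap (R ⧸ Q) (R̂ ⧸ Q.map (algebraMap R R̂))).comp
        (Ideal.quotientMap Q (algebraMap A R) le_rfl)).toAlgebra
  have := isMaximal_map_quotientMk_comap m Q
  have := (isCompletion_quotient m Q).isReduced_of_finiteType K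
  rwa [Ideal.isRadical_iff_quotient_reduced]

/-- If a local ring of an affine variety is normal, then its completion is a domain: primes with
normal quotient stay prime in the completion. -/
lemma isPrime_map_adicCompletion (K : Type*) [Field K] [IsAlgClosed K] [CharZero K]
    {A : Type*} [CommRing A] [Algebra K A] [Algebra.FiniteType K A] (m : Ideal A) [m.IsMaximal]
    [Algebra A R] [IsLocalization.AtPrime R m] (Q : Ideal R) [Q.IsPrime] [IsIntegrallyClosed (R ⧸ Q)] :
    (Q.map (algebraMap R R̂)).IsPrime := by
  let : Algebra (A ⧸ Q.comap (algebraMap A R)) (R̂ ⧸ Q.map (algebraMap R R̂)) :=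
      ((algebraMap (R ⧸ Q) (R̂ ⧸ Q.map (algebraMap R R̂))).comp
        (Ideal.quotientMap Q (algebraMap A R) le_rfl)).toAlgebra
  have := isMaximal_map_quotientMk_comap m Q
  have hQtop : Q.map (algebraMap R R̂) ≠ ⊤ := fun h =>
    ‹Q.IsPrime›.ne_top (by
      rw [← Ideal.comap_map_eq_self_of_faithfullyFlat (B := R̂) Q, h, Ideal.comap_top])
  have : Nontrivial (R̂ ⧸ Q.map (algebraMap R R̂)) := Ideal.Quotient.nontrivial_iff.mpr hQtop
  have : IsLocalRing (R̂ ⧸ Q.map (algebraMap R R̂)) :=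
    IsLocalRing.of_surjective' (Ideal.Quotient.mk _) Ideal.Quotient.mk_surjective
  have : Module.Flat (R ⧸ Q) (R̂ ⧸ Q.map (algebraMap R R̂)) :=
    Module.Flat.of_linearEquiv (Algebra.TensorProduct.quotIdealMapEquivQuotTensor R̂ Q).toLinearEquiv
  have hrad : ∀ p : Ideal (R ⧸ Q), p.IsPrime →
      (p.map (algebraMap (R ⧸ Q) (R̂ ⧸ Q.map (algebraMap R R̂)))).IsRadical := by
    intro p hp
    let p₀ := p.comap (Ideal.Quotient.mk Q)
    have h1 := isRadical_map_adicCompletion K m p₀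
    have h2 : p₀.map (Ideal.Quotient.mk Q) = p :=
      Ideal.map_comap_of_surjective _ Ideal.Quotient.mk_surjective p
    have h3 : p.map (algebraMap (R ⧸ Q) (R̂ ⧸ Q.map (algebraMap R R̂))) =
        (p₀.map (algebraMap R R̂)).map (Ideal.Quotient.mk (Q.map (algebraMap R R̂))) := by
      rw [← h2, Ideal.map_map, Ideal.map_map]
      rfl
    have h4 : Q.map (algebraMap R R̂) ≤ p₀.map (algebraMap R R̂) :=
      Ideal.map_mono ((Ideal.mk_ker (I := Q)).ge.trans (Ideal.comap_mono bot_le))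
    rw [h3]
    intro y hy
    obtain ⟨k, hk⟩ := hy
    obtain ⟨c, rfl⟩ := Ideal.Quotient.mk_surjective y
    rw [← map_pow, Ideal.mem_quotient_iff_mem h4] at hk
    rw [Ideal.mem_quotient_iff_mem h4]
    exact h1 ⟨k, hk⟩
  have := (isCompletion_quotient m Q).isDomain_of_finiteType K fun a d hd ha => by
    refine algebraMap_dvd_of_sq_eq_mul (R := R ⧸ Q) hrad
      (d := Ideal.quotientMap Q (algebraMap A R) le_rfl d) ?_ ha
    rwa [Ne, map_eq_zero_iff _ Ideal.quotientMap_injective]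
  rwa [← Ideal.Quotient.isDomain_iff_prime]

end

end Toroidal

/-! ### Descending principal ideals along flat extensions -/

namespace Toroidal

section Flat

variable {O C : Type*} [CommRing O] [CommRing C] [Algebra O C]

/-- Ideals of the form `{x | d i ∣ s i * x for all i}` commute with flat extension. -/
lemma exists_sum_of_forall_algebraMap_dvd [Module.Flat O C] {ι : Type*} (T : Finset ι) (d s : ι → O)
    (y : C) (h : ∀ i ∈ T, algebraMap O C (d i) ∣ algebraMap O C (s i) * y) :
    ∃ (n : ℕ) (e : Fin n → C) (x : Fin n → O), y = ∑ j, e j * algebraMap O C (x j) ∧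
      ∀ j, ∀ i ∈ T, d i ∣ s i * x j := by
  classical
  induction T using Finset.induction_on with
  | empty => exact ⟨1, fun _ => y, fun _ => 1, by simp, by simp⟩
  | insert i T hi ih =>
    obtain ⟨n, e, x, hy, hx⟩ := ih fun i hi => h i (Finset.mem_insert_of_mem hi)
    obtain ⟨z, hz⟩ := h i (Finset.mem_insert_self i T)
    obtain ⟨k, M, e', he', hM⟩ := Module.Flat.isTrivialRelation_of_sum_smul_eq_zero
      (R := O) (M := C) (f := fun o : Option (Fin n) => o.elim (-d i) fun j => s i * x j)
      (x := fun o : Option (Fin n) => o.elim z e) (by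
        rw [Fintype.sum_option]
        simp only [Option.elim_none, Option.elim_some, Algebra.smul_def, map_neg, map_mul]
        rw [neg_mul, ← hz, hy, Finset.mul_sum, neg_add_eq_zero]
        exact Finset.sum_congr rfl fun j _ => by ring)
    refine ⟨k, e', fun l => ∑ j, M (some j) l * x j, ?_, fun l i' hi' => ?_⟩
    · rw [hy]
      have h1 : ∀ j, e j = ∑ l, M (some j) l • e' l := fun j => he' (some j)
      simp_rw [h1, Finset.sum_mul, map_sum, Finset.mul_sum]
      rw [Finset.sum_comm]
      refine Finset.sum_congr rfl fun l _ => Finset.sum_congr rfl fun j _ => ?_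
      rw [Algebra.smul_def, map_mul]
      ring
    · rcases Finset.mem_insert.mp hi' with rfl | hi'
      · have h2 := hM l
        rw [Fintype.sum_option] at h2
        simp only [Option.elim_none, Option.elim_some] at h2
        refine ⟨M none l, ?_⟩
        rw [Finset.mul_sum]
        have h3 : ∑ j, s i' * (M (some j) l * x j) = ∑ j, s i' * x j * M (some j) l :=
          Finset.sum_congr rfl fun j _ => by ring
        rw [h3]
        linear_combination h2
      · rw [Finset.mul_sum]
        refine Finset.dvd_sum fun j _ => ?_
        rw [mul_left_comm]
        exact (hx j i' hi').mul_left _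

lemma pow_dvd_pow_mul_of_mem_pow {Q : Ideal O} {t u : O} (h : ∀ y ∈ Q, t ∣ u * y) (i : ℕ) {y : O}
    (hy : y ∈ Q ^ i) : t ^ i ∣ u ^ i * y := by
  induction i generalizing y with
  | zero => simp
  | succ i ih =>
    rw [pow_succ] at hy
    induction hy using Submodule.mul_induction_on' with
    | mem_mul_mem a ha b hb =>
      rw [pow_succ, pow_succ, mul_mul_mul_comm]
      exact mul_dvd_mul (ih ha) (h b hb)
    | add a _ b _ ha hb => rw [mul_add]; exact dvd_add ha hb

variable [IsDomain C]

/-- Let `t` be a local generator of the prime `Q`, and suppose that `Q` stays prime in the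
extension `C`. The symbolic powers of `Q C`, which do not depend on `Q`, are defined by
divisibility by powers of `t`. -/
lemma exists_mul_mem_pow_iff {Q : Ideal O} [hQ : Q.IsPrime] [hQC : (Q.map (algebraMap O C)).IsPrime]
    (hcomap : (Q.map (algebraMap O C)).comap (algebraMap O C) ≤ Q) {t u : O} (ht : t ∈ Q)
    (ht0 : algebraMap O C t ≠ 0) (hu : u ∉ Q) (htu : ∀ y ∈ Q, t ∣ u * y) (i : ℕ) (y : C) :
    (∃ τ ∉ Q.map (algebraMap O C), τ * y ∈ (Q.map (algebraMap O C)) ^ i) ↔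
      ∃ s ∉ Q, algebraMap O C t ^ i ∣ algebraMap O C s * y := by
  have hnot : ∀ s ∉ Q, algebraMap O C s ∉ Q.map (algebraMap O C) := fun s hs hs' => hs (hcomap hs')
  constructor
  · rintro ⟨τ, hτ, hτy⟩
    have h0 : algebraMap O C t ^ i ∣ algebraMap O C u ^ i * (τ * y) := by
      rw [← map_pow, ← map_pow]
      refine algebraMap_dvd_mul_of_mem_map (fun y hy => pow_dvd_pow_mul_of_mem_pow htu i hy) ?_
      rwa [Ideal.map_pow]
    obtain ⟨z', hz'⟩ := h0
    suffices key : ∀ j ≤ i, ∃ s ∉ Q, algebraMap O C t ^ j ∣ algebraMap O C s * y from key i le_rfl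
    intro j hj
    induction j with
    | zero => exact ⟨1, (Ideal.ne_top_iff_one Q).mp hQ.ne_top, by simp⟩
    | succ j ih =>
      obtain ⟨s, hs, z, hz⟩ := ih (by omega)
      obtain ⟨k, rfl⟩ : ∃ k, i = j + 1 + k := ⟨i - (j + 1), by omega⟩
      have h1 : algebraMap O C u ^ (j + 1 + k) * (τ * z) =
          algebraMap O C t * (algebraMap O C s * algebraMap O C t ^ k * z') := by
        refine mul_left_cancel₀ (pow_ne_zero j ht0) ?_
        linear_combination algebraMap O C s * hz' - algebraMap O C u ^ (j + 1 + k) * τ * hz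
      have h2 : algebraMap O C u ^ (j + 1 + k) * (τ * z) ∈ Q.map (algebraMap O C) :=
        h1 ▸ Ideal.mul_mem_right _ _ (Ideal.mem_map_of_mem _ ht)
      have h3 : z ∈ Q.map (algebraMap O C) :=
        (hQC.mem_or_mem ((hQC.mem_or_mem h2).resolve_left
          fun h => hnot u hu (hQC.mem_of_pow_mem _ h))).resolve_left hτ
      obtain ⟨e, he⟩ := algebraMap_dvd_mul_of_mem_map htu h3
      refine ⟨u * s, fun h => (hQ.mem_or_mem h).elim hu hs, e, ?_⟩
      rw [map_mul]
      linear_combination algebraMap O C u * hz + algebraMap O C t ^ j * he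
  · rintro ⟨s, hs, z, hz⟩
    exact ⟨algebraMap O C s, hnot s hs, hz ▸ Ideal.mul_mem_right _ _
      (Ideal.pow_mem_pow (Ideal.mem_map_of_mem _ ht) i)⟩

/-- A local generator of an extended prime `Q C` may be taken in `Q`. -/
lemma exists_uniformizer_of_map [Module.Flat O C] [IsNoetherianRing O] {Q : Ideal O}
    [(Q.map (algebraMap O C)).IsPrime] {τ υ : C} (hτ : τ ∈ Q.map (algebraMap O C))
    (hτ0 : τ ≠ 0) (hυ : υ ∉ Q.map (algebraMap O C))
    (h : ∀ y ∈ Q.map (algebraMap O C), τ ∣ υ * y) :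
    ∃ t ∈ Q, algebraMap O C t ≠ 0 ∧ ∃ u ∉ Q, ∀ y ∈ Q, t ∣ u * y := by
  obtain ⟨n, q, hq⟩ := Submodule.fg_iff_exists_fin_generating_family.mp (IsNoetherian.noetherian Q)
  have hqQ : ∀ k, q k ∈ Q := fun k => hq ▸ Submodule.subset_span ⟨k, rfl⟩
  have hmap : Q.map (algebraMap O C) =
      Ideal.span (Set.range fun k => algebraMap O C (q k)) := by
    conv_lhs => rw [← hq]
    rw [Ideal.submodule_span_eq, Ideal.map_span, ← Set.range_comp]
    rfl
  obtain ⟨d, hd⟩ := (Submodule.mem_span_range_iff_exists_fun C).mp (hmap ▸ hτ)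
  choose c hc using fun k => h _ (Ideal.mem_map_of_mem (algebraMap O C) (hqQ k))
  have h1 : υ = ∑ k, d k * c k := by
    refine mul_left_cancel₀ hτ0 ?_
    rw [Finset.mul_sum]
    calc τ * υ = ∑ k, υ * (d k * algebraMap O C (q k)) := by
          rw [← Finset.mul_sum, mul_comm]; congr 1; exact hd.symm
      _ = ∑ k, τ * (d k * c k) := Finset.sum_congr rfl fun k _ => by
          linear_combination d k * hc k
  obtain ⟨k, hk⟩ : ∃ k, c k ∉ Q.map (algebraMap O C) := by
    by_contra! hcon
    exact hυ (h1 ▸ Submodule.sum_mem _ fun k _ => Ideal.mul_mem_left _ _ (hcon k))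
  have hυ0 : υ ≠ 0 := fun h => hυ (h ▸ zero_mem _)
  obtain ⟨m, e, x, hx, hx'⟩ := exists_sum_of_forall_algebraMap_dvd (C := C) Finset.univ
    (fun _ => q k) q (c k) fun l _ => ⟨c l, mul_left_cancel₀ hυ0 (by
      linear_combination c k * hc l - c l * hc k)⟩
  obtain ⟨j, hj⟩ : ∃ j, x j ∉ Q := by
    by_contra! hcon
    exact hk (hx ▸ Submodule.sum_mem _ fun j _ =>
      Ideal.mul_mem_left _ _ (Ideal.mem_map_of_mem _ (hcon j)))
  refine ⟨q k, hqQ k, fun h0 => ?_, x j, hj, fun y hy => ?_⟩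
  · have h2 := hc k
    rw [h0, mul_zero, eq_comm, mul_eq_zero] at h2
    exact h2.elim hτ0 fun h => hk (h ▸ zero_mem _)
  · rw [← hq] at hy
    induction hy using Submodule.span_induction with
    | mem y hy =>
      obtain ⟨l, rfl⟩ := hy
      rw [mul_comm]
      exact hx' j l (Finset.mem_univ l)
    | zero => simp
    | add a b _ _ ha hb => rw [mul_add]; exact dvd_add ha hb
    | smul c a _ ha =>
      rw [smul_eq_mul, mul_left_comm]
      exact ha.mul_left _

end Flat

section Associated

variable {R O C : Type*} [CommRing R] [IsDomain R] [IsNoetherianRing R] [IsIntegrallyClosed R]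
  [CommRing O] [IsNoetherianRing O] [CommRing C] [IsDomain C] [IsLocalRing C] [Algebra R C]
  [Algebra O C] [Module.FaithfullyFlat R C] [Module.FaithfullyFlat O C]

/-- Let `R` and `O` have the same completion `C`, and suppose that the primes of the divisor of
`h ∈ R` extend to primes of `C` which are also extended from `O`. Then `h` generates the same ideal
of `C` as some element of `O`: the ideal `h C` is an intersection of symbolic powers of these
primes, hence it is extended from `O`, and a principal extended ideal of a local ring has a
generator in `O`. -/
theorem exists_associated_algebraMap {h : R} (h0 : h ≠ 0)
    (hprime : ∀ (p : Ideal R) (c : R), p.IsPrime → (∀ y, y ∈ p ↔ h ∣ y * c) →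
      (p.map (algebraMap R C)).IsPrime ∧
        ∃ Q : Ideal O, Q.IsPrime ∧ Q.map (algebraMap O C) = p.map (algebraMap R C)) :
    ∃ f : O, Associated (algebraMap O C f) (algebraMap R C h) := by
  have hinjR : ∀ {r : R}, r ≠ 0 → algebraMap R C r ≠ 0 := fun hr => by
    rwa [Ne, map_eq_zero_iff _ (FaithfulSMul.algebraMap_injective R C)]
  let 𝒜 : Set (Ideal R) := {p | p.IsPrime ∧ ∃ c, ∀ y, y ∈ p ↔ h ∣ y * c}
  have hfin : 𝒜.Finite := by
    refine (associatedPrimes.finite R (R ⧸ Ideal.span {h})).subset ?_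
    rintro p ⟨hp, c, hc⟩
    refine isAssociatedPrime_iff.mpr ⟨hp, Ideal.Quotient.mk _ c, ?_⟩
    ext y
    rw [hc, Submodule.mem_colon_singleton, Submodule.mem_bot, Algebra.smul_def,
      Ideal.Quotient.algebraMap_eq, ← map_mul, Ideal.Quotient.eq_zero_iff_mem,
      Ideal.mem_span_singleton]
  have hdata : ∀ p ∈ 𝒜, ∃ σ τ : O,
      algebraMap O C τ ∣ algebraMap O C σ * algebraMap R C h ∧
      ∀ x : O, τ ∣ σ * x → ∃ s ∉ p, algebraMap R C h ∣ algebraMap R C s * algebraMap O C x := by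
    rintro p ⟨hp, c, hc⟩
    obtain ⟨hpC, Q, hQ, hQp⟩ := hprime p c hp hc
    obtain ⟨t, ht, ht0, u, hu, htu⟩ := exists_uniformizer_of_forall_mem_iff_dvd h0 p hc
    obtain ⟨N, s, hs, s', hs', hN⟩ := exists_mul_eq_mul_pow h0 p ht hu htu
    have hNC := congrArg (algebraMap R C) hN
    simp only [map_mul, map_pow] at hNC
    have hpc := Ideal.comap_map_eq_self_of_faithfullyFlat (B := C) p
    have hQc := Ideal.comap_map_eq_self_of_faithfullyFlat (B := C) Q
    have hQC : (Q.map (algebraMap O C)).IsPrime := hQp ▸ hpC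
    obtain ⟨t', ht', ht0', u', hu', htu'⟩ := exists_uniformizer_of_map (Q := Q)
      (τ := algebraMap R C t) (υ := algebraMap R C u) (hQp ▸ Ideal.mem_map_of_mem _ ht) (hinjR ht0)
      (fun h => hu (hpc ▸ (hQp ▸ h : algebraMap R C u ∈ p.map (algebraMap R C))))
      (fun y hy => algebraMap_dvd_mul_of_mem_map htu (hQp ▸ hy))
    have hiff : ∀ y : C, (∃ s ∉ Q, algebraMap O C t' ^ N ∣ algebraMap O C s * y) ↔
        ∃ s ∉ p, algebraMap R C t ^ N ∣ algebraMap R C s * y := fun y => by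
      rw [← exists_mul_mem_pow_iff hQc.le ht' ht0' hu' htu', hQp,
        exists_mul_mem_pow_iff hpc.le ht (hinjR ht0) hu htu]
    obtain ⟨σ, hσ, hσh⟩ := (hiff (algebraMap R C h)).mpr ⟨s, hs, algebraMap R C s', by
      rw [hNC, mul_comm]⟩
    refine ⟨σ, t' ^ N, by rwa [map_pow], fun x hx => ?_⟩
    obtain ⟨r, hr, z, hz⟩ := (hiff (algebraMap O C x)).mp ⟨σ, hσ, by
      rw [← map_pow, ← map_mul]; exact map_dvd _ hx⟩
    refine ⟨s' * r, fun h => (hp.mem_or_mem h).elim hs' hr, algebraMap R C s * z, ?_⟩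
    rw [map_mul]
    linear_combination algebraMap R C s' * hz - z * hNC
  choose! σ τ hdvd hx using hdata
  obtain ⟨n, e, x, hη, hx'⟩ := exists_sum_of_forall_algebraMap_dvd hfin.toFinset τ σ
    (algebraMap R C h) fun p hp => hdvd p (hfin.mem_toFinset.mp hp)
  have hhx : ∀ j, algebraMap R C h ∣ algebraMap O C (x j) := by
    intro j
    let J : Ideal R :=
      ((Ideal.span {algebraMap R C h}).colon {algebraMap O C (x j)}).comap (algebraMap R C)
    have hJ : ∀ s, s ∈ J ↔ algebraMap R C h ∣ algebraMap R C s * algebraMap O C (x j) := fun s => by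
      rw [Ideal.mem_comap, Submodule.mem_colon_singleton, Ideal.mem_span_singleton, smul_eq_mul]
    obtain ⟨s, hs, hs'⟩ := exists_mem_forall_dvd_of_dvd_mul h J fun p c hp hc => by
      obtain ⟨s, hs, hsx⟩ := hx p ⟨hp, c, hc⟩ (x j) (hx' j p (hfin.mem_toFinset.mpr ⟨hp, c, hc⟩))
      exact ⟨s, (hJ s).mpr hsx, hs⟩
    exact algebraMap_dvd_of_dvd_mul_of_flat hs' ((hJ s).mp hs)
  choose w hw using hhx
  have hone : 1 = ∑ j, e j * w j := by
    refine mul_left_cancel₀ (hinjR h0) ?_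
    rw [mul_one, Finset.mul_sum]
    conv_lhs => rw [hη]
    exact Finset.sum_congr rfl fun j _ => by rw [hw]; ring
  obtain ⟨j, hj⟩ : ∃ j, IsUnit (e j * w j) := by
    by_contra! hcon
    have : (1 : C) ∈ IsLocalRing.maximalIdeal C := by
      rw [hone]
      exact Submodule.sum_mem _ fun j _ => (IsLocalRing.mem_maximalIdeal _).mpr (hcon j)
    exact (Ideal.ne_top_iff_one _).mp Ideal.IsPrime.ne_top' this
  refine ⟨x j, Associated.symm ⟨(isUnit_of_mul_isUnit_right hj).unit, ?_⟩⟩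
  rw [IsUnit.unit_spec, hw]

end Associated

end Toroidal

/-! ### Monomials on affine toric varieties -/

namespace Toroidal

namespace NormalAffineToric

variable {K : Type u} [Field K] {A : Type u} [CommRing A] [Algebra K A] (W : NormalAffineToric K A)

lemma res_injective : Function.Injective W.res := by
  have := W.isDomain
  have := W.isOpenImmersion
  have h1 : Flat (Spec.map (CommRingCat.ofHom W.res.toRingHom)) := inferInstance
  have h2 : W.res.toRingHom.Flat := Flat.SpecMap_iff.mp h1
  let : Algebra A (TorusRing K W.d) := W.res.toRingHom.toAlgebra
  have : Module.Flat A (TorusRing K W.d) := h2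
  rw [injective_iff_map_eq_zero]
  intro a ha
  by_contra h0
  have h3 : IsSMulRegular (TorusRing K W.d) a := Module.Flat.isSMulRegular_of_nonZeroDivisors
    (mem_nonZeroDivisors_of_ne_zero h0)
  have h4 : a • (1 : TorusRing K W.d) = 0 := by
    rw [Algebra.smul_def, mul_one]; exact ha
  exact one_ne_zero (h3.right_eq_zero_of_smul h4)

/-- The coefficient of the character `s` under the torus action is a multiple of `s` on the
torus. -/
lemma exists_res_eq_single_coeff (a : A) (s : Fin W.d → ℤ) :
    ∃ b : A, W.res b = AddMonoidAlgebra.single s ((W.res a).coeff s) := by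
  let B := TorusRing K W.d
  let c : B →ₗ[K] K := Finsupp.lapply s ∘ₗ (AddMonoidAlgebra.coeffLinearEquiv K).toLinearMap
  have hc : ∀ b : B, c b = b.coeff s := fun b => rfl
  refine ⟨TensorProduct.lid K A (c.rTensor A (W.act a)), ?_⟩
  have h1 : ∀ z : B ⊗[K] A, W.res (TensorProduct.lid K A (c.rTensor A z)) =
      TensorProduct.lid K B (c.rTensor B
        (Algebra.TensorProduct.map (AlgHom.id K B) W.res z)) := by
    intro z
    induction z with
    | zero => simp
    | add x y hx hy => simp only [map_add, hx, hy]
    | tmul b x => simp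
  have h2 : ∀ b : B, TensorProduct.lid K B (c.rTensor B (Bialgebra.comulAlgHom K B b)) =
      AddMonoidAlgebra.single s (b.coeff s) := by
    intro b
    induction b using AddMonoidAlgebra.induction_on with
    | of m =>
      have h3 : Bialgebra.comulAlgHom K B (AddMonoidAlgebra.of K _ (Multiplicative.ofAdd m)) =
          AddMonoidAlgebra.single m 1 ⊗ₜ[K] AddMonoidAlgebra.single m 1 := by
        simp [B]
      rw [h3, LinearMap.rTensor_tmul, TensorProduct.lid_tmul, hc, AddMonoidAlgebra.smul_single,
        smul_eq_mul, mul_one]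
      by_cases hms : m = s
      · subst hms; simp
      · simp [hms]
    | add x y hx hy => simp only [map_add, hx, hy]; simp
    | smul r x hx =>
      simp only [map_smul, hx]
      exact AddMonoidAlgebra.smul_single _ _ _
  rw [h1, W.act_res, h2]

/-- The weights of the torus action: the characters that extend to regular functions. -/
def weights : AddSubmonoid (Fin W.d → ℤ) where
  carrier := {s | ∃ a, W.res a = AddMonoidAlgebra.single s 1}
  zero_mem' := ⟨1, map_one _⟩
  add_mem' := by
    rintro s t ⟨a, ha⟩ ⟨b, hb⟩
    exact ⟨a * b, by rw [map_mul, ha, hb, AddMonoidAlgebra.single_mul_single, one_mul]⟩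

/-- The regular function that extends the character of weight `s`. -/
noncomputable def monomial (s : W.weights) : A := s.2.choose

lemma res_monomial (s : W.weights) : W.res (W.monomial s) = AddMonoidAlgebra.single s.1 1 :=
  s.2.choose_spec

lemma monomial_zero : W.monomial 0 = 1 := by
  apply W.res_injective
  rw [res_monomial, map_one]
  rfl

lemma monomial_add (s t : W.weights) : W.monomial (s + t) = W.monomial s * W.monomial t := by
  apply W.res_injective
  rw [res_monomial, map_mul, res_monomial, res_monomial, AddMonoidAlgebra.single_mul_single, one_mul]
  rfl

lemma monomial_ne_zero (s : W.weights) : W.monomial s ≠ 0 := by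
  intro h
  have := W.res_monomial s
  rw [h, map_zero, eq_comm, AddMonoidAlgebra.single_eq_zero] at this
  exact one_ne_zero this

/-- Monomials, as a homomorphism from the monoid of weights. -/
noncomputable def monomialHom : Multiplicative W.weights →* A where
  toFun s := W.monomial s.toAdd
  map_one' := W.monomial_zero
  map_mul' _ _ := W.monomial_add _ _

lemma monomial_nsmul (n : ℕ) (s : W.weights) : W.monomial (n • s) = W.monomial s ^ n :=
  map_pow W.monomialHom (Multiplicative.ofAdd s) n

lemma span_range_monomial : Submodule.span K (Set.range W.monomial) = ⊤ := by
  rw [eq_top_iff]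
  rintro a -
  have hs : ∀ s ∈ (W.res a).coeff.support, s ∈ W.weights := fun s hs => by
    obtain ⟨b, hb⟩ := W.exists_res_eq_single_coeff a s
    refine ⟨((W.res a).coeff s)⁻¹ • b, ?_⟩
    rw [map_smul, hb, AddMonoidAlgebra.smul_single, smul_eq_mul,
      inv_mul_cancel₀ (Finsupp.mem_support_iff.mp hs)]
  have h1 : a = ∑ s ∈ (W.res a).coeff.support.attach,
      (W.res a).coeff s • W.monomial ⟨s, hs s s.2⟩ := by
    apply W.res_injective
    rw [map_sum]
    simp only [map_smul, res_monomial, AddMonoidAlgebra.smul_single, smul_eq_mul, mul_one]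
    rw [Finset.sum_attach _ fun s => AddMonoidAlgebra.single s ((W.res a).coeff s)]
    exact (AddMonoidAlgebra.sum_coeff_single _).symm
  rw [h1]
  exact Submodule.sum_mem _ fun s _ => Submodule.smul_mem _ _ (Submodule.subset_span ⟨_, rfl⟩)

lemma bijective_lift_monomialHom :
    Function.Bijective (AddMonoidAlgebra.lift K A W.weights W.monomialHom) := by
  constructor
  · have h1 : W.res.comp (AddMonoidAlgebra.lift K A W.weights W.monomialHom) =
        AddMonoidAlgebra.mapDomainAlgHom K K W.weights.subtype := by
      ext s
      simp [monomialHom, res_monomial]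
    have h2 : Function.Injective (W.res.comp (AddMonoidAlgebra.lift K A W.weights W.monomialHom)) := by
      rw [h1]
      exact AddMonoidAlgebra.mapDomain_injective Subtype.val_injective
    exact Function.Injective.of_comp (f := W.res) h2
  · rw [← AlgHom.range_eq_top, eq_top_iff]
    intro a _
    have ha : a ∈ Submodule.span K (Set.range W.monomial) := W.span_range_monomial ▸ trivial
    refine Submodule.span_le (p := Subalgebra.toSubmodule (AlgHom.range _)).mpr ?_ ha
    rintro _ ⟨s, rfl⟩
    exact ⟨AddMonoidAlgebra.single s 1, by simp [monomialHom]⟩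

/-- Homomorphisms from the coordinate ring are determined by their values on monomials, which may be
prescribed. -/
lemma exists_algHom_monomial {B : Type*} [CommRing B] [Algebra K B]
    (F : Multiplicative W.weights →* B) :
    ∃ ψ : A →ₐ[K] B, ∀ s, ψ (W.monomial s) = F (Multiplicative.ofAdd s) := by
  let e := AlgEquiv.ofBijective _ W.bijective_lift_monomialHom
  refine ⟨(AddMonoidAlgebra.lift K B W.weights F).comp e.symm.toAlgHom, fun s => ?_⟩
  have h1 : e.symm (W.monomial s) = AddMonoidAlgebra.single s 1 := by
    rw [AlgEquiv.symm_apply_eq]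
    simp [e, monomialHom]
  change AddMonoidAlgebra.lift K B W.weights F (e.symm (W.monomial s)) = _
  rw [h1]
  simp

lemma fg_weights : AddMonoid.FG W.weights := by
  have := W.finiteType
  have : Algebra.FiniteType K (AddMonoidAlgebra K W.weights) :=
    Algebra.FiniteType.equiv W.finiteType
      (AlgEquiv.ofBijective _ W.bijective_lift_monomialHom).symm
  exact AddMonoidAlgebra.fg_of_finiteType (R := K)

/-- Every character of the torus is a quotient of monomials: otherwise the monomials would not
separate two homomorphisms out of the coordinate ring of the torus, although restriction to the
torus is an epimorphism. -/
lemma exists_sub_mem_weights (v : Fin W.d → ℤ) : ∃ s t : W.weights, v = s.1 - t.1 := by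
  let G : AddSubgroup (Fin W.d → ℤ) :=
    { carrier := {v | ∃ s t : W.weights, v = s.1 - t.1}
      zero_mem' := ⟨0, 0, by simp⟩
      add_mem' := by
        rintro _ _ ⟨s, t, rfl⟩ ⟨s', t', rfl⟩
        exact ⟨s + s', t + t', by push_cast; abel⟩
      neg_mem' := by
        rintro _ ⟨s, t, rfl⟩
        exact ⟨t, s, by abel⟩ }
  suffices hG : v ∈ G from hG
  let f : TorusRing K W.d →ₐ[K] AddMonoidAlgebra K ((Fin W.d → ℤ) ⧸ G) :=
    AddMonoidAlgebra.mapDomainAlgHom K K (QuotientAddGroup.mk' G)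
  let g : TorusRing K W.d →ₐ[K] AddMonoidAlgebra K ((Fin W.d → ℤ) ⧸ G) :=
    AddMonoidAlgebra.mapDomainAlgHom K K (0 : (Fin W.d → ℤ) →+ (Fin W.d → ℤ) ⧸ G)
  have hfs : ∀ s c, f (AddMonoidAlgebra.single s c) =
      AddMonoidAlgebra.single (QuotientAddGroup.mk' G s) c := fun s c => by simp [f]
  have hgs : ∀ s c, g (AddMonoidAlgebra.single s c) = AddMonoidAlgebra.single 0 c :=
    fun s c => by simp [g]
  have hfg : f.comp W.res = g.comp W.res := by
    apply AlgHom.toLinearMap_injective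
    refine LinearMap.ext_on_range W.span_range_monomial fun s => ?_
    simp only [AlgHom.toLinearMap_apply, AlgHom.comp_apply, res_monomial, hfs, hgs]
    congr 1
    exact (QuotientAddGroup.eq_zero_iff _).mpr ⟨s, 0, by simp⟩
  have := W.isOpenImmersion
  have hmono : Mono (Spec.map (CommRingCat.ofHom W.res.toRingHom)) := inferInstance
  have h1 : CommRingCat.ofHom f.toRingHom = CommRingCat.ofHom g.toRingHom := by
    apply Spec.map_injective
    rw [← cancel_mono (Spec.map (CommRingCat.ofHom W.res.toRingHom)), ← Spec.map_comp,
      ← Spec.map_comp]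
    exact congrArg (fun h : A →ₐ[K] _ => Spec.map (CommRingCat.ofHom h.toRingHom)) hfg
  have h2 : f (AddMonoidAlgebra.single v 1) = g (AddMonoidAlgebra.single v 1) :=
    RingHom.congr_fun (congrArg CommRingCat.Hom.hom h1) _
  rw [hfs, hgs] at h2
  exact (QuotientAddGroup.eq_zero_iff v).mp (AddMonoidAlgebra.single_left_injective one_ne_zero h2)

end NormalAffineToric

end Toroidal

/-! ### The toric boundary -/

namespace Toroidal

/-- A retract of a normal domain is normal. -/
lemma isIntegrallyClosed_of_retract {A D : Type*} [CommRing A] [IsDomain A] [IsIntegrallyClosed A]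
    [CommRing D] [IsDomain D] (i : D →+* A) (r : A →+* D) (h : ∀ x, r (i x) = x) :
    IsIntegrallyClosed D := by
  have hi : Function.Injective i := Function.LeftInverse.injective h
  let : Algebra D A := i.toAlgebra
  have : FaithfulSMul D A := (faithfulSMul_iff_algebraMap_injective _ _).mpr hi
  let L := FractionRing A
  have : FaithfulSMul D L := FaithfulSMul.trans D A L
  let f : FractionRing D →ₐ[D] L := IsFractionRing.liftAlgHom (g := Algebra.ofId D L)
    (FaithfulSMul.algebraMap_injective D L)
  refine (isIntegrallyClosed_iff (FractionRing D)).mpr fun {x} hx => ?_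
  obtain ⟨a, ha⟩ := IsIntegrallyClosed.isIntegral_iff.mp ((hx.map f).tower_top (A := A))
  obtain ⟨p, q, hq, rfl⟩ := IsFractionRing.div_surjective (A := D) x
  have hq0 : algebraMap D (FractionRing D) q ≠ 0 := by
    rw [Ne, FaithfulSMul.algebraMap_eq_zero_iff]
    exact nonZeroDivisors.ne_zero hq
  refine ⟨r a, ?_⟩
  rw [eq_div_iff hq0, ← map_mul]
  congr 1
  have h1 : a * i q = i p := by
    apply FaithfulSMul.algebraMap_injective A L
    rw [map_mul, ha, map_div₀, AlgHom.commutes, AlgHom.commutes,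
      IsScalarTower.algebraMap_apply D A L, IsScalarTower.algebraMap_apply D A L]
    refine div_mul_cancel₀ _ ?_
    rw [← IsScalarTower.algebraMap_apply, Ne, FaithfulSMul.algebraMap_eq_zero_iff]
    exact nonZeroDivisors.ne_zero hq
  rw [← h q, ← map_mul, h1, h]

namespace NormalAffineToric

variable {K : Type u} [Field K] {A : Type u} [CommRing A] [Algebra K A] (W : NormalAffineToric K A)

/-- The sum of a finite system of generators is a weight of which every weight divides a multiple. -/
lemma exists_weight_forall_exists_nsmul_eq_add :
    ∃ m₀ : W.weights, ∀ s, ∃ (n : ℕ) (t : W.weights), n • m₀ = s + t := by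
  classical
  obtain ⟨G, hG⟩ := W.fg_weights.fg_top
  refine ⟨∑ g ∈ G, g, fun s => ?_⟩
  have hs : s ∈ AddSubmonoid.closure (G : Set W.weights) := hG ▸ trivial
  induction hs using AddSubmonoid.closure_induction with
  | mem g hg => exact ⟨1, ∑ g ∈ G.erase g, g, by
    rw [one_smul]; exact (Finset.add_sum_erase G (fun g => g) hg).symm⟩
  | zero => exact ⟨0, 0, by simp⟩
  | add x y _ _ hx hy =>
    obtain ⟨n, t, h⟩ := hx
    obtain ⟨n', t', h'⟩ := hy
    exact ⟨n + n', t + t', by rw [add_smul, h, h']; abel⟩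

variable {m₀ : W.weights} (hm₀ : ∀ s, ∃ (n : ℕ) (t : W.weights), n • m₀ = s + t)

include hm₀

lemma isLocalizationAway_monomial :
    letI := W.res.toRingHom.toAlgebra
    IsLocalization.Away (W.monomial m₀) (TorusRing K W.d) := by
  let : Algebra A (TorusRing K W.d) := W.res.toRingHom.toAlgebra
  have hres : ∀ a, algebraMap A (TorusRing K W.d) a = W.res a := fun _ => rfl
  have hunit : IsUnit (W.res (W.monomial m₀)) := by
    rw [res_monomial]
    exact IsUnit.of_mul_eq_one (AddMonoidAlgebra.single (-m₀.1) 1)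
      (by rw [AddMonoidAlgebra.single_mul_single]; simp; rfl)
  refine ⟨?_, ?_, ?_⟩
  · rintro ⟨_, n, rfl⟩
    rw [hres]
    simpa using hunit.pow n
  · intro z
    suffices h : ∃ (n : ℕ) (a : A), z * W.res (W.monomial m₀) ^ n = W.res a by
      obtain ⟨n, a, h⟩ := h
      exact ⟨(a, ⟨_, n, rfl⟩), by rw [hres, hres, ← h]; simp⟩
    induction z using AddMonoidAlgebra.induction_on with
    | of v =>
      obtain ⟨s, t, rfl⟩ := W.exists_sub_mem_weights v
      obtain ⟨n, t', h⟩ := hm₀ t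
      refine ⟨n, W.monomial (s + t'), ?_⟩
      rw [← map_pow, ← W.monomial_nsmul, h, res_monomial, res_monomial]
      simp only [AddMonoidAlgebra.of_apply, toAdd_ofAdd, AddMonoidAlgebra.single_mul_single, mul_one]
      congr 1
      push_cast
      abel
    | add x y hx hy =>
      obtain ⟨n, a, h⟩ := hx
      obtain ⟨n', a', h'⟩ := hy
      refine ⟨n + n', a * W.monomial m₀ ^ n' + a' * W.monomial m₀ ^ n, ?_⟩
      simp only [map_add, map_mul, map_pow, ← h, ← h']
      ring
    | smul r x hx =>
      obtain ⟨n, a, h⟩ := hx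
      exact ⟨n, r • a, by rw [map_smul, ← h, smul_mul_assoc]⟩
  · intro x y h
    exact ⟨1, by rw [W.res_injective h]⟩

lemma mem_torus_iff (y : Spec (CommRingCat.of A)) :
    y ∈ W.torus ↔ W.monomial m₀ ∉ y.asIdeal := by
  let : Algebra A (TorusRing K W.d) := W.res.toRingHom.toAlgebra
  have := W.isLocalizationAway_monomial hm₀
  have h1 := PrimeSpectrum.localization_away_comap_range (TorusRing K W.d) (W.monomial m₀)
  have := W.isOpenImmersion
  have h2 : y ∈ W.torus ↔ y ∈ Set.range (PrimeSpectrum.comap (algebraMap A (TorusRing K W.d))) :=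
    Iff.rfl
  rw [h2, h1]
  rfl

/-- Every monomial divides a power of an equation of the toric boundary. -/
lemma monomial_dvd_pow (s : W.weights) : ∃ n, W.monomial s ∣ W.monomial m₀ ^ n := by
  obtain ⟨n, t, h⟩ := hm₀ s
  exact ⟨n, W.monomial t, by rw [← monomial_nsmul, h, monomial_add]⟩

omit hm₀ in
/-- The components of the toric boundary are normal: their coordinate rings are retracts of that of
the toric variety, spanned by the monomials on a face. -/
lemma isIntegrallyClosed_quotient {P : Ideal A}
    (hP : P ∈ (Ideal.span {W.monomial m₀}).minimalPrimes) : IsIntegrallyClosed (A ⧸ P) := by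
  classical
  have := W.isDomain
  have := W.isIntegrallyClosed
  have hPp : P.IsPrime := hP.1.1
  -- the endomorphism that kills the monomials in `P` and fixes the others has kernel `P`
  obtain ⟨ε, hε⟩ := W.exists_algHom_monomial (B := A)
    { toFun := fun s => if W.monomial s.toAdd ∈ P then 0 else W.monomial s.toAdd
      map_one' := by
        rw [toAdd_one, monomial_zero, if_neg ((Ideal.ne_top_iff_one P).mp hPp.ne_top)]
      map_mul' := fun s t => by
        rw [toAdd_mul, monomial_add]
        by_cases hs : W.monomial s.toAdd ∈ P
        · rw [if_pos hs, if_pos (P.mul_mem_right _ hs), zero_mul]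
        · by_cases ht : W.monomial t.toAdd ∈ P
          · rw [if_pos ht, if_pos (P.mul_mem_left _ ht), mul_zero]
          · rw [if_neg hs, if_neg ht, if_neg fun h => (hPp.mem_or_mem h).elim hs ht] }
  have hε' : ∀ s, ε (W.monomial s) = if W.monomial s ∈ P then 0 else W.monomial s := hε
  have hspan : ∀ (p : A → Prop), (∀ s, p (W.monomial s)) → p 0 → (∀ x y, p x → p y → p (x + y)) →
      (∀ (c : K) x, p x → p (c • x)) → ∀ a, p a := by
    intro p h1 h2 h3 h4 a
    have ha : a ∈ Submodule.span K (Set.range W.monomial) := W.span_range_monomial ▸ trivial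
    induction ha using Submodule.span_induction with
    | mem x hx => obtain ⟨s, rfl⟩ := hx; exact h1 s
    | zero => exact h2
    | add x y _ _ hx hy => exact h3 x y hx hy
    | smul c x _ hx => exact h4 c x hx
  have hsub : ∀ a, a - ε a ∈ P := by
    refine hspan _ (fun s => ?_) ?_ (fun x y hx hy => ?_) fun c x hx => ?_
    · rw [hε']
      split_ifs with h
      · rwa [sub_zero]
      · rw [sub_self]; exact zero_mem _
    · simp
    · rw [map_add, add_sub_add_comm]; exact add_mem hx hy
    · rw [map_smul, ← smul_sub, Algebra.smul_def]; exact P.mul_mem_left _ hx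
  have hidem : ∀ a, ε (ε a) = ε a := by
    refine hspan _ (fun s => ?_) ?_ (fun x y hx hy => ?_) fun c x hx => ?_
    · rw [hε']
      split_ifs with h
      · rw [map_zero]
      · rw [hε', if_neg h]
    · simp
    · simp only [map_add, hx, hy]
    · simp only [map_smul, hx]
  have hker : RingHom.ker ε = P := by
    have hle : RingHom.ker ε ≤ P := fun a ha => by
      have := hsub a
      rwa [(RingHom.mem_ker).mp ha, sub_zero] at this
    refine le_antisymm hle (hP.2 ⟨RingHom.ker_isPrime _, ?_⟩ hle)
    rw [Ideal.span_singleton_le_iff_mem, RingHom.mem_ker, hε', if_pos]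
    exact hP.1.2 (Ideal.mem_span_singleton_self _)
  refine isIntegrallyClosed_of_retract
    (Ideal.Quotient.lift P (ε : A →+* A) fun a ha => RingHom.mem_ker.mp (hker ▸ ha))
    (Ideal.Quotient.mk P) fun x => ?_
  obtain ⟨a, rfl⟩ := Ideal.Quotient.mk_surjective x
  rw [Ideal.Quotient.lift_mk, eq_comm, Ideal.Quotient.eq]
  exact hsub a

end NormalAffineToric

end Toroidal

/-! ### Comparison of two local rings with the same completion -/

namespace Toroidal

section Primes

variable {R O C : Type*} [CommRing R] [CommRing O] [CommRing C] [Algebra R C]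
  [Algebra O C] [Module.FaithfullyFlat R C] [Module.FaithfullyFlat O C]

/-- If two ideals generate the same ideal in the common completion `C`, and if their minimal primes
stay prime in `C`, then the extensions of their minimal primes to `C` coincide. -/
lemma exists_isPrime_map_eq_map {I : Ideal R} {J : Ideal O}
    (hIJ : I.map (algebraMap R C) = J.map (algebraMap O C))
    (hI : ∀ p ∈ I.minimalPrimes, (p.map (algebraMap R C)).IsPrime)
    (hJ : ∀ q ∈ J.minimalPrimes, (q.map (algebraMap O C)).IsPrime)
    {p : Ideal R} (hp : p ∈ I.minimalPrimes) :
    ∃ q : Ideal O, q.IsPrime ∧ q.map (algebraMap O C) = p.map (algebraMap R C) := by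
  have hpC := hI p hp
  have h1 : J ≤ (p.map (algebraMap R C)).comap (algebraMap O C) := by
    rw [← Ideal.map_le_iff_le_comap, ← hIJ]
    exact Ideal.map_mono hp.1.2
  have : ((p.map (algebraMap R C)).comap (algebraMap O C)).IsPrime := Ideal.IsPrime.comap _
  obtain ⟨q, hq, hqp⟩ := Ideal.exists_minimalPrimes_le h1
  have hqC := hJ q hq
  have h2 : q.map (algebraMap O C) ≤ p.map (algebraMap R C) := Ideal.map_le_iff_le_comap.mpr hqp
  refine ⟨q, hq.1.1, le_antisymm h2 ?_⟩
  rw [Ideal.map_le_iff_le_comap]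
  refine hp.2 ⟨Ideal.IsPrime.comap _, ?_⟩ ?_
  · rw [← Ideal.map_le_iff_le_comap, hIJ]
    exact Ideal.map_mono hq.1.2
  · refine (Ideal.comap_mono h2).trans ?_
    rw [Ideal.comap_map_eq_self_of_faithfullyFlat]

/-- In a normal Noetherian domain, an associated prime of `R / h` that contains the nonzero
element `g` is minimal over `g`. -/
lemma mem_minimalPrimes_of_forall_mem_iff_dvd [IsDomain R] [IsNoetherianRing R]
    [IsIntegrallyClosed R] {h c g : R} (h0 : h ≠ 0) (g0 : g ≠ 0) {p : Ideal R} (hp : p.IsPrime)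
    (hpc : ∀ y, y ∈ p ↔ h ∣ y * c) (hg : g ∈ p) : p ∈ (Ideal.span {g}).minimalPrimes := by
  refine ⟨⟨hp, (Ideal.span_singleton_le_iff_mem _).mpr hg⟩, fun p' hp' hle => ?_⟩
  obtain ⟨hp'p, hgp'⟩ := hp'
  obtain ⟨t, ht, ht0, u, hu, htu⟩ := exists_uniformizer_of_forall_mem_iff_dvd h0 p hpc
  obtain ⟨N, s, hs, s', hs', hN⟩ := exists_mul_eq_mul_pow g0 p ht hu htu
  have h1 : s' * t ^ N ∈ p' := hN ▸ p'.mul_mem_left _ (hgp' (Ideal.mem_span_singleton_self g))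
  have h2 : t ∈ p' := hp'p.mem_of_pow_mem N ((hp'p.mem_or_mem h1).resolve_left fun h => hs' (hle h))
  intro y hy
  obtain ⟨z, hz⟩ := htu y hy
  exact (hp'p.mem_or_mem (hz ▸ p'.mul_mem_right z h2)).resolve_left fun h => hu (hle h)

/-- If `h` divides a power of `g`, and if the components of the divisor of `g` correspond to
those of an ideal of `O`, then `h` generates the same ideal of `C` as an element of `O`. -/
lemma exists_associated_algebraMap_of_dvd_pow [IsDomain R] [IsNoetherianRing R]
    [IsIntegrallyClosed R] [IsNoetherianRing O] [IsDomain C] [IsLocalRing C]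
    {g : R} (g0 : g ≠ 0) {J : Ideal O}
    (hIJ : (Ideal.span {g}).radical.map (algebraMap R C) = J.map (algebraMap O C))
    (hI : ∀ p ∈ (Ideal.span {g}).minimalPrimes, (p.map (algebraMap R C)).IsPrime)
    (hJ : ∀ q ∈ J.minimalPrimes, (q.map (algebraMap O C)).IsPrime)
    {h : R} {n : ℕ} (hgn : h ∣ g ^ n) :
    ∃ f : O, Associated (algebraMap O C f) (algebraMap R C h) := by
  have h0 : h ≠ 0 := fun h0 => pow_ne_zero n g0 (zero_dvd_iff.mp (h0 ▸ hgn))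
  refine exists_associated_algebraMap h0 fun p c hp hpc => ?_
  have hgp : g ∈ p := hp.mem_of_pow_mem n ((hpc _).mpr (hgn.mul_right c))
  have hmin := mem_minimalPrimes_of_forall_mem_iff_dvd h0 g0 hp hpc hgp
  refine ⟨hI p hmin, exists_isPrime_map_eq_map hIJ ?_ hJ ?_⟩
  · rwa [Ideal.radical_minimalPrimes]
  · rwa [Ideal.radical_minimalPrimes]

end Primes

section Lift

/-- A homomorphism from a free abelian group may be corrected by elements of a subgroup `U` so as
to take values in a subgroup `H`, if this is possible for each value separately. -/
lemma exists_monoidHom_of_forall_exists {G : Type*} [CommGroup G] (H U : Subgroup G) {d : ℕ}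
    (X : Multiplicative (Fin d → ℤ) →* G) (h : ∀ v, ∃ g ∈ H, g / X v ∈ U) :
    ∃ F : Multiplicative (Fin d → ℤ) →* G, ∀ v, F v ∈ H ∧ F v / X v ∈ U := by
  choose g hg hgU using fun i : Fin d => h (Multiplicative.ofAdd (Pi.single i 1))
  -- extend the choices on the standard basis multiplicatively
  let F : Multiplicative (Fin d → ℤ) →* G :=
    { toFun := fun v => ∏ i, g i ^ (v.toAdd i)
      map_one' := by simp
      map_mul' := fun v w => by simp [zpow_add, Finset.prod_mul_distrib] }
  have hFH : ∀ v, F v ∈ H := fun v =>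
    Subgroup.prod_mem H (t := Finset.univ) (f := fun i => g i ^ v.toAdd i)
      fun i _ => Subgroup.zpow_mem _ (hg i) _
  refine ⟨F, fun v => ⟨hFH v, ?_⟩⟩
  have hF : ∀ i, F (Multiplicative.ofAdd (Pi.single i 1)) = g i := fun i => by
    change ∏ j, g j ^ ((Pi.single i 1 : Fin d → ℤ) j) = g i
    rw [Finset.prod_eq_single i (fun j _ hj => by rw [Pi.single_eq_of_ne hj, zpow_zero]) (by simp),
      Pi.single_eq_same, zpow_one]
  have hv : v = ∏ i, Multiplicative.ofAdd (Pi.single i (1 : ℤ) : Fin d → ℤ) ^ (v.toAdd i) := by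
    apply Multiplicative.toAdd.injective
    rw [toAdd_prod]
    simp only [toAdd_zpow, toAdd_ofAdd]
    ext j
    simp [Finset.sum_apply, Pi.single_apply]
  have h1 : (F / X) v ∈ U := by
    rw [hv, map_prod]
    refine Subgroup.prod_mem _ fun i _ => ?_
    rw [map_zpow]
    refine Subgroup.zpow_mem _ ?_ _
    rw [MonoidHom.div_apply, hF]
    exact hgU i
  exact h1

end Lift

end Toroidal

/-! ### Flatness of completions -/

namespace Toroidal

section

variable {R C : Type*} [CommRing R] [CommRing C] [Algebra R C] {I : Ideal R}

lemma mem_pow_smul_top_iff (k : ℕ) (c : C) :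
    c ∈ (I ^ k • ⊤ : Submodule R C) ↔ c ∈ (I.map (algebraMap R C)) ^ k := by
  rw [Ideal.smul_top_eq_map, Ideal.map_pow]
  rfl

lemma IsCompletion.bijective_mapQ (hC : IsCompletion (C := C) I) (k : ℕ) :
    Function.Bijective (Submodule.mapQ (I ^ k • ⊤ : Submodule R R) (I ^ k • ⊤ : Submodule R C)
      (Algebra.linearMap R C) (by
        rw [← Submodule.map_le_iff_le_comap, Submodule.map_smul'']
        exact Submodule.smul_mono le_rfl le_top)) := by
  constructor
  · rw [injective_iff_map_eq_zero]
    intro x hx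
    obtain ⟨r, rfl⟩ := Submodule.mkQ_surjective _ x
    rw [Submodule.mkQ_apply, Submodule.mapQ_apply, Submodule.Quotient.mk_eq_zero,
      mem_pow_smul_top_iff] at hx
    rw [Submodule.mkQ_apply, Submodule.Quotient.mk_eq_zero, smul_eq_mul, Ideal.mul_top]
    exact hC.comap_le k hx
  · intro x
    obtain ⟨c, rfl⟩ := Submodule.mkQ_surjective _ x
    obtain ⟨r, hr⟩ := hC.exists_sub_mem k c
    refine ⟨Submodule.Quotient.mk r, ?_⟩
    rw [Submodule.mapQ_apply, Submodule.mkQ_apply, eq_comm, Submodule.Quotient.eq,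
      mem_pow_smul_top_iff]
    exact hr

/-- Any completion of `R` is isomorphic to the adic completion, as a module. -/
lemma IsCompletion.nonempty_linearEquiv (hC : IsCompletion (C := C) I) :
    Nonempty (C ≃ₗ[R] AdicCompletion I R) := by
  have hcomplete : IsAdicComplete I C := (IsAdicComplete.map_algebraMap_iff I C).mp hC.isAdicComplete
  let e := fun k => LinearEquiv.ofBijective _ (hC.bijective_mapQ k)
  let f : ∀ k, C →ₗ[R] R ⧸ (I ^ k • ⊤ : Submodule R R) := fun k =>
    (e k).symm.toLinearMap ∘ₗ (I ^ k • ⊤ : Submodule R C).mkQ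
  have hf : ∀ k c r, f k c = Submodule.Quotient.mk r ↔
      c - algebraMap R C r ∈ (I ^ k • ⊤ : Submodule R C) := by
    intro k c r
    rw [← Submodule.Quotient.eq]
    exact (e k).symm_apply_eq
  let g : C →ₗ[R] AdicCompletion I R := AdicCompletion.lift I f fun {m n} hmn => by
    refine LinearMap.ext fun c => ?_
    obtain ⟨r, hr⟩ := Submodule.mkQ_surjective _ (f n c)
    rw [LinearMap.comp_apply, ← hr]
    refine Eq.symm ((hf m c r).mpr ?_)
    exact Submodule.smul_mono (Ideal.pow_le_pow_right hmn) le_rfl ((hf n c r).mp hr.symm)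
  have hg : ∀ c k, (g c).val k = f k c := fun c k => rfl
  refine ⟨LinearEquiv.ofBijective g ⟨?_, fun y => ?_⟩⟩
  · rw [injective_iff_map_eq_zero]
    intro c hc
    refine IsHausdorff.haus (inferInstance : IsHausdorff I C) c fun k => ?_
    rw [SModEq.zero]
    have := (hf k c 0).mp (by rw [← hg, hc]; rfl)
    rwa [map_zero, sub_zero] at this
  · choose r hr using fun k => Submodule.mkQ_surjective _ (y.val k)
    obtain ⟨L, hL⟩ := IsPrecomplete.prec (inferInstance : IsPrecomplete I C)
      (f := fun k => algebraMap R C (r k)) fun {m n} hmn => by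
        have h1 : AdicCompletion.transitionMap I R hmn (y.val n) = y.val m := y.2 hmn
        rw [← hr, ← hr] at h1
        have h2 : r m - r n ∈ (I ^ m • ⊤ : Submodule R R) :=
          (Submodule.Quotient.eq _).mp h1.symm
        rw [SModEq.sub_mem, ← map_sub]
        have h3 := Submodule.mem_map_of_mem (f := Algebra.linearMap R C) h2
        rw [Submodule.map_smul''] at h3
        exact Submodule.smul_mono le_rfl le_top h3
    refine ⟨L, AdicCompletion.ext fun k => ?_⟩
    rw [hg, ← hr]
    exact (hf k L (r k)).mpr ((SModEq.sub_mem).mp (hL k).symm)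

lemma IsCompletion.flat [IsNoetherianRing R] (hC : IsCompletion (C := C) I) : Module.Flat R C := by
  obtain ⟨e⟩ := hC.nonempty_linearEquiv
  exact Module.Flat.of_linearEquiv e

/-- A surjective endomorphism of a Noetherian ring is injective. -/
lemma injective_of_surjective_ringHom {S : Type*} [CommRing S] [IsNoetherianRing S] (f : S →+* S)
    (hf : Function.Surjective f) : Function.Injective f := by
  let N : ℕ →o Ideal S := ⟨fun n => RingHom.ker (f ^ n), monotone_nat_of_le_succ fun n x hx => by
    rw [RingHom.mem_ker] at hx ⊢
    rw [pow_succ', RingHom.mul_def, RingHom.comp_apply, hx, map_zero]⟩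
  obtain ⟨n, hn⟩ := monotone_stabilizes_iff_noetherian.mpr ‹IsNoetherianRing S› N
  rw [injective_iff_map_eq_zero]
  intro x hx
  have hs : Function.Surjective (f ^ n) := by
    rw [RingHom.coe_pow]
    exact hf.iterate n
  obtain ⟨y, rfl⟩ := hs x
  have h1 : y ∈ N (n + 1) := by
    change y ∈ RingHom.ker (f ^ (n + 1))
    rw [RingHom.mem_ker, pow_succ', RingHom.mul_def, RingHom.comp_apply, hx]
  rw [← hn (n + 1) (Nat.le_succ n)] at h1
  exact h1

/-- If two homomorphisms from a Noetherian ring extend the ideal `I` to the same ideal of `C`, and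
both have dense image, and if `C` is the completion of `R` with respect to the first one, then it
also is with respect to the second one. -/
lemma isCompletion_of_map_eq {R C : Type*} [CommRing R] [CommRing C] [IsNoetherianRing R]
    {I : Ideal R} (β α : R →+* C) (hC : @IsCompletion R C _ _ β.toAlgebra I)
    (hI : I.map α = I.map β) (hdense : ∀ c : C, ∃ r, c - α r ∈ I.map β) :
    @IsCompletion R C _ _ α.toAlgebra I := by
  have hcomap : ∀ k, ((I.map β) ^ k).comap β ≤ I ^ k := 
    @IsCompletion.comap_le R C _ _ β.toAlgebra I hC
  have hex : ∀ k c, ∃ r, c - β r ∈ (I.map β) ^ k :=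
    @IsCompletion.exists_sub_mem R C _ _ β.toAlgebra I hC
  have hdense' : ∀ k c, ∃ r, c - α r ∈ (I.map β) ^ k := by
    intro k
    induction k with
    | zero => exact fun c => ⟨0, by simp⟩
    | succ k ih =>
      have h1 : ∀ y ∈ (I.map β) ^ k, ∃ r, y - α r ∈ (I.map β) ^ (k + 1) := by
        intro y hy
        rw [← hI, ← Ideal.map_pow] at hy
        induction hy using Submodule.span_induction with
        | mem x hx =>
          obtain ⟨i, -, rfl⟩ := hx
          exact ⟨i, by simp⟩
        | zero => exact ⟨0, by simp⟩
        | add x y _ _ hx hy =>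
          obtain ⟨r, hr⟩ := hx
          obtain ⟨s, hs⟩ := hy
          exact ⟨r + s, by rw [map_add, add_sub_add_comm]; exact add_mem hr hs⟩
        | smul c x hx hxr =>
          obtain ⟨r, hr⟩ := hxr
          obtain ⟨s, hs⟩ := hdense c
          refine ⟨s * r, ?_⟩
          have hx' : x ∈ (I.map β) ^ k := by
            rw [← hI, ← Ideal.map_pow]; exact hx
          have h2 := Ideal.mul_mem_mul hs hx'
          rw [← pow_succ'] at h2
          have h3 := add_mem h2 (Ideal.mul_mem_left _ (α s) hr)
          convert h3 using 1
          rw [smul_eq_mul, map_mul]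
          ring
      intro c
      obtain ⟨r, hr⟩ := ih c
      obtain ⟨s, hs⟩ := h1 _ hr
      exact ⟨r + s, by rwa [map_add, ← sub_sub]⟩
  have hle : ∀ (γ : R →+* C), I.map γ = I.map β → ∀ k, I ^ k ≤ ((I.map β) ^ k).comap γ :=
    fun γ hγ k => by rw [← Ideal.map_le_iff_le_comap, Ideal.map_pow, hγ]
  refine @IsCompletion.mk R C _ _ α.toAlgebra I ?_ (fun k => ?_) (fun k c => ?_)
  · change IsAdicComplete (I.map α) C
    rw [hI]
    exact @IsCompletion.isAdicComplete R C _ _ β.toAlgebra I hC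
  · change ((I.map α) ^ k).comap α ≤ I ^ k
    rw [hI]
    let θ : R ⧸ I ^ k ≃+* C ⧸ (I.map β) ^ k := RingEquiv.ofBijective
      (Ideal.quotientMap ((I.map β) ^ k) β (hle β rfl k)) ⟨Ideal.quotientMap_injective' (hcomap k),
        fun x => by
          obtain ⟨c, rfl⟩ := Ideal.Quotient.mk_surjective x
          obtain ⟨r, hr⟩ := hex k c
          exact ⟨Ideal.Quotient.mk _ r, (Ideal.Quotient.eq.mpr hr).symm⟩⟩
    have hsurj : Function.Surjective
        (θ.symm.toRingHom.comp (Ideal.quotientMap ((I.map β) ^ k) α (hle α hI k))) := by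
      rw [RingHom.coe_comp]
      refine θ.symm.surjective.comp fun x => ?_
      obtain ⟨c, rfl⟩ := Ideal.Quotient.mk_surjective x
      obtain ⟨r, hr⟩ := hdense' k c
      exact ⟨Ideal.Quotient.mk _ r, (Ideal.Quotient.eq.mpr hr).symm⟩
    have hinj := injective_of_surjective_ringHom _ hsurj
    rw [RingHom.coe_comp] at hinj
    intro r hr
    have h1 : Ideal.quotientMap ((I.map β) ^ k) α (hle α hI k) (Ideal.Quotient.mk _ r) = 0 := by
      rw [Ideal.quotientMap_mk]
      exact Ideal.Quotient.eq_zero_iff_mem.mpr hr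
    rw [← map_zero (Ideal.quotientMap ((I.map β) ^ k) α (hle α hI k))] at h1
    exact Ideal.Quotient.eq_zero_iff_mem.mp (hinj.of_comp h1)
  · change ∃ r, c - α r ∈ (I.map α) ^ k
    rw [hI]
    exact hdense' k c

/-- Flatness descends along a faithfully flat extension of the target. -/
lemma flat_of_flat_of_faithfullyFlat {R O C : Type*} [CommRing R] [CommRing O] [CommRing C]
    [Algebra R O] [Algebra O C] [Algebra R C] [IsScalarTower R O C] [Module.Flat R C]
    [Module.FaithfullyFlat O C] : Module.Flat R O := by
  rw [Module.Flat.iff_lTensor_preserves_injective_linearMap]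
  intro N N' _ _ _ _ f hf
  have h1 : Function.Injective (f.baseChange O) ↔ Function.Injective (f.lTensor O) := Iff.rfl
  rw [← h1, ← Module.FaithfullyFlat.lTensor_injective_iff_injective O C]
  have h2 : Function.Injective (f.lTensor C) := Module.Flat.lTensor_preserves_injective_linearMap f hf
  let e := fun (N : Type _) [AddCommGroup N] [Module R N] =>
    (TensorProduct.AlgebraTensorModule.cancelBaseChange R O C C N)
  have h3 : ∀ x, e N' ((f.baseChange O).lTensor C x) = f.lTensor C (e N x) := by
    intro x
    induction x with
    | zero => simp
    | add x y hx hy => simp only [map_add, hx, hy]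
    | tmul c y =>
      induction y with
      | zero => simp
      | add x y hx hy => simp only [TensorProduct.tmul_add, map_add, hx, hy]
      | tmul o n => simp [e]
  intro x y hxy
  apply (e N).injective
  apply h2
  rw [← h3, ← h3, hxy]

end

end Toroidal

/-! ### Coordinates on the other local ring -/

namespace Toroidal

namespace NormalAffineToric

variable {K : Type u} [Field K] {A : Type u} [CommRing A] [Algebra K A] (W : NormalAffineToric K A)
  {O C : Type*} [CommRing O] [Algebra K O] [CommRing C] [IsDomain C] [IsLocalRing C]
  [Algebra O C] [Module.FaithfullyFlat O C] (ξ : A →+* C)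

/-- A homomorphism that does not vanish on monomials determines characters of the torus with values
in any field containing the target. -/
lemma exists_characters (hξ : Function.Injective ξ) (L : Type*) [Field L] [Algebra C L]
    [IsFractionRing C L] : ∃ X : Multiplicative (Fin W.d → ℤ) →* Lˣ, ∀ s : W.weights,
      (X (Multiplicative.ofAdd s.1) : L) = algebraMap C L (ξ (W.monomial s)) := by
  obtain ⟨m₀, hm₀⟩ := W.exists_weight_forall_exists_nsmul_eq_add
  let : Algebra A (TorusRing K W.d) := W.res.toRingHom.toAlgebra
  have := W.isLocalizationAway_monomial hm₀
  have hL : Function.Injective (algebraMap C L) := IsFractionRing.injective C L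
  have h0 : IsUnit ((algebraMap C L).comp ξ (W.monomial m₀)) := by
    refine isUnit_iff_ne_zero.mpr fun h0 => W.monomial_ne_zero m₀ (hξ (hL ?_))
    rw [map_zero, map_zero]
    exact h0
  let Λ : TorusRing K W.d →+* L := IsLocalization.Away.lift (W.monomial m₀) h0
  refine ⟨(MonoidHom.comp (Λ : TorusRing K W.d →* L)
    (AddMonoidAlgebra.of K (Fin W.d → ℤ))).toHomUnits, fun s => ?_⟩
  rw [MonoidHom.coe_toHomUnits]
  change Λ (AddMonoidAlgebra.single s.1 1) = _
  rw [← W.res_monomial]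
  exact IsLocalization.Away.lift_eq (W.monomial m₀) _ _

omit [IsDomain C] [Module.FaithfullyFlat O C] in
/-- If `O` is dense in `C`, then units of `C` are corrected by elements of `O` to units congruent to
`1` modulo the square of the maximal ideal. -/
lemma exists_unit_sub_one_mem_of_associated {c : C}
    (hdense : ∀ c : C, ∃ o : O, c - algebraMap O C o ∈ IsLocalRing.maximalIdeal C ^ 2)
    (h : ∃ f : O, Associated (algebraMap O C f) c) :
    ∃ (f : O) (υ : Cˣ), (υ : C) - 1 ∈ IsLocalRing.maximalIdeal C ^ 2 ∧
      algebraMap O C f = υ * c := by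
  obtain ⟨f, υ, hυ⟩ := h
  obtain ⟨o, ho⟩ := hdense υ
  have h1 : ((υ⁻¹ : Cˣ) : C) * algebraMap O C o - 1 ∈ IsLocalRing.maximalIdeal C ^ 2 := by
    have := Ideal.mul_mem_left _ (-((υ⁻¹ : Cˣ) : C)) ho
    convert this using 1
    linear_combination υ.inv_mul
  have h2 : IsUnit (((υ⁻¹ : Cˣ) : C) * algebraMap O C o) := by
    rw [← sub_add_cancel (((υ⁻¹ : Cˣ) : C) * algebraMap O C o) 1]
    refine IsLocalRing.isUnit_of_mem_nonunits_one_sub_self _ ?_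
    rw [sub_add_cancel, ← IsLocalRing.mem_maximalIdeal, ← neg_mem_iff, neg_sub]
    exact Ideal.pow_le_self two_ne_zero h1
  refine ⟨f * o, h2.unit, h1, ?_⟩
  rw [IsUnit.unit_spec, map_mul, ← hυ]
  linear_combination -(algebraMap O C f * algebraMap O C o) * υ.inv_mul

omit [IsLocalRing C] in
/-- An element of `C` that lies in the fraction field of `O` lies in `O`. -/
lemma exists_algebraMap_eq_of_mul_eq {a b : O} {c : C} (hb : b ≠ 0)
    (h : algebraMap O C a = algebraMap O C b * c) : ∃ o : O, algebraMap O C o = c := by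
  have hinj : Function.Injective (algebraMap O C) := FaithfulSMul.algebraMap_injective O C
  have h4 : a ∈ Ideal.span {b} := by
    rw [← Ideal.comap_map_eq_self_of_faithfullyFlat (B := C) (Ideal.span {b}), Ideal.mem_comap,
      Ideal.map_span, Set.image_singleton, Ideal.mem_span_singleton]
    exact ⟨_, h⟩
  obtain ⟨o, rfl⟩ := Ideal.mem_span_singleton.mp h4
  refine ⟨o, ?_⟩
  rw [map_mul] at h
  refine mul_left_cancel₀ ?_ h
  rwa [Ne, map_eq_zero_iff _ hinj]

/-- Suppose that every monomial is associated in `C` to an element of `O`. Since the group of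
characters is free, these elements may be chosen multiplicatively, and the units may be taken
congruent to `1` modulo the square of the maximal ideal; then they define a homomorphism from the
coordinate ring of the toric variety to `O`. -/
lemma exists_algHom_of_forall_associated (hξ : Function.Injective ξ)
    (hdense : ∀ c : C, ∃ o : O, c - algebraMap O C o ∈ IsLocalRing.maximalIdeal C ^ 2)
    (h : ∀ s, ∃ f : O, Associated (algebraMap O C f) (ξ (W.monomial s))) :
    ∃ ψ : A →ₐ[K] O, ∀ s, ∃ υ : C, υ - 1 ∈ IsLocalRing.maximalIdeal C ^ 2 ∧
      algebraMap O C (ψ (W.monomial s)) = υ * ξ (W.monomial s) := by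
  let L := FractionRing C
  have hinj : Function.Injective (algebraMap O C) := FaithfulSMul.algebraMap_injective O C
  have : IsDomain O := hinj.isDomain
  have hL : Function.Injective (algebraMap C L) := IsFractionRing.injective C L
  have hξ0 : ∀ s, ξ (W.monomial s) ≠ 0 := fun s => by
    rw [Ne, map_eq_zero_iff _ hξ]; exact W.monomial_ne_zero s
  obtain ⟨X, hX⟩ := W.exists_characters ξ hξ L
  have hLO : Function.Injective ((algebraMap C L).comp (algebraMap O C)) := by
    rw [RingHom.coe_comp]; exact hL.comp hinj
  let g : FractionRing O →+* L := IsFractionRing.lift hLO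
  have hg : ∀ o : O, g (algebraMap O _ o) = algebraMap C L (algebraMap O C o) := fun o =>
    IsFractionRing.lift_algebraMap hLO o
  -- in the units of the fraction field of `C`, the group `H` consists of the elements coming from
  -- the fraction field of `O`, and `V` of the units of `C` that are `1` modulo the square of the
  -- maximal ideal
  let H : Subgroup Lˣ := (Units.map (g : FractionRing O →* L)).range
  let V : Subgroup Lˣ := (Units.map (Ideal.Quotient.mk (IsLocalRing.maximalIdeal C ^ 2) :
    C →* C ⧸ IsLocalRing.maximalIdeal C ^ 2)).ker.map (Units.map (algebraMap C L : C →* L))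
  have hmem := fun s => exists_unit_sub_one_mem_of_associated hdense (h s)
  have hHV : ∀ v, ∃ e ∈ H, e / X v ∈ V := by
    intro v
    obtain ⟨s, t, hst⟩ := W.exists_sub_mem_weights v.toAdd
    obtain ⟨f, υ, hυ, hf⟩ := hmem s
    obtain ⟨f', υ', hυ', hf'⟩ := hmem t
    have hne : ∀ (f : O) (υ : Cˣ) s, algebraMap O C f = υ * ξ (W.monomial s) →
        algebraMap O (FractionRing O) f ≠ 0 := by
      intro f υ s hf h0
      rw [FaithfulSMul.algebraMap_eq_zero_iff] at h0
      rw [h0, map_zero] at hf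
      exact mul_ne_zero υ.ne_zero (hξ0 s) hf.symm
    let y : ∀ f : O, algebraMap O (FractionRing O) f ≠ 0 → Lˣ := fun f hf =>
      Units.map (g : FractionRing O →* L) (Units.mk0 _ hf)
    have hy : ∀ (f : O) (υ : Cˣ) s (hf : algebraMap O C f = υ * ξ (W.monomial s)),
        (υ : C) - 1 ∈ IsLocalRing.maximalIdeal C ^ 2 →
        y f (hne f υ s hf) / X (Multiplicative.ofAdd s.1) ∈ V := by
      intro f υ s hf hυ
      refine ⟨υ, ?_, ?_⟩
      · rw [SetLike.mem_coe, MonoidHom.mem_ker]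
        exact Units.ext (Ideal.Quotient.eq.mpr hυ)
      · rw [eq_div_iff_mul_eq']
        apply Units.ext
        rw [Units.val_mul, hX]
        change algebraMap C L υ * algebraMap C L (ξ (W.monomial s)) = g (algebraMap O _ f)
        rw [hg, hf, map_mul]
    refine ⟨y f (hne f υ s hf) / y f' (hne f' υ' t hf'),
      H.div_mem ⟨_, rfl⟩ ⟨_, rfl⟩, ?_⟩
    have hv : v = Multiplicative.ofAdd s.1 / Multiplicative.ofAdd t.1 := by
      rw [← ofAdd_sub, ← hst, ofAdd_toAdd]
    rw [hv, map_div, div_div_div_comm]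
    exact V.div_mem (hy f υ s hf hυ) (hy f' υ' t hf' hυ')
  obtain ⟨F, hF⟩ := exists_monoidHom_of_forall_exists H V X hHV
  -- on monomials `F` takes values in `C` and in the fraction field of `O`, hence in `O`
  have hFO : ∀ s : W.weights, ∃ (o : O) (υ : C), υ - 1 ∈ IsLocalRing.maximalIdeal C ^ 2 ∧
      algebraMap O C o = υ * ξ (W.monomial s) ∧
      algebraMap C L (algebraMap O C o) = F (Multiplicative.ofAdd s.1) := by
    intro s
    obtain ⟨⟨e, he⟩, υ, hυ, hυF⟩ := hF (Multiplicative.ofAdd s.1)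
    have hυ1 : (υ : C) - 1 ∈ IsLocalRing.maximalIdeal C ^ 2 := by
      rw [SetLike.mem_coe, MonoidHom.mem_ker] at hυ
      exact Ideal.Quotient.eq.mp (congrArg Units.val hυ)
    have h1 : (F (Multiplicative.ofAdd s.1) : L) = algebraMap C L (υ * ξ (W.monomial s)) := by
      rw [eq_div_iff_mul_eq'] at hυF
      rw [← hυF, Units.val_mul, hX, map_mul]
      rfl
    obtain ⟨a, b, hb, hab⟩ := IsFractionRing.div_surjective (A := O) (e : FractionRing O)
    have hb0 : algebraMap O (FractionRing O) b ≠ 0 := by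
      rw [Ne, FaithfulSMul.algebraMap_eq_zero_iff]; exact nonZeroDivisors.ne_zero hb
    have h2 : algebraMap O C a = algebraMap O C b * (υ * ξ (W.monomial s)) := by
      apply hL
      have h3 : g (e : FractionRing O) = F (Multiplicative.ofAdd s.1) := congrArg Units.val he
      rw [map_mul, ← h1, ← h3, ← hab, ← hg, ← hg, ← map_mul, mul_div_cancel₀ _ hb0]
    obtain ⟨o, h5⟩ := exists_algebraMap_eq_of_mul_eq (nonZeroDivisors.ne_zero hb) h2
    exact ⟨o, υ, hυ1, h5, by rw [h5, h1]⟩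
  choose G υ hυ hG hGF using hFO
  have hinj' : Function.Injective fun o : O => algebraMap C L (algebraMap O C o) := hL.comp hinj
  obtain ⟨ψ, hψ⟩ := W.exists_algHom_monomial (B := O)
    { toFun := fun s => G s.toAdd
      map_one' := hinj' (by
        change algebraMap C L (algebraMap O C (G 0)) = _
        rw [hGF]
        change ((F 1 : Lˣ) : L) = algebraMap C L (algebraMap O C 1)
        rw [map_one, map_one, map_one, Units.val_one])
      map_mul' := fun s t => hinj' (by
        change algebraMap C L (algebraMap O C (G (s.toAdd + t.toAdd))) = _
        simp only [map_mul, hGF]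
        rw [← Units.val_mul, ← map_mul]
        rfl) }
  exact ⟨ψ, fun s => ⟨υ s, hυ s, by rw [hψ]; exact hG s⟩⟩

end NormalAffineToric

end Toroidal

/-! ### A criterion for étaleness in a common completion -/

namespace Toroidal

open IsLocalRing

section

variable {R O C : Type*} [CommRing R] [CommRing O] [CommRing C] [IsLocalRing R] [IsLocalRing O]
  [IsLocalRing C] [IsNoetherianRing R] [Algebra R O] [Algebra O C] [Module.FaithfullyFlat O C]
  {β : R →+* C}

lemma map_maximalIdeal_le_of_faithfullyFlat :
    (maximalIdeal O).map (algebraMap O C) ≤ maximalIdeal C := by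
  refine IsLocalRing.le_maximalIdeal fun h => ?_
  have := Ideal.comap_map_eq_self_of_faithfullyFlat (B := C) (maximalIdeal O)
  rw [h, Ideal.comap_top] at this
  exact (maximalIdeal.isMaximal O).ne_top this.symm

/-- By Nakayama's lemma, a homomorphism that agrees with `β` to first order also generates the
maximal ideal. -/
lemma map_maximalIdeal_eq_of_sub_mem {α : R →+* C} (hβ : (maximalIdeal R).map β = maximalIdeal C)
    (h : ∀ r, α r - β r ∈ maximalIdeal C ^ 2) : (maximalIdeal R).map α = maximalIdeal C := by
  have h1 : (maximalIdeal R).map α ≤ maximalIdeal C := Ideal.map_le_iff_le_comap.mpr fun r hr => by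
    have h2 := add_mem (Ideal.pow_le_self two_ne_zero (h r)) (hβ ▸ Ideal.mem_map_of_mem β hr)
    rwa [sub_add_cancel] at h2
  refine le_antisymm h1 ?_
  have hfg : (maximalIdeal C).FG := hβ ▸ ((isNoetherianRing_iff_ideal_fg R).mp ‹_› _).map β
  refine Submodule.le_of_le_smul_of_le_jacobson_bot hfg
    (IsLocalRing.jacobson_eq_maximalIdeal ⊥ bot_ne_top).ge ?_
  rw [smul_eq_mul, ← pow_two]
  conv_lhs => rw [← hβ]
  refine Ideal.map_le_iff_le_comap.mpr fun r hr => ?_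
  rw [Ideal.mem_comap, ← sub_sub_cancel (α r) (β r)]
  exact sub_mem (Submodule.mem_sup_left (Ideal.mem_map_of_mem α hr)) (Submodule.mem_sup_right (h r))

/-- Suppose that `C` is the completion of the local ring `R` and is faithfully flat over the
`R`-algebra `O`. If the resulting homomorphism from `R` to `C` agrees with the completion to first
order, then it is a completion of `R` too. -/
lemma isCompletion_of_sub_mem (hC : @IsCompletion R C _ _ β.toAlgebra (maximalIdeal R))
    (hβ : (maximalIdeal R).map β = maximalIdeal C)
    (h : ∀ r, algebraMap O C (algebraMap R O r) - β r ∈ maximalIdeal C ^ 2) :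
    @IsCompletion R C _ _ ((algebraMap O C).comp (algebraMap R O)).toAlgebra (maximalIdeal R) := by
  have h1 := map_maximalIdeal_eq_of_sub_mem (α := (algebraMap O C).comp (algebraMap R O)) hβ h
  refine isCompletion_of_map_eq β _ hC (h1.trans hβ.symm) fun c => ?_
  obtain ⟨r, hr⟩ := @IsCompletion.exists_sub_mem R C _ _ β.toAlgebra (maximalIdeal R) hC 1 c
  refine ⟨r, ?_⟩
  rw [pow_one] at hr
  have hr' : c - β r ∈ (maximalIdeal R).map β := hr
  rw [hβ] at hr' ⊢
  have h2 := sub_mem hr' (Ideal.pow_le_self two_ne_zero (h r))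
  rwa [sub_sub_sub_cancel_right] at h2

section

variable (hβ : (maximalIdeal R).map β = maximalIdeal C)
  (h : ∀ r, algebraMap O C (algebraMap R O r) - β r ∈ maximalIdeal C ^ 2)
include hβ h

lemma map_maximalIdeal_eq_maximalIdeal_of_sub_mem :
    (maximalIdeal R).map (algebraMap R O) = maximalIdeal O := by
  have h1 := map_maximalIdeal_eq_of_sub_mem (α := (algebraMap O C).comp (algebraMap R O)) hβ h
  have h2 : ((maximalIdeal R).map (algebraMap R O)).map (algebraMap O C) = maximalIdeal C := by
    rw [Ideal.map_map, h1]
  have h3 := Ideal.comap_map_eq_self_of_faithfullyFlat (B := C)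
    ((maximalIdeal R).map (algebraMap R O))
  rw [h2] at h3
  refine le_antisymm (IsLocalRing.le_maximalIdeal fun h4 => ?_) ?_
  · rw [h4, Ideal.map_top] at h2
    exact (maximalIdeal.isMaximal C).ne_top h2.symm
  · rw [← h3, ← Ideal.map_le_iff_le_comap]
    exact map_maximalIdeal_le_of_faithfullyFlat

lemma isLocalHom_of_sub_mem : IsLocalHom (algebraMap R O) := by
  have := map_maximalIdeal_eq_maximalIdeal_of_sub_mem hβ h
  exact ((local_hom_TFAE (algebraMap R O)).out 0 2 rfl rfl).mpr this.le

lemma exists_sub_mem_of_sub_mem (hd : ∀ c, ∃ r, c - β r ∈ maximalIdeal C) (o : O) :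
    ∃ r, o - algebraMap R O r ∈ maximalIdeal O := by
  obtain ⟨r, hr⟩ := hd (algebraMap O C o)
  refine ⟨r, ?_⟩
  have h2 := sub_mem hr (Ideal.pow_le_self two_ne_zero (h r))
  rw [sub_sub_sub_cancel_right, ← map_sub] at h2
  by_contra h3
  have h4 : IsUnit (o - algebraMap R O r) := by
    rwa [IsLocalRing.mem_maximalIdeal, mem_nonunits_iff, not_not] at h3
  exact (IsLocalRing.mem_maximalIdeal _).mp h2 (h4.map _)

end

lemma bijective_algebraMap_residueField_tensor [IsLocalHom (algebraMap R O)]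
    (hm : (maximalIdeal R).map (algebraMap R O) = maximalIdeal O)
    (hd : ∀ o : O, ∃ r, o - algebraMap R O r ∈ maximalIdeal O) :
    Function.Bijective (algebraMap (ResidueField R) (ResidueField R ⊗[R] O)) := by
  constructor
  · have : Nontrivial (ResidueField R ⊗[R] O) := by
      let f : ResidueField R ⊗[R] O →ₐ[R] ResidueField O := Algebra.TensorProduct.lift
        (IsScalarTower.toAlgHom R (ResidueField R) (ResidueField O))
        (IsScalarTower.toAlgHom R O (ResidueField O)) fun _ _ => Commute.all _ _
      exact f.toRingHom.domain_nontrivial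
    exact (algebraMap (ResidueField R) (ResidueField R ⊗[R] O)).injective
  · intro x
    induction x with
    | zero => exact ⟨0, map_zero _⟩
    | add x y hx hy =>
      obtain ⟨a, rfl⟩ := hx
      obtain ⟨b, rfl⟩ := hy
      exact ⟨a + b, map_add _ _ _⟩
    | tmul k o =>
      obtain ⟨r, hr⟩ := hd o
      refine ⟨k * algebraMap R _ r, ?_⟩
      have h1 : (1 : ResidueField R) ⊗ₜ[R] (o - algebraMap R O r) = 0 := by
        rw [← hm] at hr
        generalize o - algebraMap R O r = y at hr
        induction hr using Submodule.span_induction with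
        | mem x hx =>
          obtain ⟨i, hi, rfl⟩ := hx
          rw [Algebra.algebraMap_eq_smul_one, TensorProduct.tmul_smul, TensorProduct.smul_tmul',
            ← Algebra.algebraMap_eq_smul_one]
          have : algebraMap R (ResidueField R) i = 0 := (residue_eq_zero_iff i).mpr hi
          rw [this, TensorProduct.zero_tmul]
        | zero => exact TensorProduct.tmul_zero _ _
        | add x y _ _ hx hy => rw [TensorProduct.tmul_add, hx, hy, add_zero]
        | smul c x _ hx =>
          rw [smul_eq_mul, ← one_mul (1 : ResidueField R), ← Algebra.TensorProduct.tmul_mul_tmul,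
            hx, mul_zero]
      have h2 : k ⊗ₜ[R] o = k ⊗ₜ[R] algebraMap R O r := by
        rw [← sub_eq_zero, ← TensorProduct.tmul_sub]
        have h3 := congrArg (fun z => (k ⊗ₜ[R] (1 : O)) * z) h1
        simpa only [Algebra.TensorProduct.tmul_mul_tmul, mul_one, one_mul, mul_zero] using h3
      rw [h2, Algebra.TensorProduct.algebraMap_apply, Algebra.algebraMap_self, RingHom.id_apply,
        Algebra.algebraMap_eq_smul_one (A := O), TensorProduct.tmul_smul, TensorProduct.smul_tmul',
        Algebra.smul_def, mul_comm]

end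

/-- Let `O` be a local ring of an algebra `B` of finite presentation over `A`, lying over the local
ring `R` of `A`. If `O` and `R` have a common completion `C`, compatibly to first order, then `B` is
étale over `A` at the given point. -/
lemma formallyEtale_of_isCompletion {A B R O C : Type*} [CommRing A] [CommRing B] [CommRing R]
    [CommRing O] [CommRing C] [IsLocalRing R] [IsLocalRing O] [IsLocalRing C] [IsNoetherianRing R]
    [Algebra A B] [Algebra.FinitePresentation A B] [Algebra A R] [Algebra B O] [Algebra A O]
    [Algebra R O] [IsScalarTower A B O] [IsScalarTower A R O]
    (p : Ideal A) [p.IsPrime] [IsLocalization.AtPrime R p]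
    (q : Ideal B) [q.IsPrime] [IsLocalization.AtPrime O q]
    [Algebra O C] [Module.FaithfullyFlat O C] {β : R →+* C}
    (hC : @IsCompletion R C _ _ β.toAlgebra (maximalIdeal R))
    (hβ : (maximalIdeal R).map β = maximalIdeal C)
    (h : ∀ r, algebraMap O C (algebraMap R O r) - β r ∈ maximalIdeal C ^ 2) :
    Algebra.FormallyEtale A O := by
  have hm := map_maximalIdeal_eq_maximalIdeal_of_sub_mem hβ h
  have := isLocalHom_of_sub_mem hβ h
  have hd : ∀ o : O, ∃ r, o - algebraMap R O r ∈ maximalIdeal O :=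
    exists_sub_mem_of_sub_mem hβ h fun c => by
      obtain ⟨r, hr⟩ := @IsCompletion.exists_sub_mem R C _ _ β.toAlgebra (maximalIdeal R) hC 1 c
      rw [pow_one] at hr
      have hr' : c - β r ∈ (maximalIdeal R).map β := hr
      exact ⟨r, hβ ▸ hr'⟩
  have hflat : Module.Flat R O := by
    let : Algebra R C := ((algebraMap O C).comp (algebraMap R O)).toAlgebra
    have : IsScalarTower R O C := .of_algebraMap_eq fun _ => rfl
    have : Module.Flat R C := (isCompletion_of_sub_mem hC hβ h).flat
    exact flat_of_flat_of_faithfullyFlat (C := C)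
  have hbij := bijective_algebraMap_residueField_tensor hm hd
  have hκ : Algebra.FormallyEtale (ResidueField R) (ResidueField R ⊗[R] O) :=
    .of_equiv (AlgEquiv.ofBijective (Algebra.ofId (ResidueField R) _) hbij)
  -- the localization of `B` at the complement of `p` is finitely presented over `R`
  have hle' : p.primeCompl ≤ (Algebra.algebraMapSubmonoid B p.primeCompl).comap (algebraMap A B) :=
    Submonoid.le_comap_map _
  let P := Localization (Algebra.algebraMapSubmonoid B p.primeCompl)
  let : Algebra R P := (IsLocalization.map P (algebraMap A B) hle' : R →+* P).toAlgebra
  have : IsScalarTower A R P := .of_algebraMap_eq fun a => by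
    exact (IsLocalization.map_eq hle' a).symm
  have hle : Algebra.algebraMapSubmonoid B p.primeCompl ≤ q.primeCompl := by
    rintro _ ⟨x, hx, rfl⟩ hq
    have h1 : IsUnit (algebraMap A O x) := by
      rw [IsScalarTower.algebraMap_apply A R O]
      exact (IsLocalization.map_units R (⟨x, hx⟩ : p.primeCompl)).map _
    rw [IsScalarTower.algebraMap_apply A B O] at h1
    exact (IsLocalization.AtPrime.isUnit_to_map_iff O q _).mp h1 hq
  let f : P →+* O := IsLocalization.lift (M := Algebra.algebraMapSubmonoid B p.primeCompl)
    (g := algebraMap B O) fun y => IsLocalization.map_units O (⟨y, hle y.2⟩ : q.primeCompl)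
  let : Algebra P O := f.toAlgebra
  have : IsScalarTower B P O := .of_algebraMap_eq fun b => (IsLocalization.lift_eq _ b).symm
  have : IsScalarTower A P O := .to₁₃₄ _ B _ _
  have : IsScalarTower R P O := .of_algebraMap_eq' <| by
    apply IsLocalization.ringHom_ext p.primeCompl
    rw [RingHom.comp_assoc, ← IsScalarTower.algebraMap_eq A R P, ← IsScalarTower.algebraMap_eq A P O,
      ← IsScalarTower.algebraMap_eq A R O]
  have : IsLocalization (q.primeCompl.map (algebraMap B P)) O :=
    IsLocalization.isLocalization_of_submonoid_le P O _ _ hle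
  have : Algebra.FinitePresentation R P := by
    have : Algebra.IsPushout A R B P :=
      .symm <| Algebra.isPushout_of_isLocalization p.primeCompl _ _ _
    exact .equiv (Algebra.IsPushout.equiv A R B P)
  have hsm : Algebra.FormallySmooth R O :=
    Algebra.FormallySmooth.of_formallySmooth_residueField_tensor (P := P)
      (q.primeCompl.map (algebraMap B P))
  have hess : Algebra.EssFiniteType R O := by
    have : Algebra.EssFiniteType P O := .of_isLocalization O (q.primeCompl.map (algebraMap B P))
    exact .comp R P O
  have hun : Algebra.FormallyUnramified R O := by
    have : Algebra.IsSeparable (ResidueField R) (ResidueField O) := by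
      refine ⟨fun x => ?_⟩
      obtain ⟨o, rfl⟩ := residue_surjective x
      obtain ⟨r, hr⟩ := hd o
      rw [← residue_eq_zero_iff, map_sub, sub_eq_zero] at hr
      rw [hr]
      exact isSeparable_algebraMap (residue R r)
    exact .of_map_maximalIdeal hm
  have : Algebra.FormallyEtale R O := .of_formallyUnramified_and_formallySmooth
  have : Algebra.FormallyEtale A R := .of_isLocalization p.primeCompl
  exact .comp A R O

end Toroidal

/-! ### Comparing a local ring with a toric one -/

namespace Toroidal

open IsLocalRing

lemma isIntegrallyClosed_quotient_of_isLocalization {B O : Type*} [CommRing B] [CommRing O]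
    [Algebra B O] (M : Submonoid B) [IsLocalization M O] (Q : Ideal O) [Q.IsPrime]
    [IsIntegrallyClosed (B ⧸ Q.comap (algebraMap B O))] : IsIntegrallyClosed (O ⧸ Q) := by
  have hQ : (Q.comap (algebraMap B O)).map (algebraMap B O) = Q := IsLocalization.map_under M O Q
  have h1 : IsIntegrallyClosed (O ⧸ (Q.comap (algebraMap B O)).map (algebraMap B O)) := by
    refine isIntegrallyClosed_of_isLocalization (R := B ⧸ Q.comap (algebraMap B O)) _
      (Algebra.algebraMapSubmonoid (B ⧸ Q.comap (algebraMap B O)) M) ?_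
    rintro _ ⟨x, hx, rfl⟩
    refine mem_nonZeroDivisors_of_ne_zero fun h0 => ?_
    have h2 : x ∈ Q.comap (algebraMap B O) := Ideal.Quotient.eq_zero_iff_mem.mp h0
    exact ‹Q.IsPrime›.ne_top (Q.eq_top_of_isUnit_mem h2 (IsLocalization.map_units O (⟨x, hx⟩ : M)))
  exact IsIntegrallyClosed.of_equiv (Ideal.quotEquivOfEq hQ)

lemma IsCompletion.map_maximalIdeal {R C : Type*} [CommRing R] [CommRing C] [IsLocalRing R]
    [IsLocalRing C] [Algebra R C] [Module.FaithfullyFlat R C]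
    (hC : IsCompletion (C := C) (maximalIdeal R)) :
    (maximalIdeal R).map (algebraMap R C) = maximalIdeal C := by
  refine le_antisymm map_maximalIdeal_le_of_faithfullyFlat fun c hc => ?_
  obtain ⟨r, hr⟩ := hC.exists_sub_mem 1 c
  rw [pow_one] at hr
  have h1 : algebraMap R C r ∈ maximalIdeal C := by
    have := sub_mem hc (map_maximalIdeal_le_of_faithfullyFlat hr)
    rwa [sub_sub_cancel] at this
  have h2 : r ∈ maximalIdeal R := by
    by_contra h3
    rw [IsLocalRing.mem_maximalIdeal, mem_nonunits_iff, not_not] at h3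
    exact (IsLocalRing.mem_maximalIdeal _).mp h1 (h3.map _)
  rw [← sub_add_cancel c (algebraMap R C r)]
  exact add_mem hr (Ideal.mem_map_of_mem _ h2)

namespace NormalAffineToric

variable {K : Type u} [Field K] [IsAlgClosed K] [CharZero K] {A : Type u} [CommRing A] [Algebra K A]
  (W : NormalAffineToric K A) {m₀ : W.weights}
  (hm₀ : ∀ s : W.weights, ∃ (n : ℕ) (t : W.weights), n • m₀ = s + t)
  (p : Ideal A) [p.IsMaximal] {R : Type u} [CommRing R] [IsLocalRing R] [IsNoetherianRing R]
  [Algebra A R] [IsLocalization.AtPrime R p]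

local notation "R̂" => AdicCompletion (maximalIdeal R) R

include W p in
lemma isDomain_of_isLocalization_atPrime : IsDomain R := by
  have := W.isDomain
  exact IsLocalization.isDomain_of_atPrime R p

include W p in
lemma isIntegrallyClosed_of_isLocalization_atPrime : IsIntegrallyClosed R := by
  have := W.isDomain
  have := W.isIntegrallyClosed
  exact isIntegrallyClosed_of_isLocalization R p.primeCompl p.primeCompl_le_nonZeroDivisors

include W p in
lemma isDomain_adicCompletion : IsDomain R̂ := by
  have := W.isDomain
  have := W.finiteType
  have := W.isDomain_of_isLocalization_atPrime p (R := R)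
  have := W.isIntegrallyClosed_of_isLocalization_atPrime p (R := R)
  have : IsIntegrallyClosed (R ⧸ (⊥ : Ideal R)) :=
    IsIntegrallyClosed.of_equiv (RingEquiv.quotientBot R).symm
  have h1 := isPrime_map_adicCompletion K p (R := R) ⊥
  rw [Ideal.map_bot] at h1
  exact IsDomain.of_bot_isPrime _

include W p in
lemma injective_algebraMap_adicCompletion :
    Function.Injective ((algebraMap R R̂).comp (algebraMap A R)) := by
  have := W.isDomain
  rw [RingHom.coe_comp]
  exact (FaithfulSMul.algebraMap_injective R R̂).comp
    (IsLocalization.injective R p.primeCompl_le_nonZeroDivisors)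

include p in
/-- The components of the toric boundary are normal, so that they remain irreducible in the
completion. -/
lemma isPrime_map_adicCompletion_of_mem_minimalPrimes {P : Ideal R}
    (hP : P ∈ (Ideal.span {algebraMap A R (W.monomial m₀)}).minimalPrimes) :
    (P.map (algebraMap R R̂)).IsPrime := by
  have := W.finiteType
  have := hP.1.1
  have h1 : Ideal.span {algebraMap A R (W.monomial m₀)} =
      (Ideal.span {W.monomial m₀}).map (algebraMap A R) := by
    rw [Ideal.map_span, Set.image_singleton]
  rw [h1, IsLocalization.minimalPrimes_map p.primeCompl] at hP
  have := W.isIntegrallyClosed_quotient hP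
  have := isIntegrallyClosed_quotient_of_isLocalization p.primeCompl P
  exact isPrime_map_adicCompletion K p P

variable {B : Type u} [CommRing B] [Algebra K B] [Algebra.FiniteType K B]
  (q : Ideal B) [q.IsMaximal] {O : Type u} [CommRing O] [IsLocalRing O] [IsNoetherianRing O]
  [Algebra B O] [IsLocalization.AtPrime O q] [Algebra K O] [IsScalarTower K B O]

local notation "Ô" => AdicCompletion (maximalIdeal O) O

include hm₀ p q in
/-- Suppose that the local ring `O` of a variety has the same completion as the local ring `R` of
a toric variety, compatibly with the ideal `J` and the ideal of the toric boundary. If the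
components of `J` are normal, then the coordinate ring of the toric variety maps to `O`, in a way
that is compatible to first order with the given isomorphism of completions. -/
theorem exists_algHom_of_ringEquiv {J : Ideal O}
    (hJ : ∀ Q ∈ J.minimalPrimes, IsIntegrallyClosed (O ⧸ Q)) (φ : Ô ≃+* R̂)
    (hφK : ∀ c : K, φ (algebraMap O Ô (algebraMap K O c)) =
      algebraMap R R̂ (algebraMap A R (algebraMap K A c)))
    (hφ : (J.map (algebraMap O Ô)).map (φ : Ô →+* R̂) =
      (Ideal.span {algebraMap A R (W.monomial m₀)}).radical.map (algebraMap R R̂)) :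
    ∃ ψ : A →ₐ[K] O,
      (∀ a, φ (algebraMap O Ô (ψ a)) - algebraMap R R̂ (algebraMap A R a) ∈ maximalIdeal R̂ ^ 2) ∧
      Associated (φ (algebraMap O Ô (ψ (W.monomial m₀))))
        (algebraMap R R̂ (algebraMap A R (W.monomial m₀))) := by
  have := W.isDomain
  have := W.isDomain_of_isLocalization_atPrime p (R := R)
  have := W.isIntegrallyClosed_of_isLocalization_atPrime p (R := R)
  have : IsDomain R̂ := W.isDomain_adicCompletion p
  let ξ : A →+* R̂ := (algebraMap R R̂).comp (algebraMap A R)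
  have hξ : Function.Injective ξ := W.injective_algebraMap_adicCompletion p
  let : Algebra O R̂ := ((φ : Ô →+* R̂).comp (algebraMap O Ô)).toAlgebra
  let e : Ô ≃ₗ[O] R̂ := 
    { φ with
      map_smul' := fun o x => by
        change φ (o • x) = φ (algebraMap O Ô o) * φ x
        rw [Algebra.smul_def, map_mul] }
  have : Module.FaithfullyFlat O R̂ := Module.FaithfullyFlat.of_linearEquiv _ _ e.symm
  have hmap : ∀ I : Ideal O, I.map (algebraMap O R̂) = (I.map (algebraMap O Ô)).map (φ : Ô →+* R̂) :=
    fun I => (Ideal.map_map _ _).symm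
  have hdense : ∀ c : R̂, ∃ o : O, c - algebraMap O R̂ o ∈ maximalIdeal R̂ ^ 2 := by
    intro c
    obtain ⟨o, ho⟩ := (isCompletion_adicCompletion (R := O)).exists_sub_mem 2 (φ.symm c)
    refine ⟨o, ?_⟩
    have h1 := Ideal.mem_map_of_mem (φ : Ô →+* R̂) ho
    rw [Ideal.map_pow, ← hmap] at h1
    have h2 := Ideal.pow_right_mono (map_maximalIdeal_le_of_faithfullyFlat (O := O) (C := R̂)) 2 h1
    rw [map_sub] at h2
    have h3 : (φ : Ô →+* R̂) (φ.symm c) = c := φ.apply_symm_apply c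
    rw [h3] at h2
    exact h2
  have hass : ∀ s, ∃ f : O, Associated (algebraMap O R̂ f) (ξ (W.monomial s)) := by
    intro s
    obtain ⟨n, hn⟩ := W.monomial_dvd_pow hm₀ s
    refine exists_associated_algebraMap_of_dvd_pow (R := R) (O := O) (C := R̂)
      (g := algebraMap A R (W.monomial m₀)) (J := J) (h := algebraMap A R (W.monomial s)) (n := n)
      ?_ ?_ ?_ ?_ ?_
    · rw [Ne, IsLocalization.to_map_eq_zero_iff R p.primeCompl_le_nonZeroDivisors]
      exact W.monomial_ne_zero m₀
    · rw [hmap, hφ]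
    · exact fun P hP => W.isPrime_map_adicCompletion_of_mem_minimalPrimes p hP
    · intro Q hQ
      have := hJ Q hQ
      have := hQ.1.1
      have := isPrime_map_adicCompletion K q Q
      rw [hmap]
      exact Ideal.map_isPrime_of_equiv φ
    · rw [← map_pow]
      exact map_dvd _ hn
  obtain ⟨ψ, hψ⟩ := W.exists_algHom_of_forall_associated (O := O) ξ hξ hdense hass
  have hmon : ∀ s, algebraMap O R̂ (ψ (W.monomial s)) - ξ (W.monomial s) ∈ maximalIdeal R̂ ^ 2 := by
    intro s
    obtain ⟨υ, hυ, h⟩ := hψ s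
    rw [h, ← sub_one_mul]
    exact Ideal.mul_mem_right _ _ hυ
  refine ⟨ψ, fun a => ?_, ?_⟩
  · have ha : a ∈ Submodule.span K (Set.range W.monomial) := W.span_range_monomial ▸ trivial
    change algebraMap O R̂ (ψ a) - ξ a ∈ maximalIdeal R̂ ^ 2
    induction ha using Submodule.span_induction with
    | mem x hx =>
      obtain ⟨s, rfl⟩ := hx
      exact hmon s
    | zero => simp
    | add x y _ _ hx hy =>
      rw [map_add, map_add, map_add, add_sub_add_comm]
      exact add_mem hx hy
    | smul c x _ hx =>
      have h1 : algebraMap O R̂ (algebraMap K O c) = ξ (algebraMap K A c) := hφK c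
      rw [Algebra.smul_def, map_mul, map_mul, map_mul, AlgHom.commutes, h1, ← mul_sub]
      exact Ideal.mul_mem_left _ _ hx
  · obtain ⟨υ, hυ, h⟩ := hψ m₀
    have h1 : IsUnit υ := by
      rw [← sub_add_cancel υ 1]
      refine IsLocalRing.isUnit_of_mem_nonunits_one_sub_self _ ?_
      rw [sub_add_cancel, ← IsLocalRing.mem_maximalIdeal, ← neg_mem_iff, neg_sub]
      exact Ideal.pow_le_self two_ne_zero hυ
    change Associated (algebraMap O R̂ (ψ (W.monomial m₀))) (ξ (W.monomial m₀))
    rw [h]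
    exact (associated_isUnit_mul_left_iff h1).mpr (Associated.refl _)

end NormalAffineToric

end Toroidal

/-! ### From the local ring to a neighbourhood -/

namespace Toroidal

open IsLocalRing

section

variable {B O : Type*} [CommRing B] [CommRing O] [Algebra B O] (q : Ideal B) [q.IsPrime]
  [IsLocalization.AtPrime O q]

/-- A homomorphism from an algebra of finite type to a local ring is defined in a neighbourhood. -/
lemma exists_algHom_localizationAway {K A : Type*} [CommRing K] [CommRing A] [Algebra K A]
    [Algebra.FiniteType K A] [IsDomain B] [Algebra K B] [Algebra K O] [IsScalarTower K B O]
    (ψ : A →ₐ[K] O) : ∃ f ∉ q, ∃ (ψ' : A →ₐ[K] Localization.Away f)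
      (j : Localization.Away f →ₐ[B] O), ∀ a, j (ψ' a) = ψ a := by
  classical
  obtain ⟨S, hS⟩ := (inferInstance : Algebra.FiniteType K A).out
  obtain ⟨f, hf⟩ := IsLocalization.exist_integer_multiples_of_finset q.primeCompl (S.image ψ)
  refine ⟨f, f.2, ?_⟩
  let j : Localization.Away (f : B) →ₐ[B] O := IsLocalization.liftAlgHom
    (M := Submonoid.powers (f : B)) (f := Algebra.ofId B O) (by
      rintro ⟨_, n, rfl⟩
      rw [map_pow]
      exact (IsLocalization.map_units O f).pow n)
  have hj : Function.Injective j := by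
    have h1 : Function.Injective (algebraMap B O) :=
      IsLocalization.injective O q.primeCompl_le_nonZeroDivisors
    rw [injective_iff_map_eq_zero]
    intro x hx
    obtain ⟨⟨b, s⟩, hb⟩ := IsLocalization.surj (Submonoid.powers (f : B)) x
    have h2 : algebraMap B O b = 0 := by
      rw [← j.commutes, ← hb, map_mul, hx, zero_mul]
    rw [map_eq_zero_iff _ h1] at h2
    rw [h2, map_zero] at hb
    exact (IsUnit.mul_left_eq_zero (IsLocalization.map_units _ s)).mp hb
  have hrange : ∀ a, ψ a ∈ (j.restrictScalars K).range := by
    have h1 : ψ.range ≤ (j.restrictScalars K).range := by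
      rw [← Algebra.map_top, ← hS, AlgHom.map_adjoin, Algebra.adjoin_le_iff]
      rintro _ ⟨a, ha, rfl⟩
      obtain ⟨b, hb⟩ := hf (ψ a) (Finset.mem_image_of_mem ψ ha)
      refine ⟨IsLocalization.mk' _ b ⟨(f : B), Submonoid.mem_powers _⟩, ?_⟩
      have h2 : algebraMap B O f * j (IsLocalization.mk' (Localization.Away (f : B)) b
          ⟨(f : B), Submonoid.mem_powers _⟩) = algebraMap B O f * ψ a := by
        rw [← j.commutes, ← map_mul, IsLocalization.mk'_spec'_mk, j.commutes, hb, j.commutes,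
          ← Algebra.smul_def]
      exact (IsLocalization.map_units O f).mul_left_cancel h2
    exact fun a => h1 ⟨a, rfl⟩
  let e := AlgEquiv.ofInjective (j.restrictScalars K) hj
  refine ⟨(e.symm : _ →ₐ[K] _).comp (ψ.codRestrict _ hrange), j, fun a => ?_⟩
  exact congrArg Subtype.val (e.apply_symm_apply (ψ.codRestrict _ hrange a))

/-- Inclusions of ideals of the local ring hold in a neighbourhood. -/
lemma exists_notMem_forall_mul_mem {I I' : Ideal B} (hI' : I'.FG)
    (h : I'.map (algebraMap B O) ≤ I.map (algebraMap B O)) :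
    ∃ t ∉ q, ∀ x ∈ I', t * x ∈ I := by
  have h1 : ∀ x : I', ∃ t ∈ q.primeCompl, t * (x : B) ∈ I := fun x =>
    (IsLocalization.algebraMap_mem_map_algebraMap_iff q.primeCompl O I x).mp
      (h (Ideal.mem_map_of_mem _ x.2))
  choose t ht hmem using h1
  obtain ⟨S, hS⟩ := hI'
  have hSI : ∀ x : S, (x : B) ∈ I' := fun x => hS ▸ Submodule.subset_span x.2
  refine ⟨∏ x : S, t ⟨x, hSI x⟩, ?_, fun x hx => ?_⟩
  · exact Submonoid.prod_mem q.primeCompl fun x _ => ht _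
  · rw [← hS] at hx
    induction hx using Submodule.span_induction with
    | mem x hx =>
      obtain ⟨c, hc⟩ := Finset.dvd_prod_of_mem (fun x : S => t ⟨x, hSI x⟩)
        (Finset.mem_univ (⟨x, hx⟩ : S))
      rw [hc, mul_right_comm]
      exact I.mul_mem_right _ (hmem ⟨x, _⟩)
    | zero => rw [mul_zero]; exact I.zero_mem
    | add x y _ _ hx hy => rw [mul_add]; exact I.add_mem hx hy
    | smul c x _ hx => rw [smul_eq_mul, mul_left_comm]; exact I.mul_mem_left _ hx

end

section

variable {A R O C : Type*} [CommRing A] [CommRing R] [CommRing O] [CommRing C]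
  [IsNoetherianRing R] [Algebra R C] [Algebra O C] [Module.FaithfullyFlat O C]

/-- If the radical of `g` and `J` extend to the same ideal of `C`, where moreover `g` is associated
to an element `f` of `O`, then `f` and `J` have the same radical. -/
lemma mem_and_exists_pow_le_of_associated {g : R} {f : O} {J : Ideal O}
    (hJ : J.map (algebraMap O C) = (Ideal.span {g}).radical.map (algebraMap R C))
    (hf : Associated (algebraMap O C f) (algebraMap R C g)) :
    f ∈ J ∧ ∃ n : ℕ, J ^ n ≤ Ideal.span {f} := by
  constructor
  · rw [← Ideal.comap_map_eq_self_of_faithfullyFlat (B := C) J, Ideal.mem_comap, hJ]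
    exact (Ideal.mem_iff_of_associated hf).mpr
      (Ideal.mem_map_of_mem _ (Ideal.le_radical (Ideal.mem_span_singleton_self g)))
  · obtain ⟨n, hn⟩ := (Ideal.span {g}).exists_radical_pow_le_of_fg
      (Ideal.fg_of_isNoetherianRing _)
    refine ⟨n, ?_⟩
    rw [← Ideal.comap_map_eq_self_of_faithfullyFlat (B := C) (Ideal.span {f}),
      ← Ideal.map_le_iff_le_comap, Ideal.map_pow, hJ, ← Ideal.map_pow]
    refine (Ideal.map_mono hn).trans ?_
    rw [Ideal.map_span, Ideal.map_span, Set.image_singleton, Set.image_singleton,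
      Ideal.span_singleton_le_span_singleton]
    exact hf.dvd

/-- A homomorphism from `A` to `O` that approximates `A → C` extends to the local ring of `A`, and
still approximates it. -/
lemma exists_ringHom_of_isLocalization [IsLocalRing O] [IsLocalRing R] [IsLocalRing C]
    [Module.FaithfullyFlat R C] [Algebra A R] (p : Ideal A) [p.IsPrime] [IsLocalization.AtPrime R p]
    (ψ : A →+* O) (hψ : ∀ a, algebraMap O C (ψ a) - algebraMap R C (algebraMap A R a) ∈
      maximalIdeal C ^ 2) :
    ∃ Ψ : R →+* O, (∀ a, Ψ (algebraMap A R a) = ψ a) ∧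
      ∀ r, algebraMap O C (Ψ r) - algebraMap R C r ∈ maximalIdeal C ^ 2 := by
  have hunit : ∀ s : p.primeCompl, IsUnit (ψ s) := by
    intro s
    by_contra h0
    have h1 : algebraMap O C (ψ s) ∈ maximalIdeal C :=
      map_maximalIdeal_le_of_faithfullyFlat (Ideal.mem_map_of_mem _ ((mem_maximalIdeal _).mpr h0))
    have h2 := sub_mem h1 (Ideal.pow_le_self two_ne_zero (hψ s))
    rw [sub_sub_cancel] at h2
    exact (mem_maximalIdeal _).mp h2 ((IsLocalization.map_units R s).map _)
  let Ψ : R →+* O := IsLocalization.lift hunit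
  have hΨ : ∀ a, Ψ (algebraMap A R a) = ψ a := fun a => IsLocalization.lift_eq hunit a
  refine ⟨Ψ, hΨ, fun r => ?_⟩
  obtain ⟨⟨a, s⟩, hr⟩ : ∃ y : A × p.primeCompl, r * algebraMap A R y.2 = algebraMap A R y.1 :=
    IsLocalization.surj p.primeCompl r
  have h1 : IsUnit (algebraMap R C (algebraMap A R s)) := (IsLocalization.map_units R s).map _
  have h2 : Ψ r * ψ s = ψ a := by rw [← hΨ, ← map_mul, hr, hΨ]
  have h3 := sub_mem (hψ a) (Ideal.mul_mem_left _ (algebraMap O C (Ψ r)) (hψ s))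
  rw [← h2, ← hr, map_mul, map_mul, mul_sub, sub_sub_sub_cancel_left, ← sub_mul] at h3
  exact (Ideal.mul_unit_mem_iff_mem _ h1).mp h3

end

namespace NormalAffineToric

variable {K : Type u} [Field K] [IsAlgClosed K] [CharZero K] {A : Type u} [CommRing A] [Algebra K A]
  (W : NormalAffineToric K A) {m₀ : W.weights}
  (hm₀ : ∀ s : W.weights, ∃ (n : ℕ) (t : W.weights), n • m₀ = s + t)
  (p : Ideal A) [p.IsMaximal] {R : Type u} [CommRing R] [IsLocalRing R] [IsNoetherianRing R]
  [Algebra A R] [IsLocalization.AtPrime R p]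

local notation "R̂" => AdicCompletion (maximalIdeal R) R

variable {B : Type u} [CommRing B] [IsDomain B] [Algebra K B] [Algebra.FiniteType K B]
  (q : Ideal B) [q.IsMaximal] {O : Type u} [CommRing O] [IsLocalRing O] [IsNoetherianRing O]
  [Algebra B O] [IsLocalization.AtPrime O q] [Algebra K O] [IsScalarTower K B O]

local notation "Ô" => AdicCompletion (maximalIdeal O) O

include hm₀ p in
/-- The algebraic form of the theorem: `B` is the coordinate ring of an affine neighbourhood of the
point `q`, and `I` is the ideal of the boundary. The ring `D` is the coordinate ring of a smaller
neighbourhood. -/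
theorem exists_etale_of_ringEquiv {I : Ideal B}
    (hI : ∀ Q ∈ (I.map (algebraMap B O)).minimalPrimes, IsIntegrallyClosed (O ⧸ Q)) (φ : Ô ≃+* R̂)
    (hφK : ∀ c : K, φ (algebraMap O Ô (algebraMap K O c)) =
      algebraMap R R̂ (algebraMap A R (algebraMap K A c)))
    (hφ : ((I.map (algebraMap B O)).map (algebraMap O Ô)).map (φ : Ô →+* R̂) =
      (Ideal.span {algebraMap A R (W.monomial m₀)}).radical.map (algebraMap R R̂)) :
    ∃ (D : Type u) (_ : CommRing D) (_ : Algebra K D) (ι : B →ₐ[K] D) (ψ : A →ₐ[K] D),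
      IsOpenImmersion (Spec.map (CommRingCat.ofHom ι.toRingHom)) ∧
      (∃ P : Ideal D, P.IsPrime ∧ P.comap ι = q) ∧ ψ.toRingHom.Etale ∧
      ∀ P : Ideal D, P.IsPrime → (ψ (W.monomial m₀) ∈ P ↔ I.map ι ≤ P) := by
  have := W.isDomain
  have := W.finiteType
  obtain ⟨ψ, hψ, hass⟩ := W.exists_algHom_of_ringEquiv hm₀ p q hI φ hφK hφ
  let : Algebra O R̂ := ((φ : Ô →+* R̂).comp (algebraMap O Ô)).toAlgebra
  let e : Ô ≃ₗ[O] R̂ :=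
    { φ with
      map_smul' := fun o x => by
        change φ (o • x) = φ (algebraMap O Ô o) * φ x
        rw [Algebra.smul_def, map_mul] }
  have : Module.FaithfullyFlat O R̂ := Module.FaithfullyFlat.of_linearEquiv _ _ e.symm
  obtain ⟨hmJ, n, hn⟩ := mem_and_exists_pow_le_of_associated (C := R̂)
    (g := algebraMap A R (W.monomial m₀)) (f := ψ (W.monomial m₀)) (J := I.map (algebraMap B O))
    ((Ideal.map_map _ _).symm.trans hφ) hass
  obtain ⟨Ψ, hΨ, hΨ'⟩ := exists_ringHom_of_isLocalization (C := R̂) p ψ.toRingHom hψ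
  -- the homomorphism `ψ` is defined on the neighbourhood where `f` is invertible
  obtain ⟨f, hf, ψ₁, j, hj⟩ := exists_algHom_localizationAway q ψ
  let D₁ := Localization.Away f
  let : Algebra D₁ O := j.toAlgebra
  have : IsScalarTower B D₁ O := .of_algebraMap_eq fun b => (j.commutes b).symm
  let : Algebra A D₁ := ψ₁.toAlgebra
  let : Algebra A O := ψ.toAlgebra
  let : Algebra R O := Ψ.toAlgebra
  have : IsScalarTower A D₁ O := .of_algebraMap_eq fun a => (hj a).symm
  have : IsScalarTower A R O := .of_algebraMap_eq fun a => (hΨ a).symm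
  have : IsScalarTower K A D₁ := .of_algebraMap_eq fun c => (ψ₁.commutes c).symm
  have : IsNoetherianRing A := Algebra.FiniteType.isNoetherianRing K A
  have : IsNoetherianRing D₁ := Algebra.FiniteType.isNoetherianRing K D₁
  have : Algebra.FiniteType A D₁ := .of_restrictScalars_finiteType K A D₁
  have : Algebra.FinitePresentation A D₁ := Algebra.FinitePresentation.of_finiteType.mp this
  let q₁ : Ideal D₁ := (maximalIdeal O).comap (algebraMap D₁ O)
  have hq₁ : q₁.comap (algebraMap B D₁) = q := by
    rw [Ideal.comap_comap, ← IsScalarTower.algebraMap_eq]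
    exact IsLocalization.AtPrime.under_maximalIdeal O q
  have : IsLocalization.AtPrime O q₁ := by
    have h1 : IsLocalization (q.primeCompl.map (algebraMap B D₁)) O :=
      IsLocalization.isLocalization_of_submonoid_le D₁ O (Submonoid.powers f) q.primeCompl
        (Submonoid.powers_le.mpr hf)
    refine IsLocalization.isLocalization_of_is_exists_mul_mem O
      (q.primeCompl.map (algebraMap B D₁)) q₁.primeCompl ?_ ?_
    · rintro _ ⟨b, hb, rfl⟩ h2
      exact hb (hq₁ ▸ h2)
    · rintro ⟨x, hx⟩
      obtain ⟨⟨b, s⟩, hb⟩ := IsLocalization.surj (Submonoid.powers f) x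
      refine ⟨algebraMap B D₁ s, b, fun hbq => ?_, by rw [mul_comm]; exact hb.symm⟩
      rw [SetLike.mem_coe, ← hq₁, Ideal.mem_comap, ← hb] at hbq
      exact hx (((inferInstance : q₁.IsPrime).mem_or_mem hbq).resolve_right fun h3 =>
        (inferInstance : q₁.IsPrime).ne_top (q₁.eq_top_of_isUnit_mem h3
          (IsLocalization.map_units D₁ s)))
  have hC := isCompletion_adicCompletion (R := R)
  have hét : Algebra.FormallyEtale A O := formallyEtale_of_isCompletion (B := D₁) (R := R) (C := R̂)
    p q₁ (β := algebraMap R R̂) ⟨hC.1, hC.2, hC.3⟩ hC.map_maximalIdeal hΨ'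
  have hét' : Algebra.IsEtaleAt A q₁ :=
    .of_equiv ((IsLocalization.algEquiv q₁.primeCompl O (Localization.AtPrime q₁)).restrictScalars A)
  obtain ⟨_, ⟨_, ⟨r, rfl⟩, rfl⟩, hr, hrloc⟩ :=
    PrimeSpectrum.isBasis_basic_opens.exists_subset_of_mem_open
      (show (⟨q₁, inferInstance⟩ : PrimeSpectrum D₁) ∈ Algebra.etaleLocus A D₁ from hét')
      Algebra.isOpen_etaleLocus
  -- on a smaller neighbourhood the monomial `m₀` defines the boundary
  let I₁ := I.map (algebraMap B D₁)
  have hI₁ : I₁.map (algebraMap D₁ O) = I.map (algebraMap B O) := by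
    rw [Ideal.map_map, ← IsScalarTower.algebraMap_eq]
  have hψ₁ : (Ideal.span {ψ₁ (W.monomial m₀)}).map (algebraMap D₁ O) =
      Ideal.span {ψ (W.monomial m₀)} := by
    rw [Ideal.map_span, Set.image_singleton, ← hj]
    rfl
  obtain ⟨s, hs, hsI⟩ := exists_notMem_forall_mul_mem (O := O) q₁ (I := I₁)
    (I' := Ideal.span {ψ₁ (W.monomial m₀)}) (Ideal.fg_of_isNoetherianRing _)
    (by rwa [hψ₁, hI₁, Ideal.span_singleton_le_iff_mem])
  obtain ⟨t, ht, htI⟩ := exists_notMem_forall_mul_mem (O := O) q₁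
    (I := Ideal.span {ψ₁ (W.monomial m₀)}) (I' := I₁ ^ n) (Ideal.fg_of_isNoetherianRing _)
    (by rwa [hψ₁, Ideal.map_pow, hI₁])
  let g : D₁ := r * (s * t)
  have hg : g ∈ q₁.primeCompl := q₁.primeCompl.mul_mem hr (q₁.primeCompl.mul_mem hs ht)
  let D := Localization.Away g
  have hétD : Algebra.Etale A D := Algebra.basicOpen_subset_etaleLocus_iff_etale.mp
    (subset_trans (PrimeSpectrum.basicOpen_mul_le_left r (s * t)) hrloc)
  refine ⟨D, inferInstance, inferInstance, IsScalarTower.toAlgHom K B D,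
    (IsScalarTower.toAlgHom K D₁ D).comp ψ₁, ?_, ?_, RingHom.etale_algebraMap.mpr hétD, ?_⟩
  · have h1 : CommRingCat.ofHom (IsScalarTower.toAlgHom K B D).toRingHom =
        CommRingCat.ofHom (algebraMap B D₁) ≫ CommRingCat.ofHom (algebraMap D₁ D) := by
      rw [← CommRingCat.ofHom_comp, ← IsScalarTower.algebraMap_eq]
      rfl
    rw [h1, Spec.map_comp]
    infer_instance
  · let k : D →+* O := IsLocalization.Away.lift g (g := algebraMap D₁ O)
      (IsLocalization.map_units O (⟨g, hg⟩ : q₁.primeCompl))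
    refine ⟨(maximalIdeal O).comap k, inferInstance, ?_⟩
    have h1 : k.comp (algebraMap B D) = algebraMap B O := by
      rw [IsScalarTower.algebraMap_eq B D₁ D, ← RingHom.comp_assoc, IsLocalization.Away.lift_comp,
        ← IsScalarTower.algebraMap_eq]
    change ((maximalIdeal O).comap k).comap (algebraMap B D) = q
    rw [Ideal.comap_comap, h1]
    exact IsLocalization.AtPrime.under_maximalIdeal O q
  · intro P hP
    have hP₁ : (P.comap (algebraMap D₁ D)).IsPrime := inferInstance
    have hgP : g ∉ P.comap (algebraMap D₁ D) := fun h1 =>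
      hP.ne_top (P.eq_top_of_isUnit_mem h1 (IsLocalization.Away.algebraMap_isUnit g))
    have hsP : s ∉ P.comap (algebraMap D₁ D) := fun h1 =>
      hgP (Ideal.mul_mem_left _ _ (Ideal.mul_mem_right _ _ h1))
    have htP : t ∉ P.comap (algebraMap D₁ D) := fun h1 =>
      hgP (Ideal.mul_mem_left _ _ (Ideal.mul_mem_left _ _ h1))
    have h1 : I.map (IsScalarTower.toAlgHom K B D) ≤ P ↔ I₁ ≤ P.comap (algebraMap D₁ D) := by
      rw [← Ideal.map_le_iff_le_comap, Ideal.map_map, ← IsScalarTower.algebraMap_eq]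
      rfl
    rw [h1]
    change ψ₁ (W.monomial m₀) ∈ P.comap (algebraMap D₁ D) ↔ _
    constructor
    · intro h2
      refine hP₁.le_of_pow_le (n := n) fun x hx => ?_
      exact (hP₁.mem_or_mem ((Ideal.span_singleton_le_iff_mem _).mpr h2 (htI x hx))).resolve_left htP
    · intro h2
      exact (hP₁.mem_or_mem (h2 (hsI _ (Ideal.mem_span_singleton_self _)))).resolve_left hsP

end NormalAffineToric

end Toroidal

/-! ### Stalks of ideals and of components -/

namespace Toroidal

open IsLocalRing

section

variable {X : Scheme.{u}}

lemma exists_affineOpens_le_inf {x : X} (V V' : X.affineOpens) (hx : x ∈ V.1) (hx' : x ∈ V'.1) :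
    ∃ (V'' : X.affineOpens), x ∈ V''.1 ∧ V'' ≤ V ∧ V'' ≤ V' := by
  obtain ⟨_, ⟨U, hU, rfl⟩, hxU, hle⟩ :=
    X.isBasis_affineOpens.exists_subset_of_mem_open (show x ∈ (V.1 ⊓ V'.1 : X.Opens) from ⟨hx, hx'⟩)
      (V.1 ⊓ V'.1).isOpen
  exact ⟨⟨U, hU⟩, hxU, fun y hy => (hle hy).1, fun y hy => (hle hy).2⟩

lemma map_germ_ideal_eq (I : X.IdealSheafData) {x : X} {V V' : X.affineOpens} (h : V' ≤ V)
    (hx : x ∈ V'.1) : (I.ideal V).map (X.presheaf.germ V.1 x (h hx)).hom =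
      (I.ideal V').map (X.presheaf.germ V'.1 x hx).hom := by
  have h1 : X.presheaf.map (homOfLE h).op ≫ X.presheaf.germ V'.1 x hx =
      X.presheaf.germ V.1 x (h hx) := X.presheaf.germ_res (homOfLE (show V'.1 ≤ V.1 from h)) x hx
  rw [← I.map_ideal h, Ideal.map_map, ← CommRingCat.hom_comp, h1]

lemma stalkIdeal_eq_map_germ (Z : Closeds X) {x : X} (V : X.affineOpens) (hx : x ∈ V.1) :
    stalkIdeal Z x =
      ((Scheme.IdealSheafData.vanishingIdeal Z).ideal V).map (X.presheaf.germ V.1 x hx).hom := by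
  refine le_antisymm (iSup₂_le fun V' hx' => ?_) (le_iSup₂_of_le V hx le_rfl)
  obtain ⟨V'', hx'', h, h'⟩ := exists_affineOpens_le_inf V V' hx hx'
  rw [map_germ_ideal_eq _ h' hx'', map_germ_ideal_eq _ h hx'']

end

/-- On an affine scheme, the stalk of the ideal of a closed subset is generated by the functions
that vanish on it. -/
lemma stalkIdeal_eq_map_vanishingIdeal {A : Type u} [CommRing A]
    (Z : Closeds (Spec (CommRingCat.of A))) (w : Spec (CommRingCat.of A)) :
    stalkIdeal Z w = (PrimeSpectrum.vanishingIdeal (R := A) (Z : Set (Spec (CommRingCat.of A)))).map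
      (StructureSheaf.toStalk A w).hom := by
  let Y := Spec (CommRingCat.of A)
  let V : Y.affineOpens := ⟨⊤, isAffineOpen_top Y⟩
  let e := Scheme.ΓSpecIso (CommRingCat.of A)
  rw [stalkIdeal_eq_map_germ Z V trivial]
  have h1 : (Scheme.IdealSheafData.vanishingIdeal Z).ideal V =
      (PrimeSpectrum.vanishingIdeal (R := A) (Z : Set (Spec (CommRingCat.of A)))).map e.inv.hom := by
    have h2 : ((Scheme.IdealSheafData.vanishingIdeal Z).ideal V).comap e.inv.hom =
        PrimeSpectrum.vanishingIdeal (R := A) (Z : Set (Spec (CommRingCat.of A))) := by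
      rw [Scheme.IdealSheafData.vanishingIdeal_ideal]
      have h3 : (isAffineOpen_top Y).fromSpec = Spec.map e.inv := by
        rw [IsAffineOpen.fromSpec_top]
        exact Scheme.isoSpec_Spec_inv _
      have h4 : ∀ y : Y, Spec.map e.inv (Spec.map e.hom y) = y := fun y => by
        rw [← Scheme.Hom.comp_apply, ← Spec.map_comp, e.inv_hom_id, Spec.map_id]
        rfl
      ext a
      rw [Ideal.mem_comap, PrimeSpectrum.mem_vanishingIdeal]
      refine Iff.trans ?_ (PrimeSpectrum.mem_vanishingIdeal (R := A) _ a).symm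
      constructor
      · intro h y hy
        have h5 := h (Spec.map e.hom y) (by
          change (isAffineOpen_top Y).fromSpec (Spec.map e.hom y) ∈ Z
          rw [h3]
          exact (h4 y).symm ▸ hy)
        have h6 : a ∈ (Spec.map e.inv (Spec.map e.hom y)).asIdeal := h5
        exact (SetLike.ext_iff.mp (congrArg PrimeSpectrum.asIdeal (h4 y)) a).mp h6
      · intro h P hP
        change (isAffineOpen_top Y).fromSpec P ∈ Z at hP
        rw [h3] at hP
        exact h _ hP
    rw [← h2, Ideal.map_comap_of_surjective]
    exact (ConcreteCategory.bijective_of_isIso e.inv).2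
  rw [h1, Ideal.map_map, ← CommRingCat.hom_comp]
  rfl

/-- The local ring at `q` of the closed subscheme defined by `Q`, computed in two ways. -/
lemma isIntegrallyClosed_quotient_of_surjective {B O S S' : Type*} [CommRing B] [CommRing O]
    [CommRing S] [CommRing S'] [Algebra B O] [Algebra S S'] (q : Ideal B) [q.IsPrime]
    [IsLocalization.AtPrime O q] (Q : Ideal O) (f : B →+* S) (hf : Function.Surjective f)
    (hker : RingHom.ker f = Q.comap (algebraMap B O)) (q' : Ideal S) [q'.IsPrime]
    [IsLocalization.AtPrime S' q'] (hq' : q'.comap f = q) [IsIntegrallyClosed S'] :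
    IsIntegrallyClosed (O ⧸ Q) := by
  let Q₀ := Q.comap (algebraMap B O)
  let e : B ⧸ Q₀ ≃+* S :=
    (Ideal.quotEquivOfEq hker.symm).trans (RingHom.quotientKerEquivOfSurjective hf)
  have he : ∀ b, e (Ideal.Quotient.mk Q₀ b) = f b := fun b => rfl
  have h1 : (Algebra.algebraMapSubmonoid (B ⧸ Q₀) q.primeCompl).map e.toMonoidHom =
      q'.primeCompl := by
    ext s
    constructor
    · rintro ⟨_, ⟨b, hb, rfl⟩, rfl⟩ h2
      exact hb (hq' ▸ h2)
    · intro hs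
      obtain ⟨b, rfl⟩ := hf s
      exact ⟨_, ⟨b, fun hb => hs (by rw [SetLike.mem_coe, ← hq'] at hb; exact hb), rfl⟩, he b⟩
  let e' : O ⧸ Q₀.map (algebraMap B O) ≃+* S' :=
    IsLocalization.ringEquivOfRingEquiv (M := Algebra.algebraMapSubmonoid (B ⧸ Q₀) q.primeCompl)
      (T := q'.primeCompl) _ _ e h1
  have hQ : Q₀.map (algebraMap B O) = Q := IsLocalization.map_under q.primeCompl O Q
  exact IsIntegrallyClosed.of_equiv (e'.symm.trans (Ideal.quotEquivOfEq hQ))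

section

variable {X : Scheme.{u}} {V : X.Opens} (hV : IsAffineOpen V)

lemma fromSpec_mem_iff_le (D : Closeds X) (P : PrimeSpectrum Γ(X, V)) :
    hV.fromSpec P ∈ D ↔ (Scheme.IdealSheafData.vanishingIdeal D).ideal ⟨V, hV⟩ ≤ P.asIdeal := by
  rw [Scheme.IdealSheafData.vanishingIdeal_ideal]
  have hcl : IsClosed (hV.fromSpec ⁻¹' (D : Set X)) := D.isClosed.preimage hV.fromSpec.continuous
  have h1 : P ∈ PrimeSpectrum.zeroLocus (PrimeSpectrum.vanishingIdeal
      (hV.fromSpec ⁻¹' (D : Set X)) : Set Γ(X, V)) ↔ P ∈ hV.fromSpec ⁻¹' (D : Set X) := by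
    rw [PrimeSpectrum.zeroLocus_vanishingIdeal_eq_closure]
    exact Set.ext_iff.mp hcl.closure_eq P
  rw [PrimeSpectrum.mem_zeroLocus] at h1
  exact h1.symm

/-- Minimal primes of the ideal of `D` on an affine open subset are the generic points of components
of `D`. -/
lemma isComponent_closure_fromSpec {D : Closeds X} {P : PrimeSpectrum Γ(X, V)}
    (hP : P.asIdeal ∈ ((Scheme.IdealSheafData.vanishingIdeal D).ideal ⟨V, hV⟩).minimalPrimes) :
    IsComponent D (Closeds.closure {hV.fromSpec P}) := by
  have hz : hV.fromSpec P ∈ D := (fromSpec_mem_iff_le hV D P).mpr hP.1.2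
  refine ⟨⟨isIrreducible_singleton.closure, ?_⟩, ?_⟩
  · exact closure_minimal (Set.singleton_subset_iff.mpr hz) D.isClosed
  · rintro T ⟨hT, hTD⟩ hle
    have ht := hT.isGenericPoint_genericPoint_closure
    let t := hT.genericPoint
    have htD : t ∈ D := closure_minimal hTD D.isClosed (ht.mem)
    have hspec : t ⤳ hV.fromSpec P :=
      ht.specializes (subset_closure (hle (subset_closure (Set.mem_singleton _))))
    have hPV : hV.fromSpec P ∈ V := by
      rw [← SetLike.mem_coe, ← hV.range_fromSpec]; exact ⟨P, rfl⟩
    have htV : t ∈ V := hspec.mem_open V.isOpen hPV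
    rw [← SetLike.mem_coe, ← hV.range_fromSpec] at htV
    obtain ⟨P', hP'⟩ := htV
    rw [← hP'] at hspec htD
    have h1 : P' ⤳ P := hV.fromSpec.isOpenEmbedding.isInducing.specializes_iff.mp hspec
    have h2 : P'.asIdeal ≤ P.asIdeal := (PrimeSpectrum.le_iff_specializes P' P).mpr h1
    have h3 : P = P' := PrimeSpectrum.ext
      (le_antisymm (hP.2 ⟨P'.2, (fromSpec_mem_iff_le hV D P').mp htD⟩ h2) h2)
    change T ⊆ closure {hV.fromSpec P}
    rw [h3, hP', ht.def]
    exact subset_closure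

lemma vanishingIdeal_closure_fromSpec (P : PrimeSpectrum Γ(X, V)) :
    (Scheme.IdealSheafData.vanishingIdeal (Closeds.closure {hV.fromSpec P})).ideal ⟨V, hV⟩ =
      P.asIdeal := by
  rw [Scheme.IdealSheafData.vanishingIdeal_ideal]
  have h1 : ∀ P : Spec Γ(X, V), hV.fromSpec ⁻¹' closure {hV.fromSpec P} = closure {P} := fun P => by
    rw [hV.fromSpec.isOpenEmbedding.isOpenMap.preimage_closure_eq_closure_preimage
      hV.fromSpec.continuous, ← Set.image_singleton,
      Set.preimage_image_eq _ hV.fromSpec.isOpenEmbedding.injective]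
  refine (congrArg (PrimeSpectrum.vanishingIdeal (R := Γ(X, V))) (h1 P)).trans ?_
  exact (PrimeSpectrum.vanishingIdeal_closure _).trans (PrimeSpectrum.vanishingIdeal_singleton P)

/-- If the components of `D` are normal, then so are the components of the ideal of `D` in a
local ring. -/
lemma isIntegrallyClosed_quotient_of_mem_minimalPrimes {D : Closeds X}
    (hD : ∀ Z : Closeds X, IsComponent D Z →
      IsNormalScheme (Scheme.IdealSheafData.vanishingIdeal Z).subscheme)
    {x : X} (hx : x ∈ V) {Q : Ideal (X.presheaf.stalk x)}
    (hQ : Q ∈ (((Scheme.IdealSheafData.vanishingIdeal D).ideal ⟨V, hV⟩).map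
      (X.presheaf.germ V x hx).hom).minimalPrimes) :
    IsIntegrallyClosed (X.presheaf.stalk x ⧸ Q) := by
  have hQp := hQ.1.1
  let : Algebra Γ(X, V) (X.presheaf.stalk x) := X.presheaf.algebra_section_stalk ⟨x, hx⟩
  let q := hV.primeIdealOf ⟨x, hx⟩
  have : IsLocalization.AtPrime (X.presheaf.stalk x) q.asIdeal := hV.isLocalization_stalk ⟨x, hx⟩
  let P : PrimeSpectrum Γ(X, V) := ⟨Q.comap (algebraMap Γ(X, V) (X.presheaf.stalk x)), inferInstance⟩
  have hP : P.asIdeal ∈ ((Scheme.IdealSheafData.vanishingIdeal D).ideal ⟨V, hV⟩).minimalPrimes := by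
    have h1 : Q ∈ (((Scheme.IdealSheafData.vanishingIdeal D).ideal ⟨V, hV⟩).map
      (algebraMap Γ(X, V) (X.presheaf.stalk x))).minimalPrimes := hQ
    rwa [IsLocalization.minimalPrimes_map q.asIdeal.primeCompl] at h1
  let Z := Closeds.closure {hV.fromSpec P}
  let J := Scheme.IdealSheafData.vanishingIdeal Z
  have hPq : P ≤ q := by
    change Q.comap _ ≤ q.asIdeal
    rw [← IsLocalization.AtPrime.under_maximalIdeal (X.presheaf.stalk x) q.asIdeal]
    exact Ideal.comap_mono (IsLocalRing.le_maximalIdeal hQp.ne_top)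
  have hxZ : x ∈ J.support := by
    rw [← SetLike.mem_coe, Scheme.IdealSheafData.coe_support_vanishingIdeal]
    have h1 : hV.fromSpec P ⤳ hV.fromSpec q :=
      ((PrimeSpectrum.le_iff_specializes P q).mp hPq).map hV.fromSpec.continuous
    rw [hV.fromSpec_primeIdealOf] at h1
    exact h1.mem_closure
  rw [← SetLike.mem_coe, ← Scheme.IdealSheafData.range_subschemeι] at hxZ
  obtain ⟨y, hy⟩ := hxZ
  have hyV : y ∈ J.subschemeι ⁻¹ᵁ V := by
    change J.subschemeι y ∈ V
    rwa [hy]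
  have hV' : IsAffineOpen (J.subschemeι ⁻¹ᵁ V) := hV.preimage J.subschemeι
  let : Algebra Γ(J.subscheme, J.subschemeι ⁻¹ᵁ V) (J.subscheme.presheaf.stalk y) :=
    J.subscheme.presheaf.algebra_section_stalk ⟨y, hyV⟩
  have : IsLocalization.AtPrime (J.subscheme.presheaf.stalk y) (hV'.primeIdealOf ⟨y, hyV⟩).asIdeal :=
    hV'.isLocalization_stalk ⟨y, hyV⟩
  have : IsIntegrallyClosed (J.subscheme.presheaf.stalk y) :=
    (hD Z (isComponent_closure_fromSpec hV hP) y).2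
  have hker : RingHom.ker (J.subschemeι.app V).hom =
      Q.comap (algebraMap Γ(X, V) (X.presheaf.stalk x)) := by
    refine (J.ker_subschemeι_app ⟨V, hV⟩).trans ?_
    exact vanishingIdeal_closure_fromSpec hV P
  refine isIntegrallyClosed_quotient_of_surjective q.asIdeal Q (J.subschemeι.app V).hom
    (J.subschemeι_app_surjective ⟨V, hV⟩) hker (hV'.primeIdealOf ⟨y, hyV⟩).asIdeal
    (S' := J.subscheme.presheaf.stalk y) ?_
  have h1 := IsAffineOpen.comap_primeIdealOf_appLE (f := J.subschemeι) V hV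
    (J.subschemeι ⁻¹ᵁ V) hV' le_rfl hyV
  rw [Scheme.Hom.appLE_eq_app] at h1
  have h2 := congrArg PrimeSpectrum.asIdeal h1
  have h3 : ∀ (x' : X) (hx' : x' ∈ V), x' = x →
      (hV.primeIdealOf ⟨x', hx'⟩).asIdeal = q.asIdeal := by
    rintro x' hx' rfl; rfl
  exact h2.trans (h3 _ _ hy)

end

end Toroidal

/-! ### Construction of the étale chart -/

namespace Toroidal

open IsLocalRing

lemma scalarsToStalk_specStr {K : Type u} [Field K] {A : Type u} [CommRing A] [Algebra K A]
    (w : Spec (CommRingCat.of A)) (c : K) : scalarsToStalk (specStr K A) w c =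
      (StructureSheaf.toStalk A w).hom (algebraMap K A c) := by
  have h1 : (Scheme.ΓSpecIso (CommRingCat.of K)).inv ≫ (specStr K A).appTop =
      CommRingCat.ofHom (algebraMap K A) ≫ (Scheme.ΓSpecIso (CommRingCat.of A)).inv :=
    (Scheme.ΓSpecIso_inv_naturality _).symm
  unfold scalarsToStalk
  rw [← Category.assoc, h1]
  rfl

lemma NormalAffineToric.stalkIdeal_boundary_torus {K : Type u} [Field K] {A : Type u} [CommRing A]
    [Algebra K A] (W : NormalAffineToric K A) {m₀ : W.weights}
    (hm₀ : ∀ s : W.weights, ∃ (n : ℕ) (t : W.weights), n • m₀ = s + t)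
    (w : Spec (CommRingCat.of A)) : stalkIdeal (boundary W.torus) w =
      (Ideal.span {W.monomial m₀}).radical.map (StructureSheaf.toStalk A w).hom := by
  have h1 : ((boundary W.torus : Closeds _) : Set (Spec (CommRingCat.of A))) =
      PrimeSpectrum.zeroLocus (R := A) (Ideal.span {W.monomial m₀}) := by
    ext y
    have h2 : y ∈ PrimeSpectrum.zeroLocus (R := A) (Ideal.span {W.monomial m₀}) ↔
        W.monomial m₀ ∈ y.asIdeal := by
      rw [PrimeSpectrum.zeroLocus_span]
      exact Set.singleton_subset_iff
    refine Iff.trans ?_ h2.symm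
    exact (not_congr (W.mem_torus_iff hm₀ y)).trans not_not
  rw [stalkIdeal_eq_map_vanishingIdeal, h1]
  congr 1
  exact PrimeSpectrum.vanishingIdeal_zeroLocus_eq_radical _

section

variable {K : Type u} [Field K] {X : Scheme.{u}} (s : X ⟶ Spec (CommRingCat.of K))
  {V : X.Opens} (hV : IsAffineOpen V)

/-- The homomorphism from the base field to the functions on an open subset. -/
noncomputable def scalarsToSections (V : X.Opens) : K →+* Γ(X, V) :=
  ((Scheme.ΓSpecIso (CommRingCat.of K)).inv ≫ s.appLE ⊤ V le_top).hom

lemma germ_scalarsToSections {x : X} (hx : x ∈ V) (c : K) :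
    (X.presheaf.germ V x hx).hom (scalarsToSections s V c) = scalarsToStalk s x c := by
  have h1 : (Scheme.ΓSpecIso (CommRingCat.of K)).inv ≫ s.appLE ⊤ V le_top ≫
      X.presheaf.germ V x hx = (Scheme.ΓSpecIso (CommRingCat.of K)).inv ≫ s.appTop ≫
        X.presheaf.germ ⊤ x trivial := by
    congr 1
    change (s.appTop ≫ X.presheaf.map (homOfLE le_top).op) ≫ X.presheaf.germ V x hx = _
    rw [Category.assoc, TopCat.Presheaf.germ_res]
  exact congrArg (fun f => f.hom c) h1

include hV

lemma finiteType_scalarsToSections [LocallyOfFiniteType s] :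
    (scalarsToSections s V).FiniteType := by
  have h1 := s.finiteType_appLE (isAffineOpen_top _) hV le_top
  refine RingHom.FiniteType.comp h1 (RingHom.FiniteType.of_surjective _ ?_)
  exact (ConcreteCategory.bijective_of_isIso (Scheme.ΓSpecIso (CommRingCat.of K)).inv).2

lemma fromSpec_comp_eq_SpecMap_scalarsToSections :
    hV.fromSpec ≫ s = Spec.map (CommRingCat.ofHom (scalarsToSections s V)) := by
  have h3 : (isAffineOpen_top (Spec (CommRingCat.of K))).fromSpec =
      Spec.map (Scheme.ΓSpecIso (CommRingCat.of K)).inv := by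
    rw [IsAffineOpen.fromSpec_top]
    exact Scheme.isoSpec_Spec_inv _
  rw [← IsAffineOpen.SpecMap_appLE_fromSpec s (isAffineOpen_top _) hV le_top, h3, ← Spec.map_comp]
  rfl

end

/-- An étale homomorphism to the coordinate ring of an open subset of `V` defines an étale
morphism on a neighbourhood. -/
lemma NormalAffineToric.exists_etale_of_algHom {K : Type u} [Field K] {X : Scheme.{u}}
    {s : X ⟶ Spec (CommRingCat.of K)} {U : X.Opens} {A : Type u} [CommRing A] [Algebra K A]
    (W : NormalAffineToric K A) {m₀ : W.weights}
    (hm₀ : ∀ s : W.weights, ∃ (n : ℕ) (t : W.weights), n • m₀ = s + t)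
    {V : X.Opens} (hV : IsAffineOpen V) {x : X} (hx : x ∈ V)
    {D : Type u} [CommRing D] [Algebra K D] (ι : Γ(X, V) →+* D) (ψ : A →ₐ[K] D)
    (hι : ∀ c, ι (scalarsToSections s V c) = algebraMap K D c)
    [IsOpenImmersion (Spec.map (CommRingCat.ofHom ι))]
    (hq : ∃ P : Ideal D, P.IsPrime ∧ P.comap ι = (hV.primeIdealOf ⟨x, hx⟩).asIdeal)
    (hψ : ψ.toRingHom.Etale)
    (h : ∀ P : Ideal D, P.IsPrime → (ψ (W.monomial m₀) ∈ P ↔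
      ((Scheme.IdealSheafData.vanishingIdeal (boundary U)).ideal ⟨V, hV⟩).map ι ≤ P)) :
    ∃ (V' : X.Opens) (π : (V' : Scheme.{u}) ⟶ Spec (CommRingCat.of A)),
      x ∈ V' ∧ Etale π ∧ π ≫ specStr K A = V'.ι ≫ s ∧ V'.ι ⁻¹ᵁ U = π ⁻¹ᵁ W.torus := by
  let j : Spec (CommRingCat.of D) ⟶ X := Spec.map (CommRingCat.ofHom ι) ≫ hV.fromSpec
  let ρ : Spec (CommRingCat.of D) ⟶ Spec (CommRingCat.of A) :=
    Spec.map (CommRingCat.ofHom ψ.toRingHom)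
  have hρ : Etale ρ := (HasRingHomProperty.Spec_iff (P := @Etale)).mpr hψ
  refine ⟨j.opensRange, j.isoOpensRange.inv ≫ ρ, ?_, inferInstance, ?_, ?_⟩
  · obtain ⟨P, hP, hPq⟩ := hq
    refine ⟨(⟨P, hP⟩ : PrimeSpectrum D), ?_⟩
    have h1 : Spec.map (CommRingCat.ofHom ι) (⟨P, hP⟩ : PrimeSpectrum D) =
        hV.primeIdealOf ⟨x, hx⟩ := PrimeSpectrum.ext hPq
    change hV.fromSpec (Spec.map (CommRingCat.ofHom ι) (⟨P, hP⟩ : PrimeSpectrum D)) = x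
    rw [h1]
    exact hV.fromSpec_primeIdealOf ⟨x, hx⟩
  · have h1 : ρ ≫ specStr K A = j ≫ s := by
      change Spec.map _ ≫ Spec.map _ = (Spec.map _ ≫ hV.fromSpec) ≫ s
      rw [Category.assoc, fromSpec_comp_eq_SpecMap_scalarsToSections s hV, ← Spec.map_comp,
        ← Spec.map_comp]
      congr 1
      ext c
      exact (ψ.commutes c).trans (hι c).symm
    rw [Category.assoc, h1, ← Category.assoc, Scheme.Hom.isoOpensRange_inv_comp]
  · ext y
    obtain ⟨z, rfl⟩ : ∃ z, j.isoOpensRange.hom z = y :=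
      ⟨j.isoOpensRange.inv y, by rw [← Scheme.Hom.comp_apply, Iso.inv_hom_id]; rfl⟩
    have h1 : j.opensRange.ι (j.isoOpensRange.hom z) = j z := by
      rw [← Scheme.Hom.comp_apply, Scheme.Hom.isoOpensRange_hom_ι]
    have h2 : (j.isoOpensRange.inv ≫ ρ) (j.isoOpensRange.hom z) = ρ z := by
      rw [← Scheme.Hom.comp_apply, Iso.hom_inv_id_assoc]
    change j.opensRange.ι (j.isoOpensRange.hom z) ∈ U ↔
      (j.isoOpensRange.inv ≫ ρ) (j.isoOpensRange.hom z) ∈ W.torus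
    rw [h1, h2, W.mem_torus_iff hm₀]
    have h3 : j z ∈ boundary U ↔ W.monomial m₀ ∈ (ρ z).asIdeal := by
      have h4 : W.monomial m₀ ∈ (ρ z).asIdeal ↔ ψ (W.monomial m₀) ∈ z.asIdeal := Iff.rfl
      rw [h4, h z.asIdeal z.isPrime, Ideal.map_le_iff_le_comap]
      exact fromSpec_mem_iff_le hV (boundary U) (Spec.map (CommRingCat.ofHom ι) z)
    rw [← h3]
    exact not_not.symm

end Toroidal

theorem mainTheorem11 {K : Type u} [Field K] [IsAlgClosed K] [CharZero K]
    {X : Scheme.{u}} (s : X ⟶ Spec (CommRingCat.of K)) (hX : Toroidal.IsVariety s)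
    (U : X.Opens) (hU : Toroidal.IsStrictToroidalEmbedding s U)
    (x : X) (hx : IsClosed ({x} : Set X))
    {A : Type u} [CommRing A] [Algebra K A] (W : Toroidal.NormalAffineToric K A)
    (w : Spec (CommRingCat.of A)) (hw : Toroidal.IsLocalToricModel s U x W w) :
    ∃ (V : X.Opens) (π : (V : Scheme.{u}) ⟶ Spec (CommRingCat.of A)),
      x ∈ V ∧ Etale π ∧ π ≫ Toroidal.specStr K A = V.ι ≫ s ∧
        V.ι ⁻¹ᵁ U = π ⁻¹ᵁ W.torus := by
  have := hX.isIntegral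
  have := hX.locallyOfFiniteType
  have := W.finiteType
  obtain ⟨hwc, φ, hφK, hφ⟩ := hw
  obtain ⟨m₀, hm₀⟩ := W.exists_weight_forall_exists_nsmul_eq_add
  obtain ⟨_, ⟨V, hV, rfl⟩, hxV, -⟩ :=
    X.isBasis_affineOpens.exists_subset_of_mem_open (Set.mem_univ x) isOpen_univ
  have : Nonempty V := ⟨⟨x, hxV⟩⟩
  let : Algebra K Γ(X, V) := (Toroidal.scalarsToSections s V).toAlgebra
  have : Algebra.FiniteType K Γ(X, V) := Toroidal.finiteType_scalarsToSections s hV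
  have : IsNoetherianRing Γ(X, V) := Algebra.FiniteType.isNoetherianRing K _
  have : IsNoetherianRing A := Algebra.FiniteType.isNoetherianRing K A
  -- the local ring of the variety
  let q := (hV.primeIdealOf ⟨x, hxV⟩).asIdeal
  have : q.IsMaximal := hV.primeIdealOf_isMaximal_of_isClosed ⟨x, hxV⟩ hx
  let : Algebra Γ(X, V) (X.presheaf.stalk x) := X.presheaf.algebra_section_stalk ⟨x, hxV⟩
  have : IsLocalization.AtPrime (X.presheaf.stalk x) q := hV.isLocalization_stalk ⟨x, hxV⟩
  have : IsNoetherianRing (X.presheaf.stalk x) := IsLocalization.isNoetherianRing q.primeCompl _ ‹_›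
  let : Algebra K (X.presheaf.stalk x) := (Toroidal.scalarsToStalk s x).toAlgebra
  have : IsScalarTower K Γ(X, V) (X.presheaf.stalk x) :=
    .of_algebraMap_eq fun c => (Toroidal.germ_scalarsToSections s hxV c).symm
  -- the local ring of the toric variety
  let p : Ideal A := w.asIdeal
  have : p.IsMaximal := (PrimeSpectrum.isClosed_singleton_iff_isMaximal w).mp hwc
  let : Algebra A ((Spec (CommRingCat.of A)).presheaf.stalk w) := StructureSheaf.stalkAlgebra A w
  have : IsLocalization.AtPrime ((Spec (CommRingCat.of A)).presheaf.stalk w) p :=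
    StructureSheaf.IsLocalization.to_stalk A w
  have : IsNoetherianRing ((Spec (CommRingCat.of A)).presheaf.stalk w) :=
    IsLocalization.isNoetherianRing p.primeCompl _ ‹_›
  have hI := Toroidal.stalkIdeal_eq_map_germ (Toroidal.boundary U) ⟨V, hV⟩ hxV
  have hC := W.stalkIdeal_boundary_torus hm₀ w
  have hC' : (Ideal.span {W.monomial m₀}).radical.map (StructureSheaf.toStalk A w).hom =
      (Ideal.span {algebraMap A ((Spec (CommRingCat.of A)).presheaf.stalk w)
        (W.monomial m₀)}).radical := by
    refine (IsLocalization.map_radical p.primeCompl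
      ((Spec (CommRingCat.of A)).presheaf.stalk w) _).trans ?_
    rw [Ideal.map_span, Set.image_singleton]
  obtain ⟨D, _, _, ι, ψ, hι, hq, hψ, hD⟩ := W.exists_etale_of_ringEquiv hm₀ p
    (R := (Spec (CommRingCat.of A)).presheaf.stalk w) q (O := X.presheaf.stalk x)
    (I := (Scheme.IdealSheafData.vanishingIdeal (Toroidal.boundary U)).ideal ⟨V, hV⟩)
    (fun Q hQ => Toroidal.isIntegrallyClosed_quotient_of_mem_minimalPrimes hV
      hU.isNormal_component hxV hQ) φ
    (fun c => (hφK c).trans (congrArg _ (Toroidal.scalarsToStalk_specStr w c)))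
    (by
      unfold Toroidal.completedIdeal at hφ
      rw [hI, hC, hC'] at hφ
      exact hφ)
  exact W.exists_etale_of_algHom hm₀ hV hxV ι.toRingHom ψ ι.commutes hq hψ hD
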